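/- **Setting.** Let $k\ge 0$, let $l(\beta,z)$ be a loss function with parameter $\beta\in\mathbb R^k$, and for each sample size $n\ge 1$ let $Z_n^1,\dots,Z_n^n$ be i.i.d. draws from a probability distribution $\mu_n$. In the local parameter $\theta=\sqrt n\,\beta$ put $l_n(\theta,z)=l(\theta/\sqrt n,z)$, $L_n(\theta)=\sum_{i=1}^n l_n(\theta,Z_n^i)$ and $L_n^{-i}(\theta)=\sum_{j\ne i}l_n(\theta,Z_n^j)$. For a penalty $\pi:\mathbb R^k\to\mathbb R$ and $\lambda\ge 0$ let $$\hat\theta_n=\arg\min_\theta L_n(\theta),\qquad \hat\theta_n^{\lambda,-i}=\arg\min_\theta\,[L_n^{-i}(\theta)+\lambda\pi(\theta)],\qquad CV_n(\lambda)=\sum_{i=1}^n l_n(\hat\theta_n^{\lambda,-i},Z_n^i),$$ $$g^\lambda(\theta)=\arg\min_g\,[\tfrac12\|g\|^2+\lambda\pi(\theta+g)],\qquad SURE(\lambda,\theta,\Sigma)=\operatorname{tr}\Sigma+\|g^\lambda(\theta)\|^2+2\operatorname{tr}\big(\nabla g^\lambda(\theta)\,\Sigma\big),$$ where $\nabla g^\lambda(\theta):=0$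 at points where $g^\lambda$ is not differentiable. Each $\arg\min$ denotes a global minimizer: one chosen arbitrarily if there are several, and an arbitrary point if there is none. **Assumptions.** 1. (*Sequence of experiments*) There are $\theta_0\in\mathbb R^k$ and a matrix $\Sigma$, not depending on $n$, such that for every $n$: $l(\beta,Z_n^1)$ is integrable for all $\beta$, $\theta_0$ minimizes $\theta\mapsto E[l(\theta/\sqrt n,Z_n^1)]$ over $\mathbb R^k$, and $\Sigma=\operatorname{Var}(\nabla_\beta l(\theta_0/\sqrt n,Z_n^1))$. 2. (*Normalization*) $\bar L(\theta)=\lim_{n}E[L_n(\theta)-L_n(\theta_0)]$ exists for every $\theta$, and $\bar L$ is twice differentiable at $\theta_0$ with Hessian $I$. 3. (*Penalty and tuning set*) Either (Ridge) $\pi(\theta)=\tfrac12\theta\cdot A^{-1}\theta$ with $A$ symmetric positive definite and $\Lambda=[0,\infty)$; or (Lasso) $\pi(\theta)=\|A^{-1}\theta\|_1$ with $A$ invertible, $\Lambda\subset[0,\infty)$ finite, and $\Sigma$ positive definite. 4. (*ERM*) There are a neighborhood $U$ of $0$ and a function $m$ with $\sup_n\operatorname{Var}(m(Z_n^1))<\infty$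 such that, almost surely, $|l(\beta_1,Z_n^1)-l(\beta_2,Z_n^1)|\le m(Z_n^1)\|\beta_1-\beta_2\|$ for $\beta_1,\beta_2\in U$ and $l(\cdot,Z_n^1)$ is differentiable on $U$. The sequence $\hat\theta_n$ is bounded in probability. 5. (*Cross-validation*) Almost surely, $l(\cdot,Z_n^1)$ is four times differentiable on $\mathbb R^k$. Moreover: * there is $c>0$ such that, with probability tending to $1$, $\nabla^2L_n(\theta)-cI$ is positive semidefinite for all $\theta\in\mathbb R^k$; * there are functions $B_n$ with $\sup_nE[B_n(Z_n^1)^2]<\infty$ such that, almost surely, $\|\sqrt n\nabla_\theta l_n(\theta,Z_n^1)-\sqrt n\nabla_\theta l_n(\theta',Z_n^1)\|\le B_n(Z_n^1)\|\theta-\theta'\|$ for all $\theta,\theta'$; and $\sup_nE\|\sqrt n\nabla_\theta l_n(\theta_0,Z_n^1)\|^4<\infty$; * $\frac1n\sum_{i=1}^n\|n\nabla^2_\theta l_n(\theta_0,Z_n^i)\|^2$ is bounded in probability, and there are functions $C_n$ with $\sup_nE[C_n(Z_n^1)^2]<\infty$ such that, almost surely, $\|n\nabla^2_\theta l_n(\theta,Z_n^1)-n\nabla^2_\theta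 l_n(\theta',Z_n^1)\|\le C_n(Z_n^1)\|\theta-\theta'\|$ for all $\theta,\theta'$; * $\sup_nE\big[\sup_{\theta\in\mathbb R^k}\|n^2D^4_\theta l_n(\theta,Z_n^1)\|^4\big]<\infty$. **Claim (convergence of CV to SURE).** Let $c_n=L_n(\hat\theta_n)+\tfrac12\operatorname{tr}\Sigma$, which does not depend on $\lambda$. Then $$\sup_{\lambda\in\Lambda}\Big|\,CV_n(\lambda)-c_n-\tfrac12\,SURE(\lambda,\hat\theta_n,\Sigma)\Big|\longrightarrow 0\quad\text{in probability as } n\to\infty,$$ that is, for every $\varepsilon>0$ the (outer) probability that the supremum exceeds $\varepsilon$ tends to $0$. -/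

import Mathlib

open MeasureTheory Filter Topology
open scoped ENNReal NNReal

namespace CVSure

/-- The parameter space `ℝᵏ` with its Euclidean norm. -/
abbrev Par (k : ℕ) : Type := EuclideanSpace ℝ (Fin k)

/-- A global minimizer of `f` (an arbitrary one if there are several, an arbitrary point if there
is none). -/
noncomputable def argmin {k : ℕ} (f : Par k → ℝ) : Par k :=
  Classical.epsilon fun x => ∀ y, f x ≤ f y

/-- The Hessian of `f` at `θ`, as a linear map: the derivative of the gradient. -/
noncomputable def hessian {k : ℕ} (f : Par k → ℝ) (θ : Par k) : Par k →L[ℝ] Par k :=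
  fderiv ℝ (gradient f) θ

section Model

variable {k : ℕ} {Z : Type*}

/-- The loss in the local parameter, `l_n(θ, z) = l(θ / √n, z)`. -/
noncomputable def locLoss (l : Par k → Z → ℝ) (n : ℕ) (θ : Par k) (z : Z) : ℝ :=
  l ((Real.sqrt n)⁻¹ • θ) z

/-- The empirical loss `L_n(θ) = ∑ᵢ l_n(θ, Zᵢ)` of the sample `ω = (Z₁, …, Z_n)`. -/
noncomputable def empLoss (l : Par k → Z → ℝ) (n : ℕ) (ω : Fin n → Z) (θ : Par k) : ℝ :=
  ∑ i, locLoss l n θ (ω i)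

/-- The leave-one-out empirical loss `L_n^{-i}(θ) = ∑_{j ≠ i} l_n(θ, Z_j)`. -/
noncomputable def looLoss (l : Par k → Z → ℝ) (n : ℕ) (ω : Fin n → Z) (i : Fin n)
    (θ : Par k) : ℝ :=
  ∑ j ∈ Finset.univ.erase i, locLoss l n θ (ω j)

/-- The ERM estimator. -/
noncomputable def erm (l : Par k → Z → ℝ) (n : ℕ) (ω : Fin n → Z) : Par k :=
  argmin (empLoss l n ω)

/-- The leave-one-out penalized ERM estimator with penalty `lam * pen`. -/
noncomputable def looPenErm (l : Par k → Z → ℝ) (pen : Par k → ℝ) (lam : ℝ) (n : ℕ)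
    (ω : Fin n → Z) (i : Fin n) : Par k :=
  argmin fun θ => looLoss l n ω i θ + lam * pen θ

/-- The `n`-fold (leave-one-out) cross-validation criterion. -/
noncomputable def cv (l : Par k → Z → ℝ) (pen : Par k → ℝ) (n : ℕ) (ω : Fin n → Z)
    (lam : ℝ) : ℝ :=
  ∑ i, locLoss l n (looPenErm l pen lam n ω i) (ω i)

/-- The shrinkage map `g^lam(θ) = argmin_g ½‖g‖² + lam * pen (θ + g)`. -/
noncomputable def shrink (pen : Par k → ℝ) (lam : ℝ) (θ : Par k) : Par k :=
  argmin fun g => 1 / 2 * ‖g‖ ^ 2 + lam * pen (θ + g)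

/-- The Jacobian matrix of `f` at `θ`; it is zero where `f` is not differentiable. -/
noncomputable def jacobian (f : Par k → Par k) (θ : Par k) : Matrix (Fin k) (Fin k) ℝ :=
  Matrix.of fun a b => (fderiv ℝ f θ (EuclideanSpace.single b 1)) a

/-- Stein's unbiased risk estimate. -/
noncomputable def sure (pen : Par k → ℝ) (Sig : Matrix (Fin k) (Fin k) ℝ) (lam : ℝ)
    (θ : Par k) : ℝ :=
  Sig.trace + ‖shrink pen lam θ‖ ^ 2 + 2 * (jacobian (shrink pen lam) θ * Sig).trace

/-- The ridge penalty `½ θ · A⁻¹ θ`. -/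
noncomputable def ridgePenalty (A : Matrix (Fin k) (Fin k) ℝ) (θ : Par k) : ℝ :=
  1 / 2 * ((θ : Fin k → ℝ) ⬝ᵥ (A⁻¹.mulVec θ))

/-- The lasso penalty `‖A⁻¹ θ‖₁`. -/
noncomputable def lassoPenalty (A : Matrix (Fin k) (Fin k) ℝ) (θ : Par k) : ℝ :=
  ∑ j, |A⁻¹.mulVec (θ : Fin k → ℝ) j|

/-- Ridge: `A` is positive definite and all `lam ≥ 0` are allowed. -/
def IsRidge (pen : Par k → ℝ) (Lam : Set ℝ) : Prop :=
  ∃ A : Matrix (Fin k) (Fin k) ℝ, A.PosDef ∧ pen = ridgePenalty A ∧ Lam = Set.Ici 0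

/-- Lasso: `A` is invertible and `Lam` is a finite set of nonnegative numbers. -/
def IsLasso (pen : Par k → ℝ) (Lam : Set ℝ) : Prop :=
  ∃ A : Matrix (Fin k) (Fin k) ℝ, IsUnit A.det ∧ pen = lassoPenalty A ∧
    Lam.Finite ∧ Lam ⊆ Set.Ici 0

variable [MeasurableSpace Z]

/-- The law of the sample: `n` i.i.d. draws from `μ n`. -/
noncomputable def sampleLaw (μ : ℕ → Measure Z) (n : ℕ) : Measure (Fin n → Z) :=
  Measure.pi fun _ => μ n

/-- The sequence `X n` of statistics of the samples is bounded in probability. -/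
def BddInProb (μ : ℕ → Measure Z) (X : (n : ℕ) → (Fin n → Z) → ℝ) : Prop :=
  ∀ ε : ℝ, 0 < ε → ∃ K : ℝ,
    ∀ᶠ n in atTop, sampleLaw μ n {ω | K < |X n ω|} ≤ ENNReal.ofReal ε

/-- The expected loss `E[L_n(θ) - L_n(θ₀)]`. -/
noncomputable def expLoss (l : Par k → Z → ℝ) (μ : ℕ → Measure Z) (θ₀ : Par k) (n : ℕ)
    (θ : Par k) : ℝ :=
  ∫ ω, (empLoss l n ω θ - empLoss l n ω θ₀) ∂(sampleLaw μ n)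

/-- The sequence of experiments: `θ₀ / √n` minimizes the expected loss under `μ n`, and the score at
`θ₀ / √n` has variance matrix `Sig`, for every sample size. -/
structure SequenceOfExperiments (l : Par k → Z → ℝ) (μ : ℕ → Measure Z) (θ₀ : Par k)
    (Sig : Matrix (Fin k) (Fin k) ℝ) : Prop where
  integrable : ∀ n : ℕ, 1 ≤ n → ∀ β, Integrable (l β) (μ n)
  minimizer : ∀ n : ℕ, 1 ≤ n → ∀ θ : Par k,
    ∫ z, locLoss l n θ₀ z ∂(μ n) ≤ ∫ z, locLoss l n θ z ∂(μ n)
  variance : ∀ n : ℕ, 1 ≤ n → ∀ a b : Fin k,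
    Sig a b = ProbabilityTheory.covariance
      (fun z => gradient (fun β => l β z) ((Real.sqrt n)⁻¹ • θ₀) a)
      (fun z => gradient (fun β => l β z) ((Real.sqrt n)⁻¹ • θ₀) b) (μ n)

/-- The limiting expected loss exists, and its Hessian at `θ₀` is the identity. -/
def NormalizedLoss (l : Par k → Z → ℝ) (μ : ℕ → Measure Z) (θ₀ : Par k) : Prop :=
  ∃ Lbar : Par k → ℝ,
    (∀ θ, Tendsto (fun n => expLoss l μ θ₀ n θ) atTop (𝓝 (Lbar θ))) ∧
    (∀ᶠ θ in 𝓝 θ₀, DifferentiableAt ℝ Lbar θ) ∧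
    HasFDerivAt (gradient Lbar) (ContinuousLinearMap.id ℝ (Par k)) θ₀

/-- Conditions for the convergence of the ERM estimator. -/
structure ERMConditions (l : Par k → Z → ℝ) (μ : ℕ → Measure Z) : Prop where
  lipschitz_loss : ∃ U ∈ 𝓝 (0 : Par k), ∃ m : Z → ℝ, ∃ V : ℝ, ∀ n : ℕ, 1 ≤ n →
    (∀ᵐ z ∂(μ n), ∀ β₁ ∈ U, ∀ β₂ ∈ U, |l β₁ z - l β₂ z| ≤ m z * ‖β₁ - β₂‖) ∧
    MemLp m 2 (μ n) ∧ ProbabilityTheory.variance m (μ n) ≤ V ∧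
    (∀ᵐ z ∂(μ n), ∀ β ∈ U, DifferentiableAt ℝ (fun β => l β z) β)
  bounded : BddInProb μ fun n ω => ‖erm l n ω‖

/-- Conditions for the convergence of cross-validation. -/
structure CVConditions (l : Par k → Z → ℝ) (μ : ℕ → Measure Z) (θ₀ : Par k) : Prop where
  /-- The loss is four times differentiable in the parameter. -/
  smooth : ∀ n : ℕ, 1 ≤ n → ∀ᵐ z ∂(μ n), ContDiff ℝ 3 (fun β => l β z) ∧
    Differentiable ℝ (iteratedFDeriv ℝ 3 fun β => l β z)
  /-- With probability approaching one, the empirical loss is `c`-strongly convex. -/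
  strongly_convex : ∃ c : ℝ, 0 < c ∧
    Tendsto (fun n => sampleLaw μ n
      {ω | ¬ ∀ θ v : Par k, c * ‖v‖ ^ 2 ≤ inner ℝ (hessian (empLoss l n ω) θ v) v})
      atTop (𝓝 0)
  /-- The scores are Lipschitz, with Lipschitz constants bounded in `L²` uniformly in `n`. -/
  score_lipschitz : ∃ B : ℕ → Z → ℝ, ∃ M : ℝ, ∀ n : ℕ, 1 ≤ n →
    (∀ᵐ z ∂(μ n), ∀ θ θ' : Par k,
      ‖Real.sqrt n • gradient (fun t => locLoss l n t z) θ -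
        Real.sqrt n • gradient (fun t => locLoss l n t z) θ'‖ ≤ B n z * ‖θ - θ'‖) ∧
    MemLp (B n) 2 (μ n) ∧ ∫ z, B n z ^ 2 ∂(μ n) ≤ M
  score_moment : ∃ M : ℝ≥0, ∀ n : ℕ, 1 ≤ n →
    ∫⁻ z, ‖Real.sqrt n • gradient (fun t => locLoss l n t z) θ₀‖ₑ ^ 4 ∂(μ n) ≤ M
  hessian_bounded : BddInProb μ fun n ω =>
    (n : ℝ)⁻¹ * ∑ i, ‖(n : ℝ) • hessian (fun t => locLoss l n t (ω i)) θ₀‖ ^ 2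
  hessian_lipschitz : ∃ C : ℕ → Z → ℝ, ∃ M : ℝ, ∀ n : ℕ, 1 ≤ n →
    (∀ᵐ z ∂(μ n), ∀ θ θ' : Par k,
      ‖(n : ℝ) • hessian (fun t => locLoss l n t z) θ -
        (n : ℝ) • hessian (fun t => locLoss l n t z) θ'‖ ≤ C n z * ‖θ - θ'‖) ∧
    MemLp (C n) 2 (μ n) ∧ ∫ z, C n z ^ 2 ∂(μ n) ≤ M
  fourth_derivative : ∃ M : ℝ≥0, ∀ n : ℕ, 1 ≤ n →
    ∫⁻ z, ⨆ θ : Par k,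
      ‖(n : ℝ) ^ 2 • iteratedFDeriv ℝ 4 (fun t => locLoss l n t z) θ‖ₑ ^ 4 ∂(μ n) ≤ M

end Model

end CVSure

open CVSure

/-!
Write `f_i = l_n(·, Z_i)`, `L = ∑ f_i`, `θ̂` for the minimizer of `L`, and `σ_i = ∇f_i(θ₀)`.

The limit of the expected loss is exactly `½‖θ - θ₀‖²`: the fourth derivative of `n l_n` is of order
`n⁻¹`, so the fourth differences of the limit vanish. A nonnegative function with this property is
quadratic along arithmetic progressions, and the Hessian at `θ₀` fixes the coefficients
(`tendsto_expLoss`). A weak law of large numbers for the second differences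
of `L`, a finite net and the Lipschitz condition on the Hessians then show that `∇²L` is close to the
identity uniformly on bounded sets (`highProb_hessian`). Only `n⁻¹ ∑ ‖n ∇²f_i(θ₀)‖²` being bounded in
probability is known, not the corresponding moments, so this law needs a truncation
(`highProb_avg_of_bddInProb`).

Strong convexity of `L` passes to all leave-one-out losses at once. Only an observation whose score
has a Lipschitz constant of order `√n` can do harm. The expected number of such outliers is bounded,
and each is independent of the remaining sample (`highProb_strongMono_erase`).

The rest is deterministic (`cv_sub_sure_le`). Since `L` is nearly quadratic, the minimizer `θ_λ` of
`L + λπ` is the proximal point `θ + g^λ(θ)` of a point `φ` close to `θ̂`, and the leave-one-out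
minimizer is the proximal point of a point close to `φ + σ_i`. If the proximal map is affine with
linear part `P` on a ball around `θ̂`, the two minimizers differ by `P σ_i` up to an error whose
effects add up to something small. As `∑ σ_i σ_iᵀ → Σ`, this gives
`CV_n(λ) ≈ L(θ_λ) + ∑ ⟪σ_i, P σ_i⟫ ≈ L(θ̂) + ½‖g^λ(θ̂)‖² + tr (P Σ)`, and `P = 1 + ∇g^λ(θ̂)` turns the
right-hand side into `L(θ̂) + ½ tr Σ + ½ SURE`.

For ridge the proximal map is linear. For the lasso it is affine on balls of fixed radius around all
points outside finitely many thin slabs, where strict complementarity may fail (`lasso_slab`). These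
slabs do not depend on the sample, and `θ̂ = θ₀ - ∑ σ_i + o(1)` is asymptotically normal with the
nondegenerate variance `Σ`, so `θ̂` rarely falls into them (`exists_evProb_gradient_far`).
-/

namespace CVSure

variable {k : ℕ}

/-! ### Gradients and strongly monotone gradients -/

/-- The gradient of `f` is `c`-strongly monotone; for differentiable `f` this is `c`-strong
convexity, in the form in which it is used below. -/
def StrongMono (c : ℝ) (f : Par k → ℝ) : Prop :=
  ∀ x y : Par k, c * ‖x - y‖ ^ 2 ≤ inner ℝ (gradient f x - gradient f y) (x - y)

lemma hasGradientAt_sum {ι : Type*} (s : Finset ι) {f : ι → Par k → ℝ} {g : ι → Par k}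
    {x : Par k} (h : ∀ i ∈ s, HasGradientAt (f i) (g i) x) :
    HasGradientAt (fun y => ∑ i ∈ s, f i y) (∑ i ∈ s, g i) x := by
  rw [hasGradientAt_iff_hasFDerivAt, map_sum]
  exact HasFDerivAt.fun_sum fun i hi => (h i hi).hasFDerivAt

lemma gradient_sum {ι : Type*} (s : Finset ι) {f : ι → Par k → ℝ}
    (h : ∀ i ∈ s, Differentiable ℝ (f i)) (x : Par k) :
    gradient (fun y => ∑ i ∈ s, f i y) x = ∑ i ∈ s, gradient (f i) x :=
  (hasGradientAt_sum s fun i hi => (h i hi x).hasGradientAt).gradient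

lemma hasDerivAt_along {f : Par k → ℝ} (hf : Differentiable ℝ f) (x v : Par k) (t : ℝ) :
    HasDerivAt (fun s : ℝ => f (x + s • v)) (inner ℝ (gradient f (x + t • v)) v) t := by
  have h1 : HasDerivAt (fun s : ℝ => x + s • v) v t := by
    simpa using ((hasDerivAt_id t).smul_const v).const_add x
  have h2 := (hf (x + t • v)).hasFDerivAt.comp_hasDerivAt t h1
  rwa [← inner_gradient_left] at h2

/-- Mean value bound for `f` minus a linear function, from a bound on the gradient. -/
lemma abs_sub_inner_le_of_gradient {f : Par k → ℝ} {g : Par k} {K : ℝ} {s : Set (Par k)}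
    (hs : Convex ℝ s) (hf : ∀ x ∈ s, DifferentiableAt ℝ f x)
    (hg : ∀ x ∈ s, ‖gradient f x - g‖ ≤ K) {x y : Par k} (hx : x ∈ s) (hy : y ∈ s) :
    |f y - f x - inner ℝ g (y - x)| ≤ K * ‖y - x‖ := by
  have h := hs.norm_image_sub_le_of_norm_hasFDerivWithin_le
    (f := fun z => f z - inner ℝ g z)
    (f' := fun z => fderiv ℝ f z - innerSL ℝ g) (C := K)
    (fun z hz => (((hf z hz).hasFDerivAt).sub (innerSL ℝ g).hasFDerivAt).hasFDerivWithinAt)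
    (fun z hz => ?_) hx hy
  · rw [Real.norm_eq_abs] at h
    convert h using 2
    rw [inner_sub_right]; ring
  · have : fderiv ℝ f z - innerSL ℝ g = InnerProductSpace.toDual ℝ _ (gradient f z - g) := by
      ext w
      simp
    rw [this, LinearIsometryEquiv.norm_map]
    exact hg z hz

lemma StrongMono.lower_bound {c : ℝ} {f : Par k → ℝ} (hc : StrongMono c f)
    (hf : Differentiable ℝ f) (x y : Par k) :
    f x + inner ℝ (gradient f x) (y - x) + c / 2 * ‖y - x‖ ^ 2 ≤ f y := by
  set v := y - x with hv
  let h : ℝ → ℝ := fun t => f (x + t • v) - t * inner ℝ (gradient f x) v - c / 2 * t ^ 2 * ‖v‖ ^ 2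
  have hd : ∀ t, HasDerivAt h (inner ℝ (gradient f (x + t • v)) v - inner ℝ (gradient f x) v
      - c * t * ‖v‖ ^ 2) t := by
    intro t
    have h1 := hasDerivAt_along hf x v t
    have h2 := (hasDerivAt_id t).mul_const (inner ℝ (gradient f x) v)
    have h3 := (((hasDerivAt_pow 2 t).const_mul (c / 2)).mul_const (‖v‖ ^ 2))
    refine ((h1.sub h2).sub h3).congr_deriv ?_
    push_cast; ring
  have hmono : MonotoneOn h (Set.Icc 0 1) := by
    apply monotoneOn_of_deriv_nonneg (convex_Icc 0 1)
    · exact fun t _ => (hd t).continuousAt.continuousWithinAt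
    · exact fun t _ => (hd t).differentiableAt.differentiableWithinAt
    · intro t ht
      rw [interior_Icc] at ht
      rw [(hd t).deriv]
      have h1 := hc (x + t • v) x
      have e : x + t • v - x = t • v := by abel
      rw [e, norm_smul, inner_smul_right, inner_sub_left, Real.norm_eq_abs, mul_pow, sq_abs] at h1
      have h2 : t * (c * t * ‖v‖ ^ 2) ≤
          t * (inner ℝ (gradient f (x + t • v)) v - inner ℝ (gradient f x) v) := by
        linarith [h1]
      have := le_of_mul_le_mul_left h2 ht.1
      linarith
  have := hmono (Set.left_mem_Icc.2 zero_le_one) (Set.right_mem_Icc.2 zero_le_one) zero_le_one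
  simp only [h, zero_smul, add_zero, one_smul, hv, add_sub_cancel] at this
  rw [← hv] at this
  linarith

/-! ### Penalized minimizers and the proximal map -/

/-- The properties of a penalty on which the analysis relies: a continuous, nonnegative, convex
function that vanishes at the origin. -/
structure IsPenalty (pen : Par k → ℝ) : Prop where
  convex : ConvexOn ℝ Set.univ pen
  continuous : Continuous pen
  nonneg : ∀ x, 0 ≤ pen x
  zero : pen 0 = 0

lemma argmin_spec {f : Par k → ℝ} (h : ∃ x, ∀ y, f x ≤ f y) (y : Par k) : f (argmin f) ≤ f y :=
  Classical.epsilon_spec (p := fun x => ∀ y, f x ≤ f y) h y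

/-- A strongly convex function plus a penalty attains its minimum. -/
lemma exists_minimizer {c lam : ℝ} {f pen : Par k → ℝ} (hc : StrongMono c f) (hc0 : 0 < c)
    (hf : Differentiable ℝ f) (hp : IsPenalty pen) (hl : 0 ≤ lam) :
    ∃ x, ∀ y, f x + lam * pen x ≤ f y + lam * pen y := by
  have hcont : Continuous fun x => f x + lam * pen x :=
    hf.continuous.add (continuous_const.mul hp.continuous)
  refine hcont.exists_forall_le ?_
  have h1 : Tendsto (fun x : Par k => ‖x‖) (cocompact _) atTop := tendsto_norm_cocompact_atTop
  have h2 : Tendsto (fun r : ℝ => f 0 + r * (c / 2 * r - ‖gradient f 0‖)) atTop atTop := by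
    apply tendsto_atTop_add_const_left
    apply tendsto_id.atTop_mul_atTop₀
    apply tendsto_atTop_add_const_right
    exact tendsto_id.const_mul_atTop (by positivity)
  refine tendsto_atTop_mono (fun x => ?_) (h2.comp h1)
  have h3 := hc.lower_bound hf 0 x
  have h4 := abs_real_inner_le_norm (gradient f 0) x
  have h5 := (abs_le.1 h4).1
  have h6 := mul_nonneg hl (hp.nonneg x)
  simp only [sub_zero, Function.comp] at h3 ⊢
  nlinarith

/-- The variational inequality at a minimizer of a differentiable function plus a penalty. -/
lemma variational_ineq {lam : ℝ} {f pen : Par k → ℝ} (hf : Differentiable ℝ f)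
    (hp : IsPenalty pen) (hl : 0 ≤ lam) {x : Par k}
    (hx : ∀ y, f x + lam * pen x ≤ f y + lam * pen y) (y : Par k) :
    0 ≤ inner ℝ (gradient f x) (y - x) + lam * (pen y - pen x) := by
  have hd := hasDerivAt_along hf x (y - x) 0
  simp only [zero_smul, add_zero] at hd
  have hlim := hd.tendsto_slope_zero_right
  simp only [zero_add, zero_smul, add_zero] at hlim
  have hlim2 := hlim.add_const (lam * (pen y - pen x))
  refine ge_of_tendsto hlim2 ?_
  have : ∀ᶠ t : ℝ in 𝓝[>] 0, t < 1 := (eventually_lt_nhds zero_lt_one).filter_mono nhdsWithin_le_nhds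
  filter_upwards [this, self_mem_nhdsWithin] with t ht1 ht0
  have ht0 : 0 < t := ht0
  have h1 := hx (x + t • (y - x))
  have h2 := hp.convex.2 (Set.mem_univ x) (Set.mem_univ y) (sub_nonneg.2 ht1.le) ht0.le (by ring)
  have e : (1 - t) • x + t • y = x + t • (y - x) := by
    rw [sub_smul, smul_sub, one_smul]; abel
  rw [e] at h2
  simp only [smul_eq_mul] at h2 ⊢
  have h3 : lam * pen (x + t • (y - x)) ≤ lam * ((1 - t) * pen x + t * pen y) :=
    mul_le_mul_of_nonneg_left h2 hl
  have h4 : 0 ≤ t⁻¹ * ((f (x + t • (y - x)) - f x) + t * (lam * (pen y - pen x))) := by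
    apply mul_nonneg (inv_nonneg.2 ht0.le); nlinarith
  rw [mul_add, inv_mul_cancel_left₀ ht0.ne'] at h4
  exact h4

/-- The proximal map `θ ↦ θ + g(θ)` of `lam * pen`. -/
noncomputable def prox (pen : Par k → ℝ) (lam : ℝ) (θ : Par k) : Par k :=
  θ + shrink pen lam θ

lemma gradient_half_normSq (x : Par k) :
    HasGradientAt (fun g : Par k => 1 / 2 * ‖g‖ ^ 2) x x := by
  rw [hasGradientAt_iff_hasFDerivAt]
  have h := ((hasStrictFDerivAt_norm_sq x).hasFDerivAt).const_mul (1 / 2 : ℝ)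
  refine h.congr_fderiv (ContinuousLinearMap.ext fun v => ?_)
  simp

lemma IsPenalty.prox_variational {pen : Par k → ℝ} (hp : IsPenalty pen) {lam : ℝ} (hl : 0 ≤ lam)
    (θ y : Par k) :
    inner ℝ (θ - prox pen lam θ) (y - prox pen lam θ) ≤ lam * (pen y - pen (prox pen lam θ)) := by
  have hg' : ∀ x, HasGradientAt (fun x : Par k => 1 / 2 * ‖x - θ‖ ^ 2) (x - θ) x := by
    intro x
    have h1 : HasFDerivAt (fun y : Par k => y - θ) (ContinuousLinearMap.id ℝ _) x :=
      (hasFDerivAt_id x).sub_const θ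
    have h2 : HasFDerivAt (fun g : Par k => 1 / 2 * ‖g‖ ^ 2)
      (InnerProductSpace.toDual ℝ (Par k) (x - θ)) (x - θ) :=
      (gradient_half_normSq (x - θ)).hasFDerivAt
    exact HasFDerivAt.comp (g := fun g : Par k => 1 / 2 * ‖g‖ ^ 2) x h2 h1
  have hf : Differentiable ℝ (fun x : Par k => 1 / 2 * ‖x - θ‖ ^ 2) := fun x =>
    ((hasGradientAt_iff_hasFDerivAt.1 (hg' x))).differentiableAt
  have hg : ∀ x, gradient (fun x : Par k => 1 / 2 * ‖x - θ‖ ^ 2) x = x - θ := fun x =>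
    (hg' x).gradient
  have hmono : StrongMono 1 (fun x : Par k => 1 / 2 * ‖x - θ‖ ^ 2) := by
    intro x y
    rw [hg, hg, sub_sub_sub_cancel_right, real_inner_self_eq_norm_sq, one_mul]
  obtain ⟨x, hx⟩ := exists_minimizer hmono one_pos hf hp hl
  have hmin : ∀ y, 1 / 2 * ‖shrink pen lam θ‖ ^ 2 + lam * pen (θ + shrink pen lam θ) ≤
      1 / 2 * ‖y‖ ^ 2 + lam * pen (θ + y) := by
    apply argmin_spec (f := fun g => 1 / 2 * ‖g‖ ^ 2 + lam * pen (θ + g))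
    refine ⟨x - θ, fun y => ?_⟩
    have := hx (θ + y)
    simpa using this
  have := variational_ineq hf hp hl (x := prox pen lam θ) (fun y => by
    have := hmin (y - θ)
    simpa [prox] using this) y
  rw [hg, ← neg_sub θ, inner_neg_left] at this
  linarith

/-- The variational inequality characterizes the proximal point. -/
lemma IsPenalty.prox_eq {pen : Par k → ℝ} (hp : IsPenalty pen) {lam : ℝ} (hl : 0 ≤ lam)
    {θ x : Par k} (hx : ∀ y, inner ℝ (θ - x) (y - x) ≤ lam * (pen y - pen x)) :
    prox pen lam θ = x := by
  have h1 := hp.prox_variational hl θ x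
  have h2 := hx (prox pen lam θ)
  set p := prox pen lam θ
  have h3 : inner ℝ (x - p) (x - p) ≤ (0 : ℝ) := by
    have : inner ℝ (x - p) (x - p) = inner ℝ (θ - p) (x - p) + inner ℝ (θ - x) (p - x) := by
      have e1 : x - p = (θ - p) - (θ - x) := by abel
      have e2 : p - x = -(x - p) := by abel
      rw [e2, inner_neg_right, ← sub_eq_add_neg, ← inner_sub_left, ← e1]
    rw [this]; linarith
  have h4 : x - p = 0 := by
    rw [real_inner_self_eq_norm_sq] at h3
    exact norm_eq_zero.1 (pow_eq_zero_iff two_ne_zero |>.1 (le_antisymm h3 (sq_nonneg _)))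
  exact (sub_eq_zero.1 h4).symm

lemma IsPenalty.prox_lipschitz {pen : Par k → ℝ} (hp : IsPenalty pen) {lam : ℝ} (hl : 0 ≤ lam)
    (θ θ' : Par k) : ‖prox pen lam θ - prox pen lam θ'‖ ≤ ‖θ - θ'‖ := by
  have h1 := hp.prox_variational hl θ (prox pen lam θ')
  have h2 := hp.prox_variational hl θ' (prox pen lam θ)
  set p := prox pen lam θ
  set q := prox pen lam θ'
  have h3 : ‖p - q‖ ^ 2 ≤ inner ℝ (θ - θ') (p - q) := by
    rw [← real_inner_self_eq_norm_sq]
    have : inner ℝ (θ - θ') (p - q) - inner ℝ (p - q) (p - q) =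
        -(inner ℝ (θ - p) (q - p) + inner ℝ (θ' - q) (p - q)) := by
      have e2 : q - p = -(p - q) := by abel
      rw [e2, inner_neg_right, ← inner_sub_left]
      have : θ - θ' - (p - q) = (θ - p) - (θ' - q) := by abel
      rw [this, inner_sub_left]; ring
    linarith
  have h4 := real_inner_le_norm (θ - θ') (p - q)
  by_contra hcon
  push Not at hcon
  have h5 : 0 < ‖p - q‖ := lt_of_le_of_lt (norm_nonneg _) hcon
  nlinarith

/-- A penalized minimizer is a proximal point of a gradient step taken from it. -/
lemma IsPenalty.prox_gradient_step {pen f : Par k → ℝ} (hp : IsPenalty pen) {lam : ℝ}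
    (hl : 0 ≤ lam) (hf : Differentiable ℝ f) {x : Par k}
    (hx : ∀ y, f x + lam * pen x ≤ f y + lam * pen y) :
    prox pen lam (x - gradient f x) = x := by
  refine hp.prox_eq hl fun y => ?_
  have := variational_ineq hf hp hl hx y
  have e : x - gradient f x - x = - gradient f x := by abel
  rw [e, inner_neg_left]; linarith

/-- Removing a term from a penalized criterion moves the minimizer by at most the gradient of this
term. -/
lemma penalized_minimizer_stability {c lam : ℝ} {f h pen : Par k → ℝ} (hp : IsPenalty pen)
    (hl : 0 ≤ lam) (hf : Differentiable ℝ f) (hh : Differentiable ℝ h) (hm : StrongMono c h)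
    {x y : Par k} (hx : ∀ z, f x + lam * pen x ≤ f z + lam * pen z)
    (hy : ∀ z, h y + lam * pen y ≤ h z + lam * pen z) :
    c * ‖y - x‖ ≤ ‖gradient f x - gradient h x‖ := by
  rcases eq_or_ne y x with rfl | hne
  · simp
  have h1 := variational_ineq hf hp hl hx y
  have h2 := variational_ineq hh hp hl hy x
  have h3 := hm y x
  have h4 := real_inner_le_norm (gradient f x - gradient h x) (y - x)
  have e : x - y = -(y - x) := by abel
  rw [e, inner_neg_right] at h2
  rw [inner_sub_left] at h3 h4
  have h5 : 0 < ‖y - x‖ := norm_pos_iff.2 (sub_ne_zero.2 hne)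
  have : (c * ‖y - x‖) * ‖y - x‖ ≤ ‖gradient f x - gradient h x‖ * ‖y - x‖ := by
    nlinarith
  exact le_of_mul_le_mul_right this h5

end CVSure

namespace CVSure

variable {k : ℕ}

/-! ### Deterministic comparison of cross-validation and SURE -/

/-- The matrix of a linear map in the standard basis. -/
noncomputable def stdMatrix (P : Par k →L[ℝ] Par k) : Matrix (Fin k) (Fin k) ℝ :=
  Matrix.of fun a b => (P (EuclideanSpace.single b 1)) a

lemma abs_stdMatrix_le {P : Par k →L[ℝ] Par k} (hP : ‖P‖ ≤ 1) (a b : Fin k) :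
    |stdMatrix P a b| ≤ 1 := by
  have h1 : ‖P (EuclideanSpace.single b 1)‖ ≤ 1 := by
    have := P.le_opNorm (EuclideanSpace.single b (1 : ℝ))
    simp only [PiLp.norm_single, norm_one, mul_one] at this
    exact this.trans hP
  have h2 := PiLp.norm_apply_le (P (EuclideanSpace.single b (1 : ℝ))) a
  exact h2.trans h1

lemma inner_apply_eq_sum (P : Par k →L[ℝ] Par k) (x : Par k) :
    inner ℝ x (P x) = ∑ a, ∑ b, stdMatrix P a b * (x b * x a) := by
  have hx : x = ∑ b, x b • EuclideanSpace.single b (1 : ℝ) := by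
    ext a
    simp [Finset.sum_apply, Pi.single_apply]
  have h1 : ∀ a, (P x) a = ∑ b, x b * stdMatrix P a b := by
    intro a
    conv_lhs => rw [hx]
    simp [stdMatrix, map_sum]
  rw [PiLp.inner_apply]
  refine Finset.sum_congr rfl fun a _ => ?_
  rw [h1]
  simp only [RCLike.inner_apply, conj_trivial, Finset.sum_mul]
  exact Finset.sum_congr rfl fun b _ => by ring

/-- The quadratic form of `P`, summed over a sample, is close to `tr (P Sig)` if the empirical
second moments are close to `Sig`. -/
lemma abs_sum_inner_sub_trace_le {n : ℕ} {P : Par k →L[ℝ] Par k} (hP : ‖P‖ ≤ 1)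
    {g : Fin n → Par k} {Sig : Matrix (Fin k) (Fin k) ℝ} {κ : ℝ}
    (hS : ∀ p q, |∑ i, g i p * g i q - Sig p q| ≤ κ) :
    |∑ i, inner ℝ (g i) (P (g i)) - (stdMatrix P * Sig).trace| ≤ (k : ℝ) ^ 2 * κ := by
  have e : ∑ i, inner ℝ (g i) (P (g i)) - (stdMatrix P * Sig).trace =
      ∑ a, ∑ b, stdMatrix P a b * (∑ i, g i b * g i a - Sig b a) := by
    simp only [inner_apply_eq_sum, Matrix.trace, Matrix.diag, Matrix.mul_apply, mul_sub,
      Finset.sum_sub_distrib, Finset.mul_sum]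
    congr 1
    rw [Finset.sum_comm]
    exact Finset.sum_congr rfl fun a _ => Finset.sum_comm
  rw [e]
  calc _ ≤ ∑ a : Fin k, ∑ b : Fin k, κ := by
        refine (Finset.abs_sum_le_sum_abs _ _).trans (Finset.sum_le_sum fun a _ => ?_)
        refine (Finset.abs_sum_le_sum_abs _ _).trans (Finset.sum_le_sum fun b _ => ?_)
        rw [abs_mul]
        calc _ ≤ 1 * |∑ i, g i b * g i a - Sig b a| :=
              mul_le_mul_of_nonneg_right (abs_stdMatrix_le hP a b) (abs_nonneg _)
          _ ≤ κ := by rw [one_mul]; exact hS b a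
    _ = _ := by simp; ring

/-- Where the proximal map is affine with linear part `P`, the Jacobian of the shrinkage map is
`P - 1`. -/
lemma trace_jacobian_mul {pen : Par k → ℝ} {lam δ : ℝ} {th : Par k} {P : Par k →L[ℝ] Par k}
    (hδ : 0 < δ) (hloc : ∀ φ ∈ Metric.closedBall th δ, ∀ φ' ∈ Metric.closedBall th δ,
      prox pen lam φ - prox pen lam φ' = P (φ - φ')) (Sig : Matrix (Fin k) (Fin k) ℝ) :
    (jacobian (shrink pen lam) th * Sig).trace = (stdMatrix P * Sig).trace - Sig.trace := by
  have h1 : HasFDerivAt (shrink pen lam) (P - ContinuousLinearMap.id ℝ _) th := by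
    have h2 : HasFDerivAt (fun φ => prox pen lam th + P (φ - th) - φ)
        (P - ContinuousLinearMap.id ℝ _) th := by
      have h3 : HasFDerivAt (fun φ => prox pen lam th + P (φ - th)) P th := by
        simp only [map_sub]
        exact (P.hasFDerivAt.sub_const _).const_add _
      exact h3.sub (hasFDerivAt_id th)
    refine h2.congr_of_eventuallyEq ?_
    filter_upwards [Metric.closedBall_mem_nhds th hδ] with φ hφ
    rw [← hloc φ hφ th (Metric.mem_closedBall_self hδ.le), prox, prox]
    abel
  have h4 : jacobian (shrink pen lam) th = stdMatrix P - 1 := by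
    ext a b
    simp [jacobian, stdMatrix, h1.fderiv, Matrix.one_apply]
  rw [h4, sub_mul, one_mul, Matrix.trace_sub]

/-- The total effect of the leave-one-out perturbations. -/
lemma sum_error_le {n : ℕ} {x a : Fin n → ℝ} {κ c T : ℝ} (hκ : 0 < κ) (hκ1 : κ ≤ 1) (hc : 0 < c)
    (hT : 0 ≤ T) (ha0 : ∀ i, 0 ≤ a i) (hx0 : ∀ i, 0 ≤ x i)
    (ha : ∑ i, a i ^ 2 ≤ κ ^ 2) (hx : ∑ i, x i ^ 2 ≤ T) :
    ∑ i, (a i * ((x i + a i) / c) + x i * (κ * ((x i + a i) / c) + a i)) ≤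
      ((3 * T + 3) / c + T + 1) * κ := by
  have h1 : ∑ i, a i * x i ≤ κ * (T + 1) := by
    have h2 := Finset.sum_mul_sq_le_sq_mul_sq Finset.univ a x
    have h3 : (∑ i, a i * x i) ^ 2 ≤ (κ * (T + 1)) ^ 2 := by
      calc _ ≤ κ ^ 2 * T := h2.trans (mul_le_mul ha hx (Finset.sum_nonneg fun i _ => sq_nonneg _)
            (sq_nonneg _))
        _ ≤ _ := by
          rw [mul_pow]
          exact mul_le_mul_of_nonneg_left (by nlinarith) (sq_nonneg _)
    exact le_of_sq_le_sq h3 (by positivity)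
  have e : ∑ i, (a i * ((x i + a i) / c) + x i * (κ * ((x i + a i) / c) + a i)) =
      (∑ i, a i * x i + ∑ i, a i ^ 2) / c + κ * (∑ i, x i ^ 2 + ∑ i, a i * x i) / c
        + ∑ i, a i * x i := by
    simp only [← Finset.sum_add_distrib, Finset.mul_sum, Finset.sum_div]
    refine Finset.sum_congr rfl fun i _ => ?_
    field_simp
    ring
  rw [e]
  have h0 : 0 ≤ ∑ i, a i * x i := Finset.sum_nonneg fun i _ => mul_nonneg (ha0 i) (hx0 i)
  have hκ2 : κ ^ 2 ≤ κ := by nlinarith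
  have h4 : (∑ i, a i * x i + ∑ i, a i ^ 2) / c ≤ (κ * (T + 1) + κ) / c := by
    gcongr; linarith
  have h5 : κ * (∑ i, x i ^ 2 + ∑ i, a i * x i) / c ≤ κ * (T + (T + 1)) / c := by
    gcongr
    exact h1.trans (by nlinarith)
  have h6 : ((3 * T + 3) / c + T + 1) * κ =
      (κ * (T + 1) + κ) / c + κ * (T + (T + 1)) / c + κ * (T + 1) := by
    field_simp; ring
  linarith

/-- The deterministic heart of the argument. If the empirical loss `∑ i, f i` is close to the
quadratic `½‖θ - th‖²`, if each `f i` contributes little, with gradients that hardly vary, and if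
the proximal map is affine near `th`, then the leave-one-out criterion is close to SURE. -/
theorem cv_sub_sure_le {n : ℕ} {c R₀ T R κ δ lam : ℝ} {f : Fin n → Par k → ℝ} {θ₀ th : Par k}
    {Sig : Matrix (Fin k) (Fin k) ℝ} {pen : Par k → ℝ} {a : Fin n → ℝ} {P : Par k →L[ℝ] Par k}
    (hc : 0 < c) (hT : 0 ≤ T) (hδ : 0 < δ) (hR₀ : 0 ≤ R₀) (hR : R = 4 * R₀ / c + 2 * R₀ + 1)
    (hκ : 0 < κ) (hκ1 : κ ≤ 1) (hκc : κ ≤ c / 2) (hκR : κ ≤ δ / (4 * R)) (hκδ : κ ≤ δ / 6)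
    (hp : IsPenalty pen) (hl : 0 ≤ lam)
    (hf : ∀ i, Differentiable ℝ (f i)) (hL : StrongMono c fun θ => ∑ i, f i θ)
    (hLi : ∀ i, StrongMono c fun θ => ∑ j ∈ Finset.univ.erase i, f j θ)
    (hth : gradient (fun θ => ∑ i, f i θ) th = 0) (hth0 : ‖th‖ ≤ R₀) (hθ₀ : ‖θ₀‖ ≤ R₀)
    (ha : ∀ i, ∀ x ∈ Metric.closedBall θ₀ R, ‖gradient (f i) x - gradient (f i) θ₀‖ ≤ a i)
    (hasum : ∑ i, a i ^ 2 ≤ κ ^ 2) (hσ : ∀ i, ‖gradient (f i) θ₀‖ ≤ κ)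
    (hS : ∀ p q, |∑ i, gradient (f i) θ₀ p * gradient (f i) θ₀ q - Sig p q| ≤ κ)
    (hsum : ∑ i, ‖gradient (f i) θ₀‖ ^ 2 ≤ T)
    (hquad : ∀ x ∈ Metric.closedBall θ₀ R, ∀ y ∈ Metric.closedBall θ₀ R,
      ‖gradient (fun θ => ∑ i, f i θ) x - gradient (fun θ => ∑ i, f i θ) y - (x - y)‖
        ≤ κ * ‖x - y‖)
    (hP : ‖P‖ ≤ 1)
    (hloc : ∀ φ ∈ Metric.closedBall th δ, ∀ φ' ∈ Metric.closedBall th δ,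
      prox pen lam φ - prox pen lam φ' = P (φ - φ')) :
    |∑ i, f i (argmin fun θ => ∑ j ∈ Finset.univ.erase i, f j θ + lam * pen θ)
        - (∑ i, f i th + 1 / 2 * Sig.trace) - 1 / 2 * sure pen Sig lam th|
      ≤ ((3 * T + 3) / c + T + 1 + (k : ℝ) ^ 2 + 10 * R ^ 2) * κ := by
  set L : Par k → ℝ := fun θ => ∑ i, f i θ with hLdef
  have hRpos : 0 < R := by rw [hR]; positivity
  have hRc : 0 ≤ 4 * R₀ / c := by positivity
  have hLd : Differentiable ℝ L := fun x => by
    exact (hasGradientAt_sum Finset.univ fun i _ => (hf i x).hasGradientAt).differentiableAt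
  have hLid : ∀ i, Differentiable ℝ fun θ => ∑ j ∈ Finset.univ.erase i, f j θ := fun i x =>
    (hasGradientAt_sum (Finset.univ.erase i) fun j _ => (hf j x).hasGradientAt).differentiableAt
  have hgi : ∀ i x, gradient (fun θ => ∑ j ∈ Finset.univ.erase i, f j θ) x =
      gradient L x - gradient (f i) x := by
    intro i x
    rw [hLdef, gradient_sum _ (fun j _ => hf j), gradient_sum _ (fun j _ => hf j),
      Finset.sum_erase_eq_sub (Finset.mem_univ i)]
  have hball : ∀ x : Par k, ‖x‖ ≤ 4 * R₀ / c + R₀ + 1 → x ∈ Metric.closedBall θ₀ R := by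
    intro x hx
    rw [mem_closedBall_iff_norm, hR]
    have := norm_sub_le x θ₀
    linarith
  have hth_ball : th ∈ Metric.closedBall θ₀ R := hball th (by linarith)
  have hdist : ∀ x ∈ Metric.closedBall θ₀ R, ‖x - th‖ ≤ 2 * R := by
    intro x hx
    have h1 := norm_sub_le_norm_sub_add_norm_sub x θ₀ th
    rw [mem_closedBall_iff_norm] at hx hth_ball
    rw [norm_sub_rev θ₀ th] at h1
    linarith
  -- the penalized minimizer of the full criterion
  obtain ⟨xl, hxl⟩ := exists_minimizer hL hc hLd hp hl
  have hxl_norm : ‖xl‖ ≤ 4 * R₀ / c := by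
    have h1 := variational_ineq hLd hp hl hxl 0
    have h2 := hL xl 0
    have h3 := hquad 0 (hball 0 (by rw [norm_zero]; linarith)) th hth_ball
    rw [hth, sub_zero, zero_sub, norm_neg] at h3
    have h4 : ‖gradient L 0‖ ≤ 2 * ‖th‖ := by
      have := norm_add_le (gradient L 0 - -th) (-th)
      rw [sub_add_cancel, norm_neg] at this
      nlinarith [norm_nonneg th]
    have h5 : c * ‖xl‖ ^ 2 ≤ ‖gradient L 0‖ * ‖xl‖ := by
      have h6 := abs_real_inner_le_norm (gradient L 0) xl
      have h7 := (abs_le.1 h6).1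
      rw [sub_zero, inner_sub_left] at h2
      rw [zero_sub, inner_neg_right, hp.zero] at h1
      have h8 := mul_nonneg hl (hp.nonneg xl)
      linarith
    rcases eq_or_ne xl 0 with h0 | h0
    · rw [h0, norm_zero]; exact hRc
    · have h9 : 0 < ‖xl‖ := norm_pos_iff.2 h0
      have h10 : c * ‖xl‖ ≤ ‖gradient L 0‖ := by
        apply le_of_mul_le_mul_right _ h9
        nlinarith
      rw [le_div_iff₀ hc]; nlinarith
  have hxl_ball : xl ∈ Metric.closedBall θ₀ R := hball xl (by linarith)
  set φ := xl - gradient L xl with hφdef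
  have hproxφ : prox pen lam φ = xl := hp.prox_gradient_step hl hLd hxl
  have hφ : ‖φ - th‖ ≤ 2 * R * κ := by
    have h1 := hquad xl hxl_ball th hth_ball
    rw [hth, sub_zero, ← norm_neg] at h1
    have e : -(gradient L xl - (xl - th)) = φ - th := by rw [hφdef]; abel
    rw [e] at h1
    nlinarith [hdist xl hxl_ball]
  have hκR' : 2 * R * κ ≤ δ / 2 := by
    rw [le_div_iff₀ (by positivity)] at hκR
    linarith
  have hφδ : φ ∈ Metric.closedBall th δ := by
    rw [mem_closedBall_iff_norm]; linarith
  have ha0 : ∀ i, 0 ≤ a i := fun i => (norm_nonneg _).trans (ha i θ₀ (by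
    rw [mem_closedBall_iff_norm, sub_self, norm_zero]; exact hRpos.le))
  have haκ : ∀ i, a i ≤ κ := fun i => by
    have h1 := Finset.single_le_sum (f := fun i => a i ^ 2) (fun i _ => sq_nonneg (a i))
      (Finset.mem_univ i)
    exact le_of_sq_le_sq (h1.trans hasum) hκ.le
  -- the leave-one-out minimizers
  set y : Fin n → Par k := fun i =>
    argmin fun θ => ∑ j ∈ Finset.univ.erase i, f j θ + lam * pen θ with hydef
  have hy : ∀ i z, (∑ j ∈ Finset.univ.erase i, f j (y i)) + lam * pen (y i) ≤
      (∑ j ∈ Finset.univ.erase i, f j z) + lam * pen z := by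
    intro i z
    exact argmin_spec (f := fun θ => ∑ j ∈ Finset.univ.erase i, f j θ + lam * pen θ)
      (exists_minimizer (hLi i) hc (hLid i) hp hl) z
  have hΔ : ∀ i, ‖y i - xl‖ ≤ (‖gradient (f i) θ₀‖ + a i) / c := by
    intro i
    have h1 := penalized_minimizer_stability hp hl hLd (hLid i) (hLi i) hxl (hy i)
    rw [hgi, sub_sub_cancel] at h1
    have h2 := ha i xl hxl_ball
    have h3 := norm_le_norm_add_norm_sub' (gradient (f i) xl) (gradient (f i) θ₀)
    rw [le_div_iff₀ hc]; linarith
  have hΔ' : ∀ i, ‖y i - xl‖ ≤ 2 * κ / c := fun i => (hΔ i).trans (by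
    gcongr; linarith [hσ i, haκ i])
  have hκc' : 2 * κ / c ≤ 1 := by rw [div_le_one hc]; linarith
  have hy_ball : ∀ i, y i ∈ Metric.closedBall θ₀ R := fun i => hball _ (by
    have := norm_le_norm_add_norm_sub' (y i) xl
    linarith [hΔ' i])
  have herr : ∀ i, |f i (y i) - f i xl - inner ℝ (gradient (f i) θ₀) (P (gradient (f i) θ₀))| ≤
      a i * ((‖gradient (f i) θ₀‖ + a i) / c) + ‖gradient (f i) θ₀‖ *
        (κ * ((‖gradient (f i) θ₀‖ + a i) / c) + a i) := by
    intro i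
    set σ := gradient (f i) θ₀ with hσdef
    set φi := y i - gradient (fun θ => ∑ j ∈ Finset.univ.erase i, f j θ) (y i) with hφi
    have hproxi : prox pen lam φi = y i := hp.prox_gradient_step hl (hLid i) (hy i)
    have he : φi - φ - σ = -(gradient L (y i) - gradient L xl - (y i - xl)) +
        (gradient (f i) (y i) - σ) := by
      rw [hφi, hφdef, hgi]; abel
    have he1 : ‖φi - φ - σ‖ ≤ κ * ‖y i - xl‖ + a i := by
      rw [he]
      refine (norm_add_le _ _).trans (add_le_add ?_ (ha i _ (hy_ball i)))
      rw [norm_neg]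
      exact hquad _ (hy_ball i) _ hxl_ball
    have hφiδ : φi ∈ Metric.closedBall th δ := by
      rw [mem_closedBall_iff_norm]
      have h1 : ‖φi - th‖ ≤ ‖φi - φ - σ‖ + ‖σ‖ + ‖φ - th‖ := by
        have e : φi - th = (φi - φ - σ) + σ + (φ - th) := by abel
        rw [e]
        exact norm_add₃_le
      have h2 : κ * ‖y i - xl‖ ≤ κ * 1 :=
        mul_le_mul_of_nonneg_left ((hΔ' i).trans hκc') hκ.le
      linarith [haκ i, hσ i]
    -- both minimizers are proximal points of gradient steps, and these steps differ by nearly `σ`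
    have hΔP : y i - xl = P σ + P (φi - φ - σ) := by
      rw [← map_add, add_sub_cancel, ← hloc φi hφiδ φ hφδ, hproxi, hproxφ]
    have h1 := abs_sub_inner_le_of_gradient (convex_closedBall θ₀ R) (fun x _ => hf i x) (ha i) hxl_ball
      (hy_ball i)
    have h2 : |inner ℝ σ (P (φi - φ - σ))| ≤ ‖σ‖ * (κ * ((‖σ‖ + a i) / c) + a i) := by
      refine (abs_real_inner_le_norm _ _).trans (mul_le_mul_of_nonneg_left ?_ (norm_nonneg _))
      calc _ ≤ ‖P‖ * ‖φi - φ - σ‖ := P.le_opNorm _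
        _ ≤ 1 * ‖φi - φ - σ‖ := mul_le_mul_of_nonneg_right hP (norm_nonneg _)
        _ ≤ _ := by
          rw [one_mul]
          exact he1.trans (add_le_add (mul_le_mul_of_nonneg_left (hΔ i) hκ.le) le_rfl)
    have h3 : f i (y i) - f i xl - inner ℝ σ (P σ) =
        (f i (y i) - f i xl - inner ℝ σ (y i - xl)) + inner ℝ σ (P (φi - φ - σ)) := by
      rw [hΔP, inner_add_right]; ring
    rw [h3]
    refine (abs_add_le _ _).trans (add_le_add (h1.trans ?_) h2)
    exact mul_le_mul_of_nonneg_left (hΔ i) (ha0 i)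
  -- the sum of the leave-one-out increments
  have hA : |∑ i, f i (y i) - L xl - (stdMatrix P * Sig).trace| ≤
      ((3 * T + 3) / c + T + 1) * κ + (k : ℝ) ^ 2 * κ := by
    have h1 := abs_sum_inner_sub_trace_le hP hS
    have h2 : |∑ i, f i (y i) - L xl - ∑ i, inner ℝ (gradient (f i) θ₀) (P (gradient (f i) θ₀))| ≤
        ((3 * T + 3) / c + T + 1) * κ := by
      rw [hLdef, ← Finset.sum_sub_distrib, ← Finset.sum_sub_distrib]
      refine (Finset.abs_sum_le_sum_abs _ _).trans ((Finset.sum_le_sum fun i _ => herr i).trans ?_)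
      exact sum_error_le hκ hκ1 hc hT ha0 (fun i => norm_nonneg _) hasum hsum
    rw [abs_le] at h1 h2 ⊢
    constructor <;> linarith [h1.1, h1.2, h2.1, h2.2]
  -- the quadratic approximation of the empirical loss
  have hB : |L xl - L th - 1 / 2 * ‖xl - th‖ ^ 2| ≤ 4 * R ^ 2 * κ := by
    have hG : ∀ x, HasGradientAt (fun z => L z - 1 / 2 * ‖z - th‖ ^ 2)
        (gradient L x - (x - th)) x := by
      intro x
      have h1 : HasFDerivAt (fun y : Par k => y - th) (ContinuousLinearMap.id ℝ _) x :=
        (hasFDerivAt_id x).sub_const th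
      have h2 : HasFDerivAt (fun g : Par k => 1 / 2 * ‖g‖ ^ 2)
        (InnerProductSpace.toDual ℝ (Par k) (x - th)) (x - th) :=
        (gradient_half_normSq (x - th)).hasFDerivAt
      have h3 := HasFDerivAt.comp (g := fun g : Par k => 1 / 2 * ‖g‖ ^ 2) x h2 h1
      rw [hasGradientAt_iff_hasFDerivAt, map_sub]
      exact (hLd x).hasGradientAt.hasFDerivAt.sub h3
    have h1 := abs_sub_inner_le_of_gradient (g := 0) (K := κ * (2 * R))
      (convex_closedBall θ₀ R) (fun x _ => (hG x).differentiableAt) (fun x hx => by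
        rw [(hG x).gradient, sub_zero]
        have := hquad x hx th hth_ball
        rw [hth, sub_zero] at this
        exact this.trans (mul_le_mul_of_nonneg_left (hdist x hx) hκ.le)) hth_ball hxl_ball
    rw [inner_zero_left, sub_self, norm_zero] at h1
    have h2 : L xl - L th - 1 / 2 * ‖xl - th‖ ^ 2 =
        L xl - 1 / 2 * ‖xl - th‖ ^ 2 - (L th - 1 / 2 * 0 ^ 2) - 0 := by ring
    rw [h2]
    refine h1.trans ?_
    nlinarith [hdist xl hxl_ball, mul_pos hκ hRpos]
  have hC : |1 / 2 * ‖xl - th‖ ^ 2 - 1 / 2 * ‖shrink pen lam th‖ ^ 2| ≤ 6 * R ^ 2 * κ := by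
    have h1 : ‖(xl - th) - shrink pen lam th‖ ≤ 2 * R * κ := by
      have e : (xl - th) - shrink pen lam th = prox pen lam φ - prox pen lam th := by
        rw [hproxφ, prox]; abel
      rw [e]
      exact (hp.prox_lipschitz hl _ _).trans hφ
    have h2 := hdist xl hxl_ball
    have h3 := abs_norm_sub_norm_le (xl - th) (shrink pen lam th)
    set u := ‖xl - th‖
    set w := ‖shrink pen lam th‖
    have hu : 0 ≤ u := norm_nonneg _
    have hw : 0 ≤ w := norm_nonneg _
    have h4 : |u - w| ≤ 2 * R * κ := h3.trans h1
    have h5 : w ≤ 4 * R := by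
      have := (abs_le.1 h4).1
      nlinarith
    have e : 1 / 2 * u ^ 2 - 1 / 2 * w ^ 2 = (u - w) * ((u + w) / 2) := by ring
    rw [e, abs_mul, abs_of_nonneg (by positivity : 0 ≤ (u + w) / 2)]
    calc _ ≤ (2 * R * κ) * (3 * R) := by
          apply mul_le_mul h4 (by linarith) (by positivity) (by positivity)
      _ = _ := by ring
  rw [sure, trace_jacobian_mul hδ hloc]
  have hLth : ∑ i, f i th = L th := rfl
  rw [hLth]
  have e : ∑ i, f i (y i) - (L th + 1 / 2 * Sig.trace) - 1 / 2 * (Sig.trace +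
      ‖shrink pen lam th‖ ^ 2 + 2 * ((stdMatrix P * Sig).trace - Sig.trace)) =
      (∑ i, f i (y i) - L xl - (stdMatrix P * Sig).trace) +
      (L xl - L th - 1 / 2 * ‖xl - th‖ ^ 2) +
      (1 / 2 * ‖xl - th‖ ^ 2 - 1 / 2 * ‖shrink pen lam th‖ ^ 2) := by ring
  rw [e]
  refine (abs_add_three _ _ _).trans ?_
  linarith

end CVSure

namespace CVSure

variable {k : ℕ}

/-! ### The ridge and lasso penalties -/

/-- Away from finitely many hyperplanes `⟪q.1, θ⟫ = q.2`, `q ∈ Q`, the proximal maps of `lam * pen`,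
`lam ∈ Lam`, are affine on balls around `θ` of a common radius, with linear parts of norm at most
one. -/
def ProxLocallyAffine (pen : Par k → ℝ) (Lam : Set ℝ) (Q : Finset (Par k × ℝ)) : Prop :=
  (∀ q ∈ Q, q.1 ≠ 0) ∧ ∀ ρ : ℝ, 0 < ρ → ∃ δ : ℝ, 0 < δ ∧ ∀ θ : Par k,
    (∀ q ∈ Q, ρ < |inner ℝ q.1 θ - q.2|) → ∀ lam ∈ Lam, ∃ P : Par k →L[ℝ] Par k, ‖P‖ ≤ 1 ∧
      ∀ φ ∈ Metric.closedBall θ δ, ∀ φ' ∈ Metric.closedBall θ δ,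
        prox pen lam φ - prox pen lam φ' = P (φ - φ')

section Ridge

variable {A : Matrix (Fin k) (Fin k) ℝ}

lemma ridgePenalty_eq (A : Matrix (Fin k) (Fin k) ℝ) (x : Par k) :
    ridgePenalty A x = 1 / 2 * inner ℝ x (Matrix.toEuclideanCLM (𝕜 := ℝ) A⁻¹ x) := by
  rw [ridgePenalty, EuclideanSpace.inner_eq_star_dotProduct]
  simp [dotProduct_comm]

lemma inner_toEuclideanCLM_nonneg (hA : A.PosDef) (x : Par k) :
    0 ≤ inner ℝ x (Matrix.toEuclideanCLM (𝕜 := ℝ) A⁻¹ x) := by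
  rw [EuclideanSpace.inner_eq_star_dotProduct]
  have := hA.inv.posSemidef.dotProduct_mulVec_nonneg (x : Fin k → ℝ)
  simpa [dotProduct_comm] using this

lemma inner_toEuclideanCLM_comm (hA : A.PosDef) (x y : Par k) :
    inner ℝ x (Matrix.toEuclideanCLM (𝕜 := ℝ) A⁻¹ y) =
      inner ℝ y (Matrix.toEuclideanCLM (𝕜 := ℝ) A⁻¹ x) := by
  have h := hA.inv.isHermitian
  rw [Matrix.IsHermitian, Matrix.conjTranspose_eq_transpose_of_trivial] at h
  rw [EuclideanSpace.inner_eq_star_dotProduct, EuclideanSpace.inner_eq_star_dotProduct]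
  simp only [star_trivial, Matrix.ofLp_toEuclideanCLM]
  rw [dotProduct_comm, Matrix.dotProduct_mulVec, ← Matrix.mulVec_transpose, h]

lemma isPenalty_ridgePenalty (hA : A.PosDef) : IsPenalty (ridgePenalty A) := by
  have e : ridgePenalty A = fun x => 1 / 2 * inner ℝ x (Matrix.toEuclideanCLM (𝕜 := ℝ) A⁻¹ x) :=
    funext (ridgePenalty_eq A)
  set B := Matrix.toEuclideanCLM (𝕜 := ℝ) A⁻¹ with hB
  refine ⟨⟨convex_univ, fun x _ y _ a b ha hb hab => ?_⟩, ?_, fun x => ?_, ?_⟩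
  · rw [e]
    have h1 := inner_toEuclideanCLM_nonneg hA (x - y)
    rw [← hB] at h1
    simp only [map_sub, map_add, map_smul, inner_sub_left, inner_sub_right, inner_add_left,
      inner_add_right, inner_smul_left, inner_smul_right, smul_eq_mul, conj_trivial] at h1 ⊢
    obtain rfl : b = 1 - a := by linarith
    nlinarith [mul_nonneg (mul_nonneg ha hb) h1]
  · rw [e]; fun_prop
  · rw [e]
    have h1 := inner_toEuclideanCLM_nonneg hA x
    show 0 ≤ 1 / 2 * inner ℝ x (B x)
    linarith
  · rw [e]; simp

/-- The proximal map of the ridge penalty is the linear contraction `(1 + lam A⁻¹)⁻¹`. -/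
lemma proxLocallyAffine_ridgePenalty (hA : A.PosDef) :
    ProxLocallyAffine (ridgePenalty A) (Set.Ici 0) ∅ := by
  refine ⟨by simp, fun ρ _ => ⟨1, one_pos, fun θ _ lam hl => ?_⟩⟩
  have hl : 0 ≤ lam := hl
  set B := Matrix.toEuclideanCLM (𝕜 := ℝ) A⁻¹ with hB
  set S : Par k →ₗ[ℝ] Par k := LinearMap.id + lam • (B : Par k →ₗ[ℝ] Par k) with hS
  have hSx : ∀ x, S x = x + lam • B x := fun x => rfl
  have hmono : ∀ x, ‖x‖ ^ 2 ≤ inner ℝ x (S x) := by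
    intro x
    rw [hSx, inner_add_right, inner_smul_right, real_inner_self_eq_norm_sq]
    have := mul_nonneg hl (inner_toEuclideanCLM_nonneg hA x)
    linarith
  have hinj : Function.Injective S := by
    rw [injective_iff_map_eq_zero]
    intro x hx
    have := hmono x
    rw [hx, inner_zero_right] at this
    exact norm_eq_zero.1 (pow_eq_zero_iff two_ne_zero |>.1 (le_antisymm this (sq_nonneg _)))
  set P : Par k →L[ℝ] Par k :=
    LinearMap.toContinuousLinearMap ((LinearEquiv.ofInjectiveEndo S hinj).symm : Par k →ₗ[ℝ] Par k)
    with hP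
  have hSP : ∀ x, S (P x) = x := fun x => (LinearEquiv.ofInjectiveEndo S hinj).apply_symm_apply x
  have hprox : ∀ x, prox (ridgePenalty A) lam x = P x := by
    intro x
    refine (isPenalty_ridgePenalty hA).prox_eq hl fun y => ?_
    have h1 : x - P x = lam • B (P x) := by
      have h0 := hSP x
      rw [hSx] at h0
      exact sub_eq_of_eq_add' h0.symm
    rw [h1, inner_smul_left, ridgePenalty_eq, ridgePenalty_eq]
    refine mul_le_mul_of_nonneg_left ?_ hl
    have h2 := inner_toEuclideanCLM_nonneg hA (y - P x)
    have h3 := inner_toEuclideanCLM_comm hA y (P x)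
    rw [← hB] at *
    have h4 := real_inner_comm y (B (P x))
    have h5 := real_inner_comm (P x) (B (P x))
    simp only [map_sub, inner_sub_left, inner_sub_right] at h2 ⊢
    linarith
  refine ⟨P, ?_, fun φ _ φ' _ => by rw [hprox, hprox, map_sub]⟩
  refine P.opNorm_le_bound zero_le_one fun x => ?_
  have h1 := hmono (P x)
  rw [hSP] at h1
  have h2 := real_inner_le_norm (P x) x
  rw [one_mul]
  by_contra hcon
  push Not at hcon
  have h5 : 0 < ‖P x‖ := lt_of_le_of_lt (norm_nonneg _) hcon
  nlinarith

end Ridge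

section Lasso

variable (A : Matrix (Fin k) (Fin k) ℝ)

/-- The coefficient `(A⁻¹ x)_j`. -/
noncomputable def lassoCoef (j : Fin k) : Par k →L[ℝ] ℝ :=
  (EuclideanSpace.proj j).comp (Matrix.toEuclideanCLM (𝕜 := ℝ) A⁻¹)

/-- The `j`-th column of `A`. -/
noncomputable def lassoCol (j : Fin k) : Par k := WithLp.toLp 2 (A.col j)

variable {A}

lemma lassoPenalty_eq (x : Par k) : lassoPenalty A x = ∑ j, |lassoCoef A j x| := by
  simp [lassoPenalty, lassoCoef]

lemma lassoCoef_lassoCol (hA : IsUnit A.det) (i j : Fin k) :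
    lassoCoef A i (lassoCol A j) = if i = j then 1 else 0 := by
  have h : A⁻¹.mulVec (A.col j) i = (A⁻¹ * A) i j := rfl
  have h2 : lassoCoef A i (lassoCol A j) = A⁻¹.mulVec (A.col j) i := by
    simp [lassoCoef, lassoCol]
  rw [h2, h, Matrix.nonsing_inv_mul _ hA, Matrix.one_apply]

lemma sum_lassoCoef_smul (hA : IsUnit A.det) (x : Par k) :
    ∑ j, lassoCoef A j x • lassoCol A j = x := by
  have h : A.mulVec (A⁻¹.mulVec x) = x := by
    rw [Matrix.mulVec_mulVec, Matrix.mul_nonsing_inv _ hA, Matrix.one_mulVec]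
  ext i
  have h2 := congrFun h i
  rw [← h2]
  simp [lassoCoef, lassoCol, Matrix.mulVec, dotProduct, mul_comm]

lemma isPenalty_lassoPenalty (A : Matrix (Fin k) (Fin k) ℝ) : IsPenalty (lassoPenalty A) := by
  have e : lassoPenalty A = fun x => ∑ j, |lassoCoef A j x| := funext lassoPenalty_eq
  refine ⟨⟨convex_univ, fun x _ y _ a b ha hb hab => ?_⟩, ?_, fun x => ?_, ?_⟩
  · rw [e]
    simp only [smul_eq_mul, Finset.mul_sum, ← Finset.sum_add_distrib]
    refine Finset.sum_le_sum fun j _ => ?_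
    rw [map_add, map_smul, map_smul]
    refine (abs_add_le _ _).trans ?_
    rw [smul_eq_mul, smul_eq_mul, abs_mul, abs_mul, abs_of_nonneg ha, abs_of_nonneg hb]
  · rw [e]; fun_prop
  · rw [e]; positivity
  · rw [e]; simp

/-- The dual variable `⟪A_j, θ - prox θ⟫` of the lasso. -/
noncomputable def lassoDual (A : Matrix (Fin k) (Fin k) ℝ) (lam : ℝ) (j : Fin k) (θ : Par k) : ℝ :=
  inner ℝ (lassoCol A j) (θ - prox (lassoPenalty A) lam θ)

lemma mul_lassoDual_le (hA : IsUnit A.det) {lam : ℝ} (hl : 0 ≤ lam) (j : Fin k) (θ : Par k)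
    (t : ℝ) : t * lassoDual A lam j θ ≤ lam *
      (|lassoCoef A j (prox (lassoPenalty A) lam θ) + t| -
        |lassoCoef A j (prox (lassoPenalty A) lam θ)|) := by
  have h := (isPenalty_lassoPenalty A).prox_variational hl θ
    (prox (lassoPenalty A) lam θ + t • lassoCol A j)
  set p := prox (lassoPenalty A) lam θ with hp
  rw [add_sub_cancel_left, inner_smul_right, real_inner_comm] at h
  refine h.trans (le_of_eq ?_)
  congr 1
  rw [lassoPenalty_eq, lassoPenalty_eq, ← Finset.sum_sub_distrib, Finset.sum_eq_single j]
  · simp [lassoCoef_lassoCol hA]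
  · intro i _ hij
    simp [lassoCoef_lassoCol hA, hij]
  · simp

lemma abs_lassoDual_le (hA : IsUnit A.det) {lam : ℝ} (hl : 0 ≤ lam) (j : Fin k) (θ : Par k) :
    |lassoDual A lam j θ| ≤ lam := by
  have h1 := mul_lassoDual_le hA hl j θ 1
  have h2 := mul_lassoDual_le hA hl j θ (-1)
  set u := lassoCoef A j (prox (lassoPenalty A) lam θ)
  have h3 : |u + 1| - |u| ≤ 1 := by linarith [abs_add_le u 1, abs_one (α := ℝ)]
  have h4 : |u + -1| - |u| ≤ 1 := by
    have := abs_add_le u (-1)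
    rw [abs_neg, abs_one] at this; linarith
  rw [abs_le]
  constructor <;> nlinarith

lemma lassoDual_eq_of_pos (hA : IsUnit A.det) {lam : ℝ} (hl : 0 ≤ lam) {j : Fin k} {θ : Par k}
    (hu : 0 < lassoCoef A j (prox (lassoPenalty A) lam θ)) : lassoDual A lam j θ = lam := by
  have h1 := mul_lassoDual_le hA hl j θ (-lassoCoef A j (prox (lassoPenalty A) lam θ))
  have h2 := (abs_le.1 (abs_lassoDual_le hA hl j θ)).2
  rw [add_neg_cancel, abs_zero, abs_of_pos hu] at h1
  refine le_antisymm h2 (le_of_mul_le_mul_left ?_ hu)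
  linarith

lemma lassoDual_eq_of_neg (hA : IsUnit A.det) {lam : ℝ} (hl : 0 ≤ lam) {j : Fin k} {θ : Par k}
    (hu : lassoCoef A j (prox (lassoPenalty A) lam θ) < 0) : lassoDual A lam j θ = -lam := by
  have h1 := mul_lassoDual_le hA hl j θ (-lassoCoef A j (prox (lassoPenalty A) lam θ))
  have h2 := (abs_le.1 (abs_lassoDual_le hA hl j θ)).1
  rw [add_neg_cancel, abs_zero, abs_of_neg hu] at h1
  refine le_antisymm (le_of_mul_le_mul_left (a := -lassoCoef A j (prox (lassoPenalty A) lam θ)) ?_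
    (neg_pos.2 hu)) h2
  linarith

lemma exists_lasso_bound (A : Matrix (Fin k) (Fin k) ℝ) :
    ∃ M : ℝ, 0 < M ∧ (∀ j, ‖lassoCol A j‖ ≤ M) ∧ ∀ j x, |lassoCoef A j x| ≤ M * ‖x‖ := by
  refine ⟨∑ j, ‖lassoCol A j‖ + ∑ j, ‖lassoCoef A j‖ + 1, by positivity, fun j => ?_,
    fun j x => ?_⟩
  · have h1 := Finset.single_le_sum (f := fun j => ‖lassoCol A j‖) (fun _ _ => norm_nonneg _)
      (Finset.mem_univ j)
    have h2 : 0 ≤ ∑ j, ‖lassoCoef A j‖ := by positivity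
    linarith
  · refine ((lassoCoef A j).le_opNorm x).trans (mul_le_mul_of_nonneg_right ?_ (norm_nonneg _))
    have h1 := Finset.single_le_sum (f := fun j => ‖lassoCoef A j‖) (fun _ _ => norm_nonneg _)
      (Finset.mem_univ j)
    have h2 : 0 ≤ ∑ j, ‖lassoCol A j‖ := by positivity
    linarith

/-- Where strict complementarity holds with margin `ρ`, the active set and the signs do not change
nearby, and there the proximal map of the lasso acts as the projection onto the span of the active
columns. -/
lemma lasso_prox_locally_affine (hA : IsUnit A.det) {M : ℝ} (hM : 0 < M)
    (hcol : ∀ j, ‖lassoCol A j‖ ≤ M) (hcoef : ∀ j x, |lassoCoef A j x| ≤ M * ‖x‖) {lam ρ : ℝ}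
    (hl : 0 ≤ lam) (hρ : 0 < ρ) {θ : Par k}
    (h : ∀ j, ρ < |lassoCoef A j (prox (lassoPenalty A) lam θ)| ∨
      |lassoDual A lam j θ| < lam - ρ) :
    ∃ P : Par k →L[ℝ] Par k, ‖P‖ ≤ 1 ∧
      ∀ φ ∈ Metric.closedBall θ (ρ / (4 * M)), ∀ φ' ∈ Metric.closedBall θ (ρ / (4 * M)),
        prox (lassoPenalty A) lam φ - prox (lassoPenalty A) lam φ' = P (φ - φ') := by
  set p := prox (lassoPenalty A) lam with hp
  have hlip : ∀ x y, ‖p x - p y‖ ≤ ‖x - y‖ := (isPenalty_lassoPenalty A).prox_lipschitz hl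
  set S : Set (Fin k) := {j | ρ < |lassoCoef A j (p θ)|} with hS
  have hclose : ∀ φ ∈ Metric.closedBall θ (ρ / (4 * M)), ∀ j,
      |lassoCoef A j (p φ) - lassoCoef A j (p θ)| ≤ ρ / 2 ∧
      |lassoDual A lam j φ - lassoDual A lam j θ| ≤ ρ / 2 := by
    intro φ hφ j
    rw [mem_closedBall_iff_norm, le_div_iff₀ (by positivity)] at hφ
    constructor
    · rw [← map_sub]
      have h1 := hcoef j (p φ - p θ)
      have h2 := mul_le_mul_of_nonneg_left (hlip φ θ) hM.le
      linarith
    · rw [lassoDual, lassoDual, ← inner_sub_right]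
      have h1 : ‖φ - p φ - (θ - p θ)‖ ≤ ‖φ - θ‖ + ‖φ - θ‖ := by
        have e : φ - p φ - (θ - p θ) = (φ - θ) - (p φ - p θ) := by abel
        rw [e]
        exact (norm_sub_le _ _).trans (add_le_add le_rfl (hlip _ _))
      have h2 := abs_real_inner_le_norm (lassoCol A j) (φ - p φ - (θ - p θ))
      have h3 := mul_le_mul (hcol j) h1 (norm_nonneg _) hM.le
      linarith
  -- on the active set the dual variable is constant, off it the coefficient vanishes
  have hdual : ∀ φ ∈ Metric.closedBall θ (ρ / (4 * M)), ∀ j ∈ S,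
      lassoDual A lam j φ = lassoDual A lam j θ := by
    intro φ hφ j hj
    have h1 := abs_le.1 (hclose φ hφ j).1
    have hj : ρ < |lassoCoef A j (p θ)| := hj
    rcases lt_abs.1 hj with h2 | h2
    · rw [lassoDual_eq_of_pos hA hl (j := j) (θ := φ) (by linarith [h1.1]),
        lassoDual_eq_of_pos hA hl (j := j) (θ := θ) (by linarith)]
    · rw [lassoDual_eq_of_neg hA hl (j := j) (θ := φ) (by linarith [h1.2]),
        lassoDual_eq_of_neg hA hl (j := j) (θ := θ) (by linarith)]
  have hzero : ∀ φ ∈ Metric.closedBall θ (ρ / (4 * M)), ∀ j ∉ S, lassoCoef A j (p φ) = 0 := by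
    intro φ hφ j hj
    have h1 := (hclose φ hφ j).2
    have h2 := (h j).resolve_left hj
    have h3 : |lassoDual A lam j φ| < lam := by
      have := abs_sub_abs_le_abs_sub (lassoDual A lam j φ) (lassoDual A lam j θ)
      linarith
    rcases lt_trichotomy (lassoCoef A j (p φ)) 0 with h4 | h4 | h4
    · rw [lassoDual_eq_of_neg hA hl h4, abs_neg, abs_of_nonneg hl] at h3
      exact absurd h3 (lt_irrefl _)
    · exact h4
    · rw [lassoDual_eq_of_pos hA hl h4, abs_of_nonneg hl] at h3
      exact absurd h3 (lt_irrefl _)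
  set K : Submodule ℝ (Par k) := Submodule.span ℝ (lassoCol A '' S) with hK
  refine ⟨K.starProjection, K.starProjection_norm_le, fun φ hφ φ' hφ' => ?_⟩
  symm
  apply Submodule.eq_starProjection_of_mem_of_inner_eq_zero
  · rw [← sum_lassoCoef_smul hA (p φ - p φ')]
    refine Submodule.sum_mem _ fun j _ => ?_
    by_cases hj : j ∈ S
    · exact Submodule.smul_mem _ _ (Submodule.subset_span ⟨j, hj, rfl⟩)
    · rw [map_sub, hzero φ hφ j hj, hzero φ' hφ' j hj, sub_zero, zero_smul]
      exact K.zero_mem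
  · intro w hw
    induction hw using Submodule.span_induction with
    | mem x hx =>
      obtain ⟨j, hj, rfl⟩ := hx
      have h1 := (hdual φ hφ j hj).trans (hdual φ' hφ' j hj).symm
      rw [lassoDual, lassoDual, ← sub_eq_zero, ← inner_sub_right] at h1
      rw [real_inner_comm, ← h1]
      congr 1; abel
    | zero => exact inner_zero_right _
    | add x y _ _ hx hy => rw [inner_add_right, hx, hy, add_zero]
    | smul t x _ hx => rw [inner_smul_right, hx, mul_zero]

/-- The normal of the slab that catches a failure of strict complementarity at `j` when the other
active columns are those in `S`: the component of `A_j` orthogonal to these columns. -/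
noncomputable def lassoNormal (A : Matrix (Fin k) (Fin k) ℝ) (S : Finset (Fin k)) (j : Fin k) :
    Par k :=
  lassoCol A j - (Submodule.span ℝ (lassoCol A '' S)).starProjection (lassoCol A j)

lemma lassoCoef_eq_zero_of_mem_span (hA : IsUnit A.det) {S : Finset (Fin k)} {i : Fin k}
    (hi : i ∉ S) {x : Par k} (hx : x ∈ Submodule.span ℝ (lassoCol A '' S)) :
    lassoCoef A i x = 0 := by
  induction hx using Submodule.span_induction with
  | mem x hx =>
    obtain ⟨j, hj, rfl⟩ := hx
    rw [lassoCoef_lassoCol hA, if_neg]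
    rintro rfl
    exact hi hj
  | zero => exact map_zero _
  | add x y _ _ hx hy => rw [map_add, hx, hy, add_zero]
  | smul t x _ hx => rw [map_smul, hx, smul_zero]

lemma lassoCoef_lassoNormal (hA : IsUnit A.det) {S : Finset (Fin k)} {i : Fin k} (hi : i ∉ S)
    (j : Fin k) : lassoCoef A i (lassoNormal A S j) = if i = j then 1 else 0 := by
  rw [lassoNormal, map_sub, lassoCoef_lassoCol hA, lassoCoef_eq_zero_of_mem_span hA hi
    (Submodule.starProjection_apply_mem _ _), sub_zero]

lemma inner_lassoNormal_lassoCol {S : Finset (Fin k)} {i : Fin k} (hi : i ∈ S) (j : Fin k) :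
    inner ℝ (lassoNormal A S j) (lassoCol A i) = 0 :=
  Submodule.starProjection_inner_eq_zero _ _ (Submodule.subset_span ⟨i, hi, rfl⟩)

/-- If strict complementarity fails at `j` by at most `ρ`, then `θ` lies in a slab of width of order
`ρ`, which depends only on the active set, on the signs and on `j`. -/
lemma lasso_slab (hA : IsUnit A.det) {M : ℝ} (hM : 0 < M)
    (hcol : ∀ j, ‖lassoCol A j‖ ≤ M) {lam ρ : ℝ} (hl : 0 ≤ lam) {θ : Par k} {j : Fin k}
    (h1 : |lassoCoef A j (prox (lassoPenalty A) lam θ)| ≤ ρ)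
    (h2 : lam - ρ ≤ |lassoDual A lam j θ|) :
    ∃ S : Finset (Fin k), j ∉ S ∧ ∃ s : Fin k → SignType,
      |inner ℝ (lassoNormal A S j) θ -
        lam * ∑ i, lassoCoef A i (lassoNormal A S j) * (s i : ℝ)| ≤ (2 * M ^ 2 + 1) * ρ := by
  classical
  set p := prox (lassoPenalty A) lam θ with hp
  have hρ : 0 ≤ ρ := (abs_nonneg _).trans h1
  refine ⟨Finset.univ.filter fun i => lassoCoef A i p ≠ 0 ∧ i ≠ j, by simp,
    fun i => if i = j then SignType.sign (lassoDual A lam j θ)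
      else SignType.sign (lassoCoef A i p), ?_⟩
  set S := Finset.univ.filter fun i => lassoCoef A i p ≠ 0 ∧ i ≠ j with hS
  have hjS : j ∉ S := by simp [hS]
  set v := lassoNormal A S j with hv
  have e1 : inner ℝ v p = lassoCoef A j p * inner ℝ v (lassoCol A j) := by
    conv_lhs => rw [← sum_lassoCoef_smul hA p]
    rw [inner_sum, Finset.sum_eq_single j]
    · rw [inner_smul_right]
    · intro i _ hij
      rw [inner_smul_right]
      by_cases hi : i ∈ S
      · rw [hv, inner_lassoNormal_lassoCol hi, mul_zero]
      · have : lassoCoef A i p = 0 := by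
          by_contra hne
          exact hi (by simp [hS, hne, hij])
        rw [this, zero_mul]
    · simp
  have e2 : inner ℝ v (θ - p) = ∑ i, lassoCoef A i v * lassoDual A lam i θ := by
    conv_lhs => rw [← sum_lassoCoef_smul hA v]
    rw [sum_inner]
    exact Finset.sum_congr rfl fun i _ => by rw [inner_smul_left]; rfl
  have hvj : lassoCoef A j v = 1 := by rw [hv, lassoCoef_lassoNormal hA hjS, if_pos rfl]
  have e3 : (∑ i, lassoCoef A i v * lassoDual A lam i θ) -
      lam * ∑ i, lassoCoef A i v * (((if i = j then SignType.sign (lassoDual A lam j θ)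
        else SignType.sign (lassoCoef A i p) : SignType)) : ℝ) =
      lassoDual A lam j θ - lam * (SignType.sign (lassoDual A lam j θ) : ℝ) := by
    rw [Finset.mul_sum, ← Finset.sum_sub_distrib, Finset.sum_eq_single j]
    · rw [hvj, if_pos rfl]; ring
    · intro i _ hij
      rw [if_neg hij]
      by_cases hi : i ∈ S
      · have hne : lassoCoef A i p ≠ 0 := by
          have := hi
          simp only [hS, Finset.mem_filter] at this
          exact this.2.1
        rcases lt_or_gt_of_ne hne with h4 | h4
        · rw [lassoDual_eq_of_neg hA hl h4, sign_neg h4]; simp; ring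
        · rw [lassoDual_eq_of_pos hA hl h4, sign_pos h4]; simp; ring
      · rw [hv, lassoCoef_lassoNormal hA hi, if_neg hij]; ring
    · simp
  have e4 : inner ℝ v θ = inner ℝ v p + inner ℝ v (θ - p) := by
    rw [← inner_add_right, add_sub_cancel]
  have h5 : |lassoDual A lam j θ - lam * (SignType.sign (lassoDual A lam j θ) : ℝ)| ≤ ρ := by
    have h6 := abs_lassoDual_le hA hl j θ
    rcases lt_trichotomy (lassoDual A lam j θ) 0 with h7 | h7 | h7
    · rw [sign_neg h7]
      rw [abs_of_neg h7] at h2 h6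
      simp only [SignType.coe_neg, SignType.coe_one]
      rw [abs_le]; constructor <;> linarith
    · rw [h7]; simpa using hρ
    · rw [sign_pos h7]
      rw [abs_of_pos h7] at h2 h6
      simp only [SignType.coe_one]
      rw [abs_le]; constructor <;> linarith
  have h6 : |inner ℝ v (lassoCol A j)| ≤ 2 * M ^ 2 := by
    have hv1 : ‖v‖ ≤ 2 * M := by
      have h7 := Submodule.norm_starProjection_apply_le (Submodule.span ℝ (lassoCol A '' S))
        (lassoCol A j)
      have := norm_sub_le (lassoCol A j)
        ((Submodule.span ℝ (lassoCol A '' S)).starProjection (lassoCol A j))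
      rw [hv, lassoNormal]
      linarith [hcol j]
    refine (abs_real_inner_le_norm _ _).trans ?_
    have := mul_le_mul hv1 (hcol j) (norm_nonneg _) (by positivity)
    linarith
  rw [e4, e1, e2, add_sub_assoc, e3]
  refine (abs_add_le _ _).trans ?_
  rw [abs_mul]
  have := mul_le_mul h1 h6 (abs_nonneg _) hρ
  linarith

lemma exists_proxLocallyAffine_lassoPenalty_singleton (hA : IsUnit A.det) {lam : ℝ}
    (hl : 0 ≤ lam) : ∃ Q, ProxLocallyAffine (lassoPenalty A) {lam} Q := by
  classical
  obtain ⟨M, hM, hcol, hcoef⟩ := exists_lasso_bound A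
  refine ⟨((Finset.univ : Finset (Finset (Fin k) × Fin k × (Fin k → SignType))).filter
    fun q => q.2.1 ∉ q.1).image fun q => (lassoNormal A q.1 q.2.1,
      lam * ∑ i, lassoCoef A i (lassoNormal A q.1 q.2.1) * (q.2.2 i : ℝ)), ?_, fun ρ hρ => ?_⟩
  · intro q hq
    obtain ⟨⟨S, j, s⟩, hq1, rfl⟩ := Finset.mem_image.1 hq
    have hj : j ∉ S := (Finset.mem_filter.1 hq1).2
    intro h0
    have h1 := lassoCoef_lassoNormal hA hj j
    rw [show lassoNormal A S j = 0 from h0, map_zero, if_pos rfl] at h1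
    exact zero_ne_one h1
  · set r := ρ / (2 * M ^ 2 + 1) with hr
    have hr0 : 0 < r := by positivity
    refine ⟨r / (4 * M), by positivity, fun θ hθ lam' hlam' => ?_⟩
    obtain rfl : lam' = lam := hlam'
    refine lasso_prox_locally_affine hA hM hcol hcoef hl hr0 fun j => ?_
    by_contra hcon
    push Not at hcon
    obtain ⟨S, hj, s, hs⟩ := lasso_slab hA hM hcol hl hcon.1 hcon.2
    have h1 := hθ (_, _) (Finset.mem_image.2 ⟨(S, j, s), by simp [hj], rfl⟩)
    rw [hr, mul_div_cancel₀ _ (by positivity)] at hs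
    exact absurd h1 (not_lt.2 hs)

lemma ProxLocallyAffine.union {pen : Par k → ℝ} {Lam Lam' : Set ℝ} {Q Q' : Finset (Par k × ℝ)}
    [DecidableEq (Par k × ℝ)]
    (h : ProxLocallyAffine pen Lam Q) (h' : ProxLocallyAffine pen Lam' Q') :
    ProxLocallyAffine pen (Lam ∪ Lam') (Q ∪ Q') := by
  refine ⟨fun q hq => (Finset.mem_union.1 hq).elim (h.1 q) (h'.1 q), fun ρ hρ => ?_⟩
  obtain ⟨δ, hδ, H⟩ := h.2 ρ hρ
  obtain ⟨δ', hδ', H'⟩ := h'.2 ρ hρ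
  refine ⟨min δ δ', lt_min hδ hδ', fun θ hθ lam hlam => ?_⟩
  have hs : Metric.closedBall θ (min δ δ') ⊆ Metric.closedBall θ δ :=
    Metric.closedBall_subset_closedBall (min_le_left _ _)
  have hs' : Metric.closedBall θ (min δ δ') ⊆ Metric.closedBall θ δ' :=
    Metric.closedBall_subset_closedBall (min_le_right _ _)
  rcases hlam with hlam | hlam
  · obtain ⟨P, hP, hP'⟩ := H θ (fun q hq => hθ q (Finset.mem_union_left _ hq)) lam hlam
    exact ⟨P, hP, fun φ hφ φ' hφ' => hP' φ (hs hφ) φ' (hs hφ')⟩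
  · obtain ⟨P, hP, hP'⟩ := H' θ (fun q hq => hθ q (Finset.mem_union_right _ hq)) lam hlam
    exact ⟨P, hP, fun φ hφ φ' hφ' => hP' φ (hs' hφ) φ' (hs' hφ')⟩

lemma exists_proxLocallyAffine_lassoPenalty (hA : IsUnit A.det) {Lam : Set ℝ} (hfin : Lam.Finite)
    (hl : Lam ⊆ Set.Ici 0) : ∃ Q, ProxLocallyAffine (lassoPenalty A) Lam Q := by
  classical
  induction Lam, hfin using Set.Finite.induction_on with
  | empty => exact ⟨∅, by simp, fun ρ _ => ⟨1, one_pos, by simp⟩⟩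
  | @insert lam s _ _ ih =>
    obtain ⟨Q, hQ⟩ := ih ((Set.subset_insert _ _).trans hl)
    obtain ⟨Q', hQ'⟩ := exists_proxLocallyAffine_lassoPenalty_singleton hA
      (hl (Set.mem_insert _ _))
    exact ⟨_, hQ'.union hQ⟩

end Lasso

/-- Both kinds of penalty satisfy the assumptions of the deterministic comparison. -/
lemma penalty_facts {pen : Par k → ℝ} {Lam : Set ℝ} {Sig : Matrix (Fin k) (Fin k) ℝ}
    (h : IsRidge pen Lam ∨ (IsLasso pen Lam ∧ Sig.PosDef)) :
    IsPenalty pen ∧ (∀ lam ∈ Lam, 0 ≤ lam) ∧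
      ∃ Q, ProxLocallyAffine pen Lam Q ∧ (Q = ∅ ∨ Sig.PosDef) := by
  rcases h with ⟨A, hA, rfl, rfl⟩ | ⟨⟨A, hA, rfl, hfin, hl⟩, hSig⟩
  · exact ⟨isPenalty_ridgePenalty hA, fun _ h => h, ∅, proxLocallyAffine_ridgePenalty hA,
      Or.inl rfl⟩
  · obtain ⟨Q, hQ⟩ := exists_proxLocallyAffine_lassoPenalty hA hfin hl
    exact ⟨isPenalty_lassoPenalty A, hl, Q, hQ, Or.inr hSig⟩

end CVSure

namespace CVSure

/-! ### Events of high probability and laws of large numbers -/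

section Events

variable {Z : Type*} [MeasurableSpace Z] {μ : ℕ → Measure Z}

instance [∀ n, IsProbabilityMeasure (μ n)] (n : ℕ) : IsProbabilityMeasure (sampleLaw μ n) := by
  unfold sampleLaw; infer_instance

/-- For all large `n`, the event `E n` fails with (outer) probability at most `τ`. -/
def EvProb (μ : ℕ → Measure Z) (τ : ℝ) (E : (n : ℕ) → (Fin n → Z) → Prop) : Prop :=
  ∀ᶠ n in atTop, sampleLaw μ n {ω | ¬ E n ω} ≤ ENNReal.ofReal τ

/-- The (outer) probability that the event `E n` fails tends to zero. -/
def HighProb (μ : ℕ → Measure Z) (E : (n : ℕ) → (Fin n → Z) → Prop) : Prop :=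
  ∀ τ : ℝ, 0 < τ → EvProb μ τ E

lemma highProb_iff_tendsto {E : (n : ℕ) → (Fin n → Z) → Prop} :
    HighProb μ E ↔ Tendsto (fun n => sampleLaw μ n {ω | ¬ E n ω}) atTop (𝓝 0) := by
  rw [ENNReal.tendsto_nhds_zero]
  constructor
  · intro h ε hε
    rcases eq_or_ne ε ⊤ with rfl | hne
    · exact Eventually.of_forall fun _ => le_top
    · have := h ε.toReal (ENNReal.toReal_pos hε.ne' hne)
      simpa only [EvProb, ENNReal.ofReal_toReal hne] using this
  · intro h τ hτ
    exact h _ (ENNReal.ofReal_pos.2 hτ)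

variable {E E' : (n : ℕ) → (Fin n → Z) → Prop} {τ τ' : ℝ}

lemma EvProb.mono (h : EvProb μ τ E) (hE : ∀ᶠ n in atTop, ∀ ω, E n ω → E' n ω) :
    EvProb μ τ E' := by
  filter_upwards [h, hE] with n hn hEn
  refine le_trans (measure_mono fun ω hω => ?_) hn
  exact fun hω' => hω (hEn ω hω')

lemma EvProb.and (h : EvProb μ τ E) (h' : EvProb μ τ' E') (hτ : 0 ≤ τ) (hτ' : 0 ≤ τ') :
    EvProb μ (τ + τ') fun n ω => E n ω ∧ E' n ω := by
  filter_upwards [h, h'] with n hn hn'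
  rw [ENNReal.ofReal_add hτ hτ']
  refine le_trans (measure_mono fun ω hω => ?_) ((measure_union_le _ _).trans (add_le_add hn hn'))
  by_cases h1 : E n ω
  · exact Or.inr fun h2 => hω ⟨h1, h2⟩
  · exact Or.inl h1

lemma HighProb.mono (h : HighProb μ E) (hE : ∀ᶠ n in atTop, ∀ ω, E n ω → E' n ω) :
    HighProb μ E' := fun τ hτ => (h τ hτ).mono hE

lemma HighProb.and (h : HighProb μ E) (h' : HighProb μ E') :
    HighProb μ fun n ω => E n ω ∧ E' n ω := fun τ hτ => by
  have := (h (τ / 2) (by positivity)).and (h' (τ / 2) (by positivity)) (by positivity)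
    (by positivity)
  rwa [add_halves] at this

lemma highProb_forall_finset {ι : Type*} (s : Finset ι) {F : ι → (n : ℕ) → (Fin n → Z) → Prop}
    (h : ∀ i ∈ s, HighProb μ (F i)) : HighProb μ fun n ω => ∀ i ∈ s, F i n ω := by
  classical
  induction s using Finset.induction_on with
  | empty => exact fun τ _ => Eventually.of_forall fun n => by simp
  | insert a s _ ih =>
    refine ((h a (Finset.mem_insert_self _ _)).and
      (ih fun i hi => h i (Finset.mem_insert_of_mem hi))).mono (Eventually.of_forall fun n ω hω => ?_)
    intro i hi
    rcases Finset.mem_insert.1 hi with rfl | hi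
    · exact hω.1
    · exact hω.2 i hi

end Events

section Laws

variable {Z : Type*} [MeasurableSpace Z]

lemma ae_sample {ν : Measure Z} [IsProbabilityMeasure ν] {p : Z → Prop} (h : ∀ᵐ z ∂ν, p z)
    (n : ℕ) : ∀ᵐ ω ∂(Measure.pi fun _ : Fin n => ν), ∀ i, p (ω i) :=
  ae_all_iff.2 fun i => (measurePreserving_eval (fun _ : Fin n => ν) i).quasiMeasurePreserving.ae h

lemma highProb_of_ae {μ : ℕ → Measure Z} [∀ n, IsProbabilityMeasure (μ n)] {p : ℕ → Z → Prop}
    (h : ∀ n, 1 ≤ n → ∀ᵐ z ∂(μ n), p n z) : HighProb μ fun n ω => ∀ i, p n (ω i) := by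
  intro τ _
  filter_upwards [eventually_ge_atTop 1] with n hn
  have : sampleLaw μ n {ω | ¬ ∀ i, p n (ω i)} = 0 := ae_iff.1 (ae_sample (h n hn) n)
  rw [this]
  exact zero_le

/-- Chebyshev's inequality for a sample mean. -/
lemma measure_avg_sub_ge_le {ν : Measure Z} [IsProbabilityMeasure ν] {X : Z → ℝ}
    (hX : MemLp X 2 ν) {n : ℕ} (hn : 1 ≤ n) {ε : ℝ} (hε : 0 < ε) :
    (Measure.pi fun _ : Fin n => ν) {ω | ε ≤ |(n : ℝ)⁻¹ * ∑ i, X (ω i) - ∫ z, X z ∂ν|} ≤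
      ENNReal.ofReal ((∫ z, X z ^ 2 ∂ν) / (n * ε ^ 2)) := by
  have hn0 : (0 : ℝ) < n := by exact_mod_cast hn
  have hi : ∀ i : Fin n, MemLp (fun ω : Fin n → Z => X (ω i)) 2 (Measure.pi fun _ => ν) :=
    fun i => hX.comp_measurePreserving (measurePreserving_eval (fun _ : Fin n => ν) i)
  set S : (Fin n → Z) → ℝ := ∑ i, fun ω => X (ω i) with hS
  have hSm : MemLp S 2 (Measure.pi fun _ : Fin n => ν) := memLp_finsetSum' _ fun i _ => hi i
  have hmean : ∫ ω, S ω ∂(Measure.pi fun _ : Fin n => ν) = n * ∫ z, X z ∂ν := by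
    simp only [hS, Finset.sum_apply]
    rw [integral_finsetSum _ fun i _ => (hi i).integrable one_le_two]
    rw [Finset.sum_congr rfl fun i _ => integral_comp_eval (μ := fun _ : Fin n => ν) hX.1]
    simp
  have h := ProbabilityTheory.meas_ge_le_variance_div_sq hSm (c := n * ε) (by positivity)
  rw [ProbabilityTheory.variance_sum_pi (fun _ => hX), hmean] at h
  refine le_trans (le_of_eq ?_) (h.trans (ENNReal.ofReal_le_ofReal ?_))
  · congr 1
    ext ω
    have e : (n : ℝ)⁻¹ * ∑ i, X (ω i) - ∫ z, X z ∂ν = (n : ℝ)⁻¹ * (S ω - n * ∫ z, X z ∂ν) := by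
      simp only [hS, Finset.sum_apply]
      field_simp
    simp only [Set.mem_ofPred_eq]
    rw [e, abs_mul, abs_of_pos (inv_pos.2 hn0), le_inv_mul_iff₀ hn0]
  · have h1 : ProbabilityTheory.variance X ν ≤ ∫ z, X z ^ 2 ∂ν :=
      ProbabilityTheory.variance_le_expectation_sq hX.1
    simp only [Finset.sum_const, Finset.card_univ, Fintype.card_fin, nsmul_eq_mul]
    rw [div_le_div_iff₀ (by positivity) (by positivity)]
    calc _ ≤ (n * ∫ z, X z ^ 2 ∂ν) * (n * ε ^ 2) := by gcongr
      _ = _ := by ring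

variable {μ : ℕ → Measure Z} [∀ n, IsProbabilityMeasure (μ n)]

lemma eventually_div_le (C : ℝ) {τ : ℝ} (hτ : 0 < τ) : ∀ᶠ n : ℕ in atTop, C / n ≤ τ := by
  have := (tendsto_const_div_atTop_nhds_zero_nat C).eventually (eventually_lt_nhds hτ)
  exact this.mono fun n hn => hn.le

/-- The law of large numbers for rows with bounded second moments. -/
lemma highProb_avg_of_sq {X : ℕ → Z → ℝ} {M : ℝ} (hX : ∀ n, 1 ≤ n → MemLp (X n) 2 (μ n))
    (hM : ∀ n, 1 ≤ n → ∫ z, X n z ^ 2 ∂(μ n) ≤ M) {ε : ℝ} (hε : 0 < ε) :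
    HighProb μ fun n ω => |(n : ℝ)⁻¹ * ∑ i, X n (ω i) - ∫ z, X n z ∂(μ n)| ≤ ε := by
  intro τ hτ
  filter_upwards [eventually_ge_atTop 1, eventually_div_le (M / ε ^ 2) hτ] with n hn hn'
  refine le_trans (measure_mono fun ω hω => ?_)
    ((measure_avg_sub_ge_le (hX n hn) hn hε).trans (ENNReal.ofReal_le_ofReal ?_))
  · exact (not_le.1 hω).le
  · refine le_trans ?_ hn'
    rw [div_div, mul_comm (ε ^ 2)]
    have hn0 : (0 : ℝ) < n := by exact_mod_cast hn
    gcongr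
    exact hM n hn

/-- Sample means of nonnegative variables with bounded means are bounded in probability. -/
lemma exists_evProb_avg_le {Y : ℕ → Z → ℝ} {M : ℝ} (hY : ∀ n, 1 ≤ n → Integrable (Y n) (μ n))
    (h0 : ∀ n z, 0 ≤ Y n z) (hM : ∀ n, 1 ≤ n → ∫ z, Y n z ∂(μ n) ≤ M) {τ : ℝ} (hτ : 0 < τ) :
    ∃ K : ℝ, 0 < K ∧ EvProb μ τ fun n ω => (n : ℝ)⁻¹ * ∑ i, Y n (ω i) ≤ K := by
  refine ⟨(|M| + 1) / τ, by positivity, ?_⟩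
  filter_upwards [eventually_ge_atTop 1] with n hn
  have hn0 : (0 : ℝ) < n := by exact_mod_cast hn
  have hi : ∀ i : Fin n, Integrable (fun ω : Fin n → Z => Y n (ω i)) (sampleLaw μ n) :=
    fun i => (measurePreserving_eval (fun _ : Fin n => μ n) i).integrable_comp_of_integrable
      (hY n hn)
  have hint : Integrable (fun ω => (n : ℝ)⁻¹ * ∑ i, Y n (ω i)) (sampleLaw μ n) :=
    (integrable_finsetSum _ fun i _ => hi i).const_mul _
  have hnn : ∀ ω : Fin n → Z, 0 ≤ (n : ℝ)⁻¹ * ∑ i, Y n (ω i) := fun ω =>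
    mul_nonneg (inv_nonneg.2 hn0.le) (Finset.sum_nonneg fun i _ => h0 n _)
  have hmean : ∫ ω, (n : ℝ)⁻¹ * ∑ i, Y n (ω i) ∂(sampleLaw μ n) ≤ |M| := by
    rw [integral_const_mul, integral_finsetSum _ fun i _ => hi i]
    unfold sampleLaw
    rw [Finset.sum_congr rfl fun i _ =>
      integral_comp_eval (μ := fun _ : Fin n => μ n) (hY n hn).aestronglyMeasurable]
    simp only [Finset.sum_const, Finset.card_univ, Fintype.card_fin, nsmul_eq_mul]
    rw [inv_mul_cancel_left₀ hn0.ne']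
    exact (hM n hn).trans (le_abs_self M)
  have hmarkov := mul_meas_ge_le_integral_of_nonneg (Eventually.of_forall hnn) hint
    ((|M| + 1) / τ)
  have h1 : (sampleLaw μ n).real {ω | (|M| + 1) / τ ≤ (n : ℝ)⁻¹ * ∑ i, Y n (ω i)} ≤ τ := by
    have h2 := hmarkov.trans hmean
    rw [div_mul_eq_mul_div, div_le_iff₀ hτ] at h2
    have h3 : 0 < |M| + 1 := by positivity
    by_contra hcon
    push Not at hcon
    nlinarith [abs_nonneg M]
  refine le_trans (measure_mono fun ω hω => ?_) ((ENNReal.le_ofReal_iff_toReal_le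
    (measure_ne_top _ _) hτ.le).2 h1)
  exact (not_le.1 hω).le

/-- With bounded fourth moments, the largest of the `n` observations is of smaller order than
`√n`. -/
lemma highProb_norm_le_sqrt {E : Type*} [NormedAddCommGroup E] {s : ℕ → Z → E} {M : ℝ≥0}
    (hs : ∀ n, 1 ≤ n → AEStronglyMeasurable (s n) (μ n))
    (hM : ∀ n, 1 ≤ n → ∫⁻ z, ‖s n z‖ₑ ^ 4 ∂(μ n) ≤ M) {κ : ℝ} (hκ : 0 < κ) :
    HighProb μ fun n ω => ∀ i, ‖s n (ω i)‖ ≤ κ * Real.sqrt n := by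
  intro τ hτ
  filter_upwards [eventually_ge_atTop 1, eventually_div_le ((M : ℝ) / κ ^ 4) hτ] with n hn hn'
  have hn0 : (0 : ℝ) < n := by exact_mod_cast hn
  set T : Set Z := {z | ENNReal.ofReal (κ ^ 4 * n ^ 2) ≤ ‖s n z‖ₑ ^ 4} with hT
  have h1 : μ n T ≤ ENNReal.ofReal ((M : ℝ) / (κ ^ 4 * n ^ 2)) := by
    have h2 := mul_meas_ge_le_lintegral₀ ((hs n hn).enorm.pow_const 4)
      (ENNReal.ofReal (κ ^ 4 * n ^ 2))
    have h3 := h2.trans (hM n hn)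
    have hpos : 0 < κ ^ 4 * (n : ℝ) ^ 2 := by positivity
    rw [ENNReal.ofReal_div_of_pos hpos, ENNReal.ofReal_coe_nnreal,
      ENNReal.le_div_iff_mul_le (Or.inl (ENNReal.ofReal_pos.2 hpos).ne')
        (Or.inl ENNReal.ofReal_ne_top), mul_comm]
    exact h3
  have hsub : {ω : Fin n → Z | ¬ ∀ i, ‖s n (ω i)‖ ≤ κ * Real.sqrt n} ⊆
      ⋃ i : Fin n, (fun ω => ω i) ⁻¹' T := by
    intro ω hω
    simp only [Set.mem_ofPred_eq, not_forall, not_le] at hω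
    obtain ⟨i, hi⟩ := hω
    refine Set.mem_iUnion.2 ⟨i, ?_⟩
    show ENNReal.ofReal (κ ^ 4 * n ^ 2) ≤ ‖s n (ω i)‖ₑ ^ 4
    rw [← ofReal_norm, ← ENNReal.ofReal_pow (norm_nonneg _)]
    apply ENNReal.ofReal_le_ofReal
    have e : κ ^ 4 * (n : ℝ) ^ 2 = (κ * Real.sqrt n) ^ 4 := by
      rw [mul_pow]; congr 1
      rw [show (4 : ℕ) = 2 * 2 from rfl, pow_mul, Real.sq_sqrt hn0.le]
    rw [e]
    exact pow_le_pow_left₀ (by positivity) hi.le 4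
  have hTm : NullMeasurableSet T (μ n) :=
    nullMeasurableSet_le aemeasurable_const ((hs n hn).enorm.pow_const 4)
  calc _ ≤ ∑ i : Fin n, sampleLaw μ n ((fun ω => ω i) ⁻¹' T) :=
        (measure_mono hsub).trans (measure_iUnion_fintype_le _ _)
    _ = ∑ i : Fin n, μ n T := Finset.sum_congr rfl fun i _ =>
        (measurePreserving_eval (fun _ : Fin n => μ n) i).measure_preimage hTm
    _ ≤ ∑ i : Fin n, ENNReal.ofReal ((M : ℝ) / (κ ^ 4 * n ^ 2)) := Finset.sum_le_sum fun i _ => h1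
    _ = ENNReal.ofReal ((M : ℝ) / κ ^ 4 / n) := by
        rw [Finset.sum_const, Finset.card_univ, Fintype.card_fin, nsmul_eq_mul,
          ← ENNReal.ofReal_natCast, ← ENNReal.ofReal_mul hn0.le]
        congr 1
        field_simp
    _ ≤ _ := ENNReal.ofReal_le_ofReal hn'

end Laws

section Truncation

variable {Z : Type*} [MeasurableSpace Z] {ν : Measure Z} [IsProbabilityMeasure ν] {X : Z → ℝ}
  {n : ℕ} {K τ : ℝ}

/-- If the mean of the squares is rarely larger than `K`, then a single square rarely exceeds
`n K`. -/
lemma mul_measureReal_sq_gt_le (hX : Measurable X) (hn : 1 ≤ n) (hτ : τ ≤ 1 / 2) (hτ0 : 0 ≤ τ)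
    (h : (Measure.pi fun _ : Fin n => ν) {ω | K < (n : ℝ)⁻¹ * ∑ i, X (ω i) ^ 2} ≤
      ENNReal.ofReal τ) :
    n * ν.real {z | n * K < X z ^ 2} ≤ 2 * τ := by
  have hn0 : (0 : ℝ) < n := by exact_mod_cast hn
  set T : Set Z := {z | n * K < X z ^ 2} with hT
  have hTm : MeasurableSet T := measurableSet_lt measurable_const (hX.pow_const 2)
  set p := ν.real T with hp
  have hp1 : p ≤ 1 := measureReal_le_one
  have hbox : 1 - τ ≤ (1 - p) ^ n := by
    have h1 : (Measure.pi fun _ : Fin n => ν) (Set.univ.pi fun _ => Tᶜ) =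
        ENNReal.ofReal ((1 - p) ^ n) := by
      rw [Measure.pi_pi, Finset.prod_const, Finset.card_univ, Fintype.card_fin,
        ENNReal.ofReal_pow (by linarith)]
      congr 1
      rw [← probReal_compl_eq_one_sub hTm, ofReal_measureReal]
    have h2 : (1 : ℝ≥0∞) ≤ ENNReal.ofReal ((1 - p) ^ n) + ENNReal.ofReal τ := by
      rw [← measure_univ (μ := Measure.pi fun _ : Fin n => ν), ← h1]
      refine le_trans (measure_mono fun ω _ => ?_) ((measure_union_le _ _).trans
        (add_le_add le_rfl h))
      by_cases hω : ∀ i, ω i ∉ T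
      · exact Or.inl fun i _ => hω i
      · push Not at hω
        obtain ⟨i, hi⟩ := hω
        refine Or.inr ?_
        have h3 : n * K < ∑ i, X (ω i) ^ 2 := lt_of_lt_of_le hi
          (Finset.single_le_sum (f := fun i => X (ω i) ^ 2) (fun _ _ => sq_nonneg _)
            (Finset.mem_univ i))
        show K < (n : ℝ)⁻¹ * ∑ i, X (ω i) ^ 2
        rwa [lt_inv_mul_iff₀ hn0]
    rw [← ENNReal.ofReal_add (pow_nonneg (by linarith) _) hτ0, ← ENNReal.ofReal_one,
      ENNReal.ofReal_le_ofReal_iff (add_nonneg (pow_nonneg (by linarith) _) hτ0)] at h2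
    linarith
  have h1 : (1 - p) ^ n ≤ Real.exp (-(n * p)) := by
    have := pow_le_pow_left₀ (by linarith) (Real.one_sub_le_exp_neg p) n
    rwa [← Real.exp_nat_mul, mul_neg] at this
  have h2 := Real.add_one_le_exp (n * p)
  have h3 : Real.exp (-(n * p)) * Real.exp (n * p) = 1 := by rw [← Real.exp_add]; simp
  have h4 : 0 ≤ n * p := mul_nonneg hn0.le measureReal_nonneg
  have h5 : (1 - τ) * (n * p + 1) ≤ 1 := by
    exact (mul_le_mul (hbox.trans h1) h2 (by linarith) (Real.exp_pos _).le).trans h3.le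
  nlinarith

/-- Truncation at the level `b`: the function `x` where `x ^ 2 ≤ b`, and `0` elsewhere. -/
noncomputable def trunc (b x : ℝ) : ℝ := if x ^ 2 ≤ b then x else 0

lemma measurable_trunc (b : ℝ) : Measurable (trunc b) :=
  Measurable.ite (measurableSet_le (measurable_id.pow_const 2) measurable_const) measurable_id
    measurable_const

lemma trunc_sq_le {b : ℝ} (hb : 0 ≤ b) (x : ℝ) : trunc b x ^ 2 ≤ b := by
  unfold trunc; split_ifs with h
  · exact h
  · simpa using hb

lemma trunc_sq_le_sq (b x : ℝ) : trunc b x ^ 2 ≤ x ^ 2 := by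
  unfold trunc; split_ifs with h
  · exact le_rfl
  · simpa using sq_nonneg x

lemma memLp_trunc (hX : Measurable X) {b : ℝ} (hb : 0 ≤ b) (p : ℝ≥0∞) :
    MemLp (fun z => trunc b (X z)) p ν := by
  refine MemLp.of_bound ((measurable_trunc b).comp hX).aestronglyMeasurable (Real.sqrt b)
    (Eventually.of_forall fun z => ?_)
  rw [Real.norm_eq_abs]
  exact Real.abs_le_sqrt (trunc_sq_le hb _)

/-- If the mean of the squares is rarely larger than `K`, then the truncated second moment is at
most of order `K`: otherwise Chebyshev's inequality would push the truncated mean of squares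
above `K`. -/
lemma integral_trunc_sq_le (hX : Measurable X) (hn : 1 ≤ n) (hτ : τ ≤ 1 / 2) (hK : 0 < K)
    (h : (Measure.pi fun _ : Fin n => ν) {ω | K < (n : ℝ)⁻¹ * ∑ i, X (ω i) ^ 2} ≤
      ENNReal.ofReal τ) :
    ∫ z, trunc (n * K) (X z) ^ 2 ∂ν ≤ 16 * K := by
  have hn0 : (0 : ℝ) < n := by exact_mod_cast hn
  have hb : 0 ≤ n * K := by positivity
  set Y : Z → ℝ := fun z => trunc (n * K) (X z) ^ 2 with hY
  have hYm : Measurable Y := ((measurable_trunc _).comp hX).pow_const 2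
  have hY0 : ∀ z, 0 ≤ Y z := fun z => sq_nonneg _
  have hYb : ∀ z, Y z ≤ n * K := fun z => trunc_sq_le hb _
  have hYL : ∀ p, MemLp Y p ν := fun p => MemLp.of_bound hYm.aestronglyMeasurable (n * K)
    (Eventually.of_forall fun z => by rw [Real.norm_eq_abs, abs_of_nonneg (hY0 z)]; exact hYb z)
  set m := ∫ z, Y z ∂ν with hm
  by_contra hcon
  push Not at hcon
  have hm0 : 0 < m := by linarith
  have h1 := measure_avg_sub_ge_le (hYL 2) hn (half_pos hm0)
  have h2 : ∫ z, Y z ^ 2 ∂ν ≤ n * K * m := by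
    rw [hm, ← integral_const_mul]
    refine integral_mono ((hYL 2).integrable_sq)
      (((hYL 1).integrable le_rfl).const_mul _) fun z => ?_
    show Y z ^ 2 ≤ n * K * Y z
    rw [sq]
    exact mul_le_mul_of_nonneg_right (hYb z) (hY0 z)
  have h3 : (∫ z, Y z ^ 2 ∂ν) / (n * (m / 2) ^ 2) ≤ 1 / 4 := by
    rw [div_le_iff₀ (by positivity)]
    refine h2.trans ?_
    have := mul_le_mul_of_nonneg_left hcon.le (mul_nonneg hn0.le hm0.le)
    nlinarith
  have h4 : (1 : ℝ≥0∞) ≤ ENNReal.ofReal (1 / 4) + ENNReal.ofReal (1 / 2) := by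
    rw [← measure_univ (μ := Measure.pi fun _ : Fin n => ν)]
    refine le_trans (measure_mono fun ω _ => ?_) ((measure_union_le _ _).trans
      (add_le_add (h1.trans (ENNReal.ofReal_le_ofReal h3))
        (h.trans (ENNReal.ofReal_le_ofReal hτ))))
    by_cases hω : m / 2 ≤ |(n : ℝ)⁻¹ * ∑ i, Y (ω i) - ∫ z, Y z ∂ν|
    · exact Or.inl hω
    · right
      push Not at hω
      have h5 := (abs_lt.1 hω).1
      have h6 : (n : ℝ)⁻¹ * ∑ i, Y (ω i) ≤ (n : ℝ)⁻¹ * ∑ i, X (ω i) ^ 2 :=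
        mul_le_mul_of_nonneg_left (Finset.sum_le_sum fun i _ => trunc_sq_le_sq _ _)
          (inv_nonneg.2 hn0.le)
      show K < (n : ℝ)⁻¹ * ∑ i, X (ω i) ^ 2
      linarith
  rw [← ENNReal.ofReal_add (by norm_num) (by norm_num), ← ENNReal.ofReal_one,
    ENNReal.ofReal_le_ofReal_iff (by norm_num)] at h4
  norm_num at h4

lemma measure_avg_sub_gt_le_of_trunc {B : Z → ℝ} {M ε α : ℝ} (hX : Measurable X) (hn : 1 ≤ n)
    (hτ0 : 0 ≤ τ) (hτ : τ ≤ 1 / 2) (hK : 0 < K) (hε : 0 < ε) (hα : 0 < α)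
    (hB : ∀ᵐ z ∂ν, |X z| ≤ Real.sqrt n * B z) (hBL : MemLp B 2 ν) (hBM : ∫ z, B z ^ 2 ∂ν ≤ M)
    (hαM : α * M ≤ ε / 4) (hτα : 2 * τ ≤ α * (ε / 4))
    (h : (Measure.pi fun _ : Fin n => ν) {ω | K < (n : ℝ)⁻¹ * ∑ i, X (ω i) ^ 2} ≤
      ENNReal.ofReal τ) :
    (Measure.pi fun _ : Fin n => ν) {ω | ε < |(n : ℝ)⁻¹ * ∑ i, X (ω i) - ∫ z, X z ∂ν|} ≤
      ENNReal.ofReal τ + ENNReal.ofReal (64 * K / ε ^ 2 / n) := by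
  have hn0 : (0 : ℝ) < n := by exact_mod_cast hn
  have hb : 0 ≤ n * K := by positivity
  set Y : Z → ℝ := fun z => trunc (n * K) (X z) with hY
  set T : Set Z := {z | n * K < X z ^ 2} with hT
  have hTm : MeasurableSet T := measurableSet_lt measurable_const (hX.pow_const 2)
  have hXint : Integrable X ν := ((hBL.integrable one_le_two).const_mul (Real.sqrt n)).mono'
    hX.aestronglyMeasurable hB
  have hYint : Integrable Y ν := (memLp_trunc hX hb 1).integrable le_rfl
  have hdiff : |∫ z, X z ∂ν - ∫ z, Y z ∂ν| ≤ ε / 4 := by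
    rw [← integral_sub hXint hYint]
    refine (norm_integral_le_integral_norm (fun z => X z - Y z)).trans ?_
    -- the arithmetic-geometric mean inequality replaces the Cauchy-Schwarz inequality here
    have hpt : ∀ᵐ z ∂ν, ‖X z - Y z‖ ≤
        α / 2 * B z ^ 2 + T.indicator (fun _ => (n : ℝ) / (2 * α)) z := by
      filter_upwards [hB] with z hz
      by_cases hzT : z ∈ T
      · have hYz : Y z = 0 := by
          simp only [hY, trunc]
          rw [if_neg (not_le.2 hzT)]
        rw [Set.indicator_of_mem hzT, hYz, sub_zero, Real.norm_eq_abs]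
        refine hz.trans ?_
        have h1 : 0 ≤ (α * B z - Real.sqrt n) ^ 2 / (2 * α) := by positivity
        have h2 : (α * B z - Real.sqrt n) ^ 2 / (2 * α) =
            α / 2 * B z ^ 2 + n / (2 * α) - Real.sqrt n * B z := by
          have := Real.sq_sqrt hn0.le
          field_simp
          nlinarith
        linarith
      · have hYz : Y z = X z := by
          simp only [hY, trunc]
          rw [if_pos (not_lt.1 hzT)]
        rw [Set.indicator_of_notMem hzT, hYz, sub_self, norm_zero]
        positivity
    have hint1 : Integrable (fun z => α / 2 * B z ^ 2) ν := hBL.integrable_sq.const_mul _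
    have hint2 : Integrable (T.indicator fun _ => (n : ℝ) / (2 * α)) ν :=
      (integrable_const _).indicator hTm
    refine (integral_mono_ae (hXint.sub hYint).norm (hint1.add hint2) hpt).trans ?_
    have h1 := mul_measureReal_sq_gt_le hX hn hτ hτ0 h
    have e : ∫ z, (fun z => α / 2 * B z ^ 2) z + (T.indicator fun _ => (n : ℝ) / (2 * α)) z ∂ν =
        α / 2 * ∫ z, B z ^ 2 ∂ν + n * ν.real T / (2 * α) := by
      rw [integral_add hint1 hint2, integral_const_mul, integral_indicator_const _ hTm, smul_eq_mul]
      ring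
    refine (le_of_eq e).trans ?_
    have h2 : n * ν.real T / (2 * α) ≤ ε / 8 := by
      rw [div_le_iff₀ (by positivity)]
      linarith
    have h3 : α / 2 * ∫ z, B z ^ 2 ∂ν ≤ α / 2 * M :=
      mul_le_mul_of_nonneg_left hBM (by positivity)
    linarith
  have h1 := measure_avg_sub_ge_le (memLp_trunc hX hb 2 (ν := ν)) hn (half_pos hε)
  have h2 := integral_trunc_sq_le hX hn hτ hK h
  have h3 : (∫ z, trunc (n * K) (X z) ^ 2 ∂ν) / (n * (ε / 2) ^ 2) ≤ 64 * K / ε ^ 2 / n := by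
    rw [div_div, div_le_div_iff₀ (by positivity) (by positivity)]
    have := mul_le_mul_of_nonneg_right h2 (by positivity : 0 ≤ ε ^ 2 * (n : ℝ))
    nlinarith
  refine le_trans (measure_mono fun ω hω => ?_) ((measure_union_le _ _).trans
    (add_le_add h (h1.trans (ENNReal.ofReal_le_ofReal h3))))
  by_cases hω1 : ∀ i, ω i ∉ T
  · right
    have hYX : ∀ i, trunc (n * K) (X (ω i)) = X (ω i) := fun i => if_pos (not_lt.1 (hω1 i))
    show ε / 2 ≤ |(n : ℝ)⁻¹ * ∑ i, trunc (n * K) (X (ω i)) - ∫ z, Y z ∂ν|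
    simp only [hYX]
    have h4 : ε < |(n : ℝ)⁻¹ * ∑ i, X (ω i) - ∫ z, X z ∂ν| := hω
    have h5 := abs_sub_abs_le_abs_sub ((n : ℝ)⁻¹ * ∑ i, X (ω i) - ∫ z, X z ∂ν)
      ((n : ℝ)⁻¹ * ∑ i, X (ω i) - ∫ z, Y z ∂ν)
    rw [sub_sub_sub_cancel_left, abs_sub_comm (∫ z, Y z ∂ν)] at h5
    linarith
  · left
    push Not at hω1
    obtain ⟨i, hi⟩ := hω1
    have h3 : n * K < ∑ i, X (ω i) ^ 2 := lt_of_lt_of_le hi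
      (Finset.single_le_sum (f := fun i => X (ω i) ^ 2) (fun _ _ => sq_nonneg _)
        (Finset.mem_univ i))
    show K < (n : ℝ)⁻¹ * ∑ i, X (ω i) ^ 2
    rwa [lt_inv_mul_iff₀ hn0]

/-- A weak law of large numbers for rows whose entries are dominated by `√n B_n` only, with `B_n`
bounded in `L²`: it holds if the means of the squares are bounded in probability. -/
lemma highProb_avg_of_bddInProb {μ : ℕ → Measure Z} [∀ n, IsProbabilityMeasure (μ n)]
    {X B : ℕ → Z → ℝ} {M : ℝ} (hX : ∀ n, 1 ≤ n → AEStronglyMeasurable (X n) (μ n))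
    (hB : ∀ n, 1 ≤ n → ∀ᵐ z ∂(μ n), |X n z| ≤ Real.sqrt n * B n z)
    (hBL : ∀ n, 1 ≤ n → MemLp (B n) 2 (μ n)) (hBM : ∀ n, 1 ≤ n → ∫ z, B n z ^ 2 ∂(μ n) ≤ M)
    (hbdd : ∀ τ : ℝ, 0 < τ → ∃ K : ℝ, EvProb μ τ fun n ω => (n : ℝ)⁻¹ * ∑ i, X n (ω i) ^ 2 ≤ K)
    {ε : ℝ} (hε : 0 < ε) :
    HighProb μ fun n ω => |(n : ℝ)⁻¹ * ∑ i, X n (ω i) - ∫ z, X n z ∂(μ n)| ≤ ε := by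
  intro τ' hτ'
  set α := ε / (4 * (|M| + 1)) with hα
  have hα0 : 0 < α := by positivity
  have hαM : α * M ≤ ε / 4 := by
    have : α * (|M| + 1) = ε / 4 := by rw [hα]; field_simp
    nlinarith [le_abs_self M]
  set τ := min (1 / 2) (min (α * (ε / 4) / 2) (τ' / 2)) with hτ
  have hτ0 : 0 < τ := by positivity
  have hτ1 : τ ≤ 1 / 2 := min_le_left _ _
  have hτ2 : τ ≤ α * (ε / 4) / 2 := (min_le_right _ _).trans (min_le_left _ _)
  have hτ3 : τ ≤ τ' / 2 := (min_le_right _ _).trans (min_le_right _ _)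
  obtain ⟨K₀, hK₀⟩ := hbdd τ hτ0
  set K := max K₀ 1 with hK
  have hKpos : 0 < K := lt_of_lt_of_le one_pos (le_max_right _ _)
  filter_upwards [hK₀, eventually_ge_atTop 1,
    eventually_div_le (64 * K / ε ^ 2) (half_pos hτ')] with n hn hn1 hn2
  have hmk := (hX n hn1).aemeasurable.ae_eq_mk
  set X' := (hX n hn1).aemeasurable.mk (X n) with hX'
  have hae := ae_sample hmk n
  have e1 : ∫ z, X n z ∂(μ n) = ∫ z, X' z ∂(μ n) := integral_congr_ae hmk
  have h1 : (Measure.pi fun _ : Fin n => μ n) {ω | K < (n : ℝ)⁻¹ * ∑ i, X' (ω i) ^ 2} ≤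
      ENNReal.ofReal τ := by
    refine le_trans (measure_mono_ae ?_) hn
    filter_upwards [hae] with ω hω hω'
    have h2 : K < (n : ℝ)⁻¹ * ∑ i, X' (ω i) ^ 2 := hω'
    show ¬ (n : ℝ)⁻¹ * ∑ i, X n (ω i) ^ 2 ≤ K₀
    simp only [hω]
    exact not_le.2 ((le_max_left _ _).trans_lt h2)
  have h2 := measure_avg_sub_gt_le_of_trunc (hX n hn1).aemeasurable.measurable_mk hn1 hτ0.le hτ1
    hKpos hε hα0 (by filter_upwards [hB n hn1, hmk] with z hz hz'; exact (congrArg abs hz').symm.le.trans hz)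
    (hBL n hn1) (hBM n hn1) hαM (by linarith) h1
  refine le_trans (measure_mono_ae ?_) (h2.trans ?_)
  · filter_upwards [hae] with ω hω hω'
    have h3 : ¬ |(n : ℝ)⁻¹ * ∑ i, X n (ω i) - ∫ z, X n z ∂(μ n)| ≤ ε := hω'
    show ε < |(n : ℝ)⁻¹ * ∑ i, X' (ω i) - ∫ z, X' z ∂(μ n)|
    rw [← e1]
    simp only [hω] at h3
    exact not_le.1 h3
  · rw [← ENNReal.ofReal_add hτ0.le (by positivity)]
    exact ENNReal.ofReal_le_ofReal (by linarith)

end Truncation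

end CVSure

namespace CVSure

/-! ### A central limit theorem for triangular arrays -/

section CLT

variable {Z : Type*} [MeasurableSpace Z]

lemma norm_cexp_sub_taylor_two_le (x : ℝ) :
    ‖Complex.exp (x * Complex.I) - (1 + x * Complex.I - (x : ℂ) ^ 2 / 2)‖ ≤ 4 * |x| ^ 3 := by
  rcases le_or_gt |x| 1 with h | h
  · have h1 := Complex.norm_exp_sub_sum_le_norm_mul_exp (x * Complex.I) 3
    have e : ∑ m ∈ Finset.range 3, ((x : ℂ) * Complex.I) ^ m / (m.factorial : ℂ) =
        1 + x * Complex.I - (x : ℂ) ^ 2 / 2 := by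
      simp [Finset.sum_range_succ, mul_pow, Nat.factorial]
      ring
    rw [e] at h1
    have h2 : ‖(x : ℂ) * Complex.I‖ = |x| := by simp
    rw [h2] at h1
    refine h1.trans ?_
    have h3 : Real.exp |x| ≤ 4 := by
      have := Real.exp_one_lt_d9
      have := Real.exp_le_exp.2 h
      linarith
    have := mul_le_mul_of_nonneg_left h3 (pow_nonneg (abs_nonneg x) 3)
    linarith
  · have h1 : ‖Complex.exp (x * Complex.I)‖ = 1 := Complex.norm_exp_ofReal_mul_I x
    have h2 : ‖(1 : ℂ) + x * Complex.I - (x : ℂ) ^ 2 / 2‖ ≤ 1 + |x| + |x| ^ 2 / 2 := by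
      refine (norm_sub_le _ _).trans (add_le_add ((norm_add_le _ _).trans (le_of_eq ?_))
        (le_of_eq ?_)) <;> simp
    refine (norm_sub_le _ _).trans ?_
    rw [h1]
    nlinarith [mul_pos (sub_pos.2 h) (sub_pos.2 h), mul_pos (sub_pos.2 h) (by positivity : 0 < |x|),
      mul_pos (mul_pos (sub_pos.2 h) (by positivity : 0 < |x|)) (by positivity : 0 < |x|)]

lemma abs_pow_three_le (x : ℝ) : |x| ^ 3 ≤ 1 + |x| ^ 4 := by
  have h := abs_nonneg x
  rcases le_or_gt |x| 1 with h1 | h1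
  · have := pow_le_one₀ h h1 (n := 3)
    linarith [pow_nonneg h 4]
  · nlinarith [pow_pos (lt_trans one_pos h1) 3]

/-- The second-order expansion of the characteristic function of a centered variable. -/
lemma norm_charFun_sub_le {ν : Measure Z} [IsProbabilityMeasure ν] {Y : Z → ℝ} {M σ2 : ℝ}
    (hY : MemLp Y 4 ν) (h0 : ∫ z, Y z ∂ν = 0) (h2 : ∫ z, Y z ^ 2 ∂ν = σ2)
    (h4 : ∫ z, |Y z| ^ 4 ∂ν ≤ M) (t : ℝ) :
    ‖charFun (ν.map Y) t - (1 - ((t ^ 2 * σ2 / 2 : ℝ) : ℂ))‖ ≤ 4 * |t| ^ 3 * (1 + M) := by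
  have hY4 : Integrable (fun z => |Y z| ^ 4) ν := by
    have := hY.integrable_norm_pow (by norm_num)
    simpa using this
  have hY2 : Integrable (fun z => Y z ^ 2) ν :=
    (hY.mono_exponent (by norm_num : (2 : ℝ≥0∞) ≤ 4)).integrable_sq
  have hY1 : Integrable Y ν := hY.integrable (by norm_num)
  have hexp : Integrable (fun z => Complex.exp (t * Y z * Complex.I)) ν := by
    refine Integrable.of_bound (C := 1) ?_ (Eventually.of_forall fun z => ?_)
    · have : Continuous fun y : ℝ => Complex.exp (t * y * Complex.I) := by fun_prop
      exact this.comp_aestronglyMeasurable hY.1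
    · rw [← Complex.ofReal_mul, Complex.norm_exp_ofReal_mul_I]
  have e1 : charFun (ν.map Y) t = ∫ z, Complex.exp (t * Y z * Complex.I) ∂ν := by
    rw [charFun_apply_real, integral_map hY.1.aemeasurable]
    exact (by fun_prop : Continuous fun y : ℝ =>
      Complex.exp (t * y * Complex.I)).aestronglyMeasurable
  have hq : Integrable (fun z => (1 : ℂ) + (t * Y z : ℝ) * Complex.I - ((t * Y z : ℝ) : ℂ) ^ 2 / 2)
      ν := by
    refine ((integrable_const _).add ?_).sub ?_
    · exact ((hY1.const_mul t).ofReal).mul_const _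
    · have := ((hY2.const_mul (t ^ 2)).ofReal (𝕜 := ℂ)).div_const 2
      refine this.congr (Eventually.of_forall fun z => ?_)
      simp [mul_pow]
  have e2 : ∫ z, ((1 : ℂ) + (t * Y z : ℝ) * Complex.I - ((t * Y z : ℝ) : ℂ) ^ 2 / 2) ∂ν =
      1 - ((t ^ 2 * σ2 / 2 : ℝ) : ℂ) := by
    have e3 : ∀ z, (1 : ℂ) + (t * Y z : ℝ) * Complex.I - ((t * Y z : ℝ) : ℂ) ^ 2 / 2 =
        ((1 - t ^ 2 / 2 * Y z ^ 2 : ℝ) : ℂ) + ((t * Y z : ℝ) : ℂ) * Complex.I := by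
      intro z; push_cast; ring
    simp only [e3]
    rw [integral_add, integral_mul_const, integral_complex_ofReal, integral_complex_ofReal,
      integral_const_mul, h0, integral_sub (integrable_const _) (hY2.const_mul _),
      integral_const_mul, h2]
    · simp; ring
    · exact (((integrable_const _).sub (hY2.const_mul _))).ofReal
    · exact ((hY1.const_mul t).ofReal).mul_const _
  rw [e1, ← e2, ← integral_sub hexp hq]
  refine (norm_integral_le_integral_norm _).trans ?_
  have h5 : ∫ z, 4 * |t| ^ 3 * (1 + |Y z| ^ 4) ∂ν ≤ 4 * |t| ^ 3 * (1 + M) := by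
    rw [integral_const_mul, integral_add (integrable_const _) hY4]
    simp only [integral_const, probReal_univ, one_smul]
    gcongr
  refine le_trans (integral_mono (hexp.sub hq).norm
    (((integrable_const _).add hY4).const_mul _) fun z => ?_) h5
  have h6 := norm_cexp_sub_taylor_two_le (t * Y z)
  rw [abs_mul, mul_pow] at h6
  have h7 := mul_le_mul_of_nonneg_left (abs_pow_three_le (Y z)) (by positivity : 0 ≤ 4 * |t| ^ 3)
  simp only [Complex.ofReal_mul, Pi.add_apply] at h6 ⊢
  linarith

variable {μ : ℕ → Measure Z} [∀ n, IsProbabilityMeasure (μ n)]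

/-- Rows with mean zero, a common variance and bounded fourth moments satisfy the central limit
theorem. -/
theorem tendsto_map_sum_gaussian {Y : ℕ → Z → ℝ} {M : ℝ} {σ2 : ℝ≥0}
    (hY : ∀ n, MemLp (Y n) 4 (μ n)) (h0 : ∀ n, 1 ≤ n → ∫ z, Y n z ∂(μ n) = 0)
    (h2 : ∀ n, 1 ≤ n → ∫ z, Y n z ^ 2 ∂(μ n) = σ2)
    (h4 : ∀ n, 1 ≤ n → ∫ z, |Y n z| ^ 4 ∂(μ n) ≤ M)
    {ρ : ℕ → ProbabilityMeasure ℝ}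
    (hρ : ∀ n, (ρ n : Measure ℝ) =
      (sampleLaw μ n).map fun ω => (Real.sqrt n)⁻¹ * ∑ i, Y n (ω i)) :
    Tendsto ρ atTop (𝓝 ⟨ProbabilityTheory.gaussianReal 0 σ2, inferInstance⟩) := by
  refine ProbabilityMeasure.tendsto_iff_tendsto_charFun.2 fun t => ?_
  have hchar : ∀ n, charFun (ρ n : Measure ℝ) t =
      (charFun ((μ n).map (Y n)) ((Real.sqrt n)⁻¹ * t)) ^ n := by
    intro n
    have hYi : ∀ i : Fin n, AEMeasurable (fun ω : Fin n → Z => Y n (ω i)) (sampleLaw μ n) :=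
      fun i => (hY n).1.aemeasurable.comp_quasiMeasurePreserving
        (measurePreserving_eval (fun _ : Fin n => μ n) i).quasiMeasurePreserving
    rw [hρ, charFun_map_mul_comp (Finset.aemeasurable_fun_sum _ fun i _ => hYi i),
      (ProbabilityTheory.iIndepFun_pi (μ := fun _ : Fin n => μ n) (X := fun _ => Y n)
        fun _ => (hY n).1.aemeasurable).charFun_map_fun_sum_eq_prod hYi, Finset.prod_apply]
    have : ∀ i : Fin n, (sampleLaw μ n).map (fun ω => Y n (ω i)) = (μ n).map (Y n) := by
      intro i
      have h1 := (measurePreserving_eval (fun _ : Fin n => μ n) i)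
      have h3 : AEMeasurable (Y n) ((sampleLaw μ n).map (Function.eval i)) := by
        unfold sampleLaw; rw [h1.map_eq]; exact (hY n).1.aemeasurable
      have h2 := AEMeasurable.map_map_of_aemeasurable h3 (measurable_pi_apply i).aemeasurable
      unfold sampleLaw at h2 ⊢
      rw [h1.map_eq] at h2
      exact h2.symm
    simp [this]
  simp only [hchar]
  have hlim : charFun (ProbabilityTheory.gaussianReal 0 σ2) t =
      Complex.exp (-((t ^ 2 * σ2 / 2 : ℝ) : ℂ)) := by
    rw [ProbabilityTheory.charFun_gaussianReal]
    congr 1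
    push_cast; ring
  show Tendsto _ atTop (𝓝 (charFun (ProbabilityTheory.gaussianReal 0 σ2) t))
  rw [hlim]
  apply Complex.tendsto_pow_exp_of_isLittleO_sub_add_div
  -- the error is of order `n ^ (-3/2)`
  rw [Asymptotics.isLittleO_iff]
  intro c hc
  have hsq : Tendsto (fun n : ℕ => (4 * |t| ^ 3 * (1 + M)) * (Real.sqrt n)⁻¹) atTop (𝓝 0) := by
    have := (tendsto_inv_atTop_zero.comp (Real.tendsto_sqrt_atTop.comp
      tendsto_natCast_atTop_atTop)).const_mul (4 * |t| ^ 3 * (1 + M))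
    simpa using this
  filter_upwards [eventually_ge_atTop 1, hsq.eventually (eventually_lt_nhds hc)] with n hn hn2
  have hn0 : (0 : ℝ) < n := by exact_mod_cast hn
  have hs : 0 < Real.sqrt n := Real.sqrt_pos.2 hn0
  have hss : Real.sqrt n ^ 2 = n := Real.sq_sqrt hn0.le
  have h := norm_charFun_sub_le (hY n) (h0 n hn) (h2 n hn) (h4 n hn) ((Real.sqrt n)⁻¹ * t)
  have e : (1 : ℂ) - (((((Real.sqrt n)⁻¹ * t) ^ 2 * σ2 / 2 : ℝ)) : ℂ) =
      1 + -((t ^ 2 * σ2 / 2 : ℝ) : ℂ) / n := by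
    rw [mul_pow, inv_pow, hss]
    push_cast
    field_simp
    ring
  rw [e] at h
  refine h.trans ?_
  have e2 : 4 * |(Real.sqrt n)⁻¹ * t| ^ 3 * (1 + M) =
      (4 * |t| ^ 3 * (1 + M)) * (Real.sqrt n)⁻¹ * (n : ℝ)⁻¹ := by
    have hinv : (n : ℝ)⁻¹ = (Real.sqrt n)⁻¹ ^ 2 := by rw [inv_pow, hss]
    rw [abs_mul, abs_of_pos (inv_pos.2 hs), mul_pow, hinv]
    ring
  rw [e2]
  have e3 : ‖(1 : ℂ) / n‖ = (n : ℝ)⁻¹ := by simp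
  rw [e3]
  exact mul_le_mul_of_nonneg_right hn2.le (inv_nonneg.2 hn0.le)

/-- Anti-concentration: normalized sums with positive limiting variance rarely fall into a narrow
interval around a fixed point. -/
theorem exists_evProb_sum_far {Y : ℕ → Z → ℝ} {M : ℝ} {σ2 : ℝ} (hσ : 0 < σ2)
    (hY : ∀ n, 1 ≤ n → MemLp (Y n) 4 (μ n)) (h0 : ∀ n, 1 ≤ n → ∫ z, Y n z ∂(μ n) = 0)
    (h2 : ∀ n, 1 ≤ n → ∫ z, Y n z ^ 2 ∂(μ n) = σ2)
    (h4 : ∀ n, 1 ≤ n → ∫ z, |Y n z| ^ 4 ∂(μ n) ≤ M) (b : ℝ) {τ : ℝ} (hτ : 0 < τ) :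
    ∃ ρ : ℝ, 0 < ρ ∧ EvProb μ τ fun n ω => ρ < |(Real.sqrt n)⁻¹ * ∑ i, Y n (ω i) - b| := by
  -- the row with index zero is irrelevant
  set Y' : ℕ → Z → ℝ := fun n => if n = 0 then 0 else Y n with hY'
  have hY'eq : ∀ n, 1 ≤ n → Y' n = Y n := fun n hn => if_neg (by omega)
  have hY'm : ∀ n, MemLp (Y' n) 4 (μ n) := by
    intro n
    rcases Nat.eq_zero_or_pos n with rfl | hn
    · simp only [hY', if_pos]; exact MemLp.zero
    · rw [hY'eq n hn]; exact hY n hn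
  lift σ2 to ℝ≥0 using hσ.le
  have hσ' : σ2 ≠ 0 := by exact_mod_cast hσ.ne'
  set S : (n : ℕ) → (Fin n → Z) → ℝ := fun n ω => (Real.sqrt n)⁻¹ * ∑ i, Y' n (ω i) with hS
  have hSm : ∀ n, AEMeasurable (S n) (sampleLaw μ n) := fun n =>
    (Finset.aemeasurable_fun_sum _ fun i _ => (hY'm n).1.aemeasurable.comp_quasiMeasurePreserving
        (measurePreserving_eval (fun _ : Fin n => μ n) i).quasiMeasurePreserving).const_mul _
  set law : ℕ → ProbabilityMeasure ℝ := fun n =>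
    ⟨(sampleLaw μ n).map (S n), Measure.isProbabilityMeasure_map (hSm n)⟩ with hlaw
  have hlim := tendsto_map_sum_gaussian hY'm
    (fun n hn => by rw [hY'eq n hn]; exact h0 n hn)
    (fun n hn => by rw [hY'eq n hn]; exact h2 n hn)
    (fun n hn => by rw [hY'eq n hn]; exact h4 n hn) (ρ := law) (fun n => rfl)
  set G := ProbabilityTheory.gaussianReal 0 σ2 with hG
  have hatom : G {b} = 0 := by
    have := ProbabilityTheory.nullSingletonClass_gaussianReal (μ := 0) hσ'
    exact measure_singleton b
  have hsmall : ∃ ρ : ℝ, 0 < ρ ∧ G (Metric.cthickening ρ {b}) < ENNReal.ofReal τ := by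
    have h1 := tendsto_measure_cthickening (μ := G) (s := {b})
      ⟨1, one_pos, measure_ne_top _ _⟩
    rw [closure_singleton, hatom] at h1
    have h2 := h1.eventually (eventually_lt_nhds (ENNReal.ofReal_pos.2 hτ))
    have h3 : ∀ᶠ r : ℝ in 𝓝[>] 0, G (Metric.cthickening r {b}) < ENNReal.ofReal τ :=
      h2.filter_mono nhdsWithin_le_nhds
    obtain ⟨r, hr, hr0⟩ := (h3.and self_mem_nhdsWithin).exists
    exact ⟨r, hr0, hr⟩
  obtain ⟨ρ, hρ, hρτ⟩ := hsmall
  refine ⟨ρ, hρ, ?_⟩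
  have h5 := ProbabilityMeasure.limsup_measure_closed_le_of_tendsto hlim
    (Metric.isClosed_cthickening (δ := ρ) (E := {b}))
  have h6 := eventually_lt_of_limsup_lt (lt_of_le_of_lt h5 hρτ)
  filter_upwards [h6, eventually_ge_atTop 1] with n hn hn1
  refine le_trans (le_of_eq ?_) hn.le
  show _ = (sampleLaw μ n).map (S n) _
  rw [Measure.map_apply_of_aemeasurable (hSm n) Metric.isClosed_cthickening.measurableSet,
    Metric.cthickening_singleton _ hρ.le]
  congr 1
  ext ω
  simp only [hS, hY'eq n hn1, Set.mem_ofPred_eq, not_lt, Set.mem_preimage, Metric.mem_closedBall,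
    Real.dist_eq]

end CLT

end CVSure

namespace CVSure

variable {k : ℕ}

/-! ### Hessians, second and fourth differences -/

lemma differentiable_gradient {f : Par k → ℝ} (hf : ContDiff ℝ 2 f) :
    Differentiable ℝ (gradient f) := by
  have h1 : Differentiable ℝ (fderiv ℝ f) :=
    (hf.fderiv_right (m := 1) (by norm_num)).differentiable (by norm_num)
  exact ((InnerProductSpace.toDual ℝ (Par k)).symm.toContinuousLinearEquiv.differentiable).comp h1

lemma hessian_apply_inner {f : Par k → ℝ} (hf : ContDiff ℝ 2 f) (θ u v : Par k) :
    inner ℝ (hessian f θ u) v = fderiv ℝ (fderiv ℝ f) θ u v := by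
  have h1 : Differentiable ℝ (fderiv ℝ f) :=
    (hf.fderiv_right (m := 1) (by norm_num)).differentiable (by norm_num)
  have hA : HasFDerivAt (fun x => inner ℝ v (gradient f x))
      ((innerSL ℝ v).comp (hessian f θ)) θ :=
    HasFDerivAt.comp θ (innerSL ℝ v).hasFDerivAt (differentiable_gradient hf θ).hasFDerivAt
  have hB : HasFDerivAt (fun x => fderiv ℝ f x v)
      ((ContinuousLinearMap.apply ℝ ℝ v).comp (fderiv ℝ (fderiv ℝ f) θ)) θ :=
    HasFDerivAt.comp θ (ContinuousLinearMap.apply ℝ ℝ v).hasFDerivAt (h1 θ).hasFDerivAt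
  have e : (fun x => inner ℝ v (gradient f x)) = fun x => fderiv ℝ f x v := by
    funext x; rw [real_inner_comm, inner_gradient_left]
  rw [e] at hA
  have h2 := congrArg (fun T => T u) (hA.unique hB)
  rw [real_inner_comm]
  exact h2

lemma hessian_symm {f : Par k → ℝ} (hf : ContDiff ℝ 2 f) (θ u v : Par k) :
    inner ℝ (hessian f θ u) v = inner ℝ (hessian f θ v) u := by
  rw [hessian_apply_inner hf, hessian_apply_inner hf]
  exact (hf.contDiffAt.isSymmSndFDerivAt (by simp)) u v

lemma hessian_sum {ι : Type*} (s : Finset ι) {f : ι → Par k → ℝ}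
    (hf : ∀ i ∈ s, ContDiff ℝ 2 (f i)) (θ : Par k) :
    hessian (fun x => ∑ i ∈ s, f i x) θ = ∑ i ∈ s, hessian (f i) θ := by
  have h1 : gradient (fun x => ∑ i ∈ s, f i x) = fun x => ∑ i ∈ s, gradient (f i) x :=
    funext fun x => gradient_sum s (fun i hi => (hf i hi).differentiable (by norm_num)) x
  rw [hessian, h1, fderiv_fun_sum fun i hi => differentiable_gradient (hf i hi) θ]
  rfl

lemma norm_gradient_sub_le_of_hessian {f : Par k → ℝ} (hf : ContDiff ℝ 2 f) {s : Set (Par k)}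
    (hs : Convex ℝ s) {H : Par k →L[ℝ] Par k} {K : ℝ} (hK : ∀ x ∈ s, ‖hessian f x - H‖ ≤ K)
    {x y : Par k} (hx : x ∈ s) (hy : y ∈ s) :
    ‖gradient f x - gradient f y - H (x - y)‖ ≤ K * ‖x - y‖ := by
  have h := hs.norm_image_sub_le_of_norm_hasFDerivWithin_le
    (f := fun z => gradient f z - H z) (f' := fun z => hessian f z - H) (C := K)
    (fun z _ => ((differentiable_gradient hf z).hasFDerivAt.sub H.hasFDerivAt).hasFDerivWithinAt)
    hK hy hx
  have e : gradient f x - gradient f y - H (x - y) =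
      gradient f x - H x - (gradient f y - H y) := by rw [map_sub]; abel
  rw [e]
  exact h

lemma strongMono_of_hessian {f : Par k → ℝ} (hf : ContDiff ℝ 2 f) {c : ℝ}
    (h : ∀ θ v : Par k, c * ‖v‖ ^ 2 ≤ inner ℝ (hessian f θ v) v) : StrongMono c f := by
  intro x y
  set v := x - y with hv
  let q : ℝ → ℝ := fun t => inner ℝ (gradient f (y + t • v)) v - c * ‖v‖ ^ 2 * t
  have hd : ∀ t, HasDerivAt q (inner ℝ (hessian f (y + t • v) v) v - c * ‖v‖ ^ 2) t := by
    intro t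
    have h1 : HasDerivAt (fun s : ℝ => y + s • v) v t := by
      simpa using ((hasDerivAt_id t).smul_const v).const_add y
    have h2 := (differentiable_gradient hf (y + t • v)).hasFDerivAt.comp_hasDerivAt t h1
    have h3 := h2.inner ℝ (hasDerivAt_const t v)
    have h4 := h3.sub ((hasDerivAt_id t).const_mul (c * ‖v‖ ^ 2))
    refine h4.congr_deriv ?_
    simp [hessian]
  have hmono : MonotoneOn q (Set.Icc 0 1) := by
    apply monotoneOn_of_deriv_nonneg (convex_Icc 0 1)
    · exact fun t _ => (hd t).continuousAt.continuousWithinAt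
    · exact fun t _ => (hd t).differentiableAt.differentiableWithinAt
    · intro t _
      rw [(hd t).deriv]
      exact sub_nonneg.2 (h _ _)
  have h5 := hmono (Set.left_mem_Icc.2 zero_le_one) (Set.right_mem_Icc.2 zero_le_one) zero_le_one
  have e : y + v = x := by rw [hv]; abel
  simp only [q, zero_smul, add_zero, one_smul, e, mul_zero, sub_zero, mul_one] at h5
  rw [inner_sub_left]
  linarith

/-- The symmetric second difference of `f` at `θ` in the direction `v`. -/
def secondDiff (f : Par k → ℝ) (θ v : Par k) : ℝ := f (θ + v) + f (θ - v) - 2 * f θ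

lemma abs_secondDiff_le_of_gradient {f : Par k → ℝ} (hf : Differentiable ℝ f) {B : ℝ}
    (hB0 : 0 ≤ B) (hB : ∀ x y, ‖gradient f x - gradient f y‖ ≤ B * ‖x - y‖) (θ v : Par k) :
    |secondDiff f θ v| ≤ 2 * B * ‖v‖ ^ 2 := by
  have key : ∀ w : Par k, ‖w‖ = ‖v‖ → |f (θ + w) - f θ - inner ℝ (gradient f θ) w| ≤
      B * ‖v‖ * ‖v‖ := by
    intro w hw
    have h := abs_sub_inner_le_of_gradient (f := f) (g := gradient f θ) (K := B * ‖v‖)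
      (convex_closedBall θ ‖v‖) (fun x _ => hf x)
      (fun x hx => (hB x θ).trans (mul_le_mul_of_nonneg_left (mem_closedBall_iff_norm.1 hx) hB0))
      (x := θ) (y := θ + w) (Metric.mem_closedBall_self (norm_nonneg _))
      (by rw [mem_closedBall_iff_norm, add_sub_cancel_left, hw])
    rwa [add_sub_cancel_left, hw] at h
  have h1 := key v rfl
  have h2 := key (-v) (norm_neg v)
  rw [inner_neg_right, ← sub_eq_add_neg] at h2
  have e : secondDiff f θ v = (f (θ + v) - f θ - inner ℝ (gradient f θ) v) +
      (f (θ - v) - f θ - -inner ℝ (gradient f θ) v) := by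
    rw [secondDiff]; ring
  rw [e]
  refine (abs_add_le _ _).trans ?_
  nlinarith

/-- The second difference is the Hessian form up to a cubic error, for a Lipschitz Hessian. -/
lemma abs_secondDiff_sub_hessian_le {f : Par k → ℝ} (hf : ContDiff ℝ 2 f) {C : ℝ} (hC0 : 0 ≤ C)
    (hC : ∀ x y, ‖hessian f x - hessian f y‖ ≤ C * ‖x - y‖) (θ v : Par k) :
    |secondDiff f θ v - inner ℝ (hessian f θ v) v| ≤ 2 * C * ‖v‖ ^ 3 := by
  have hfd : Differentiable ℝ f := hf.differentiable (by norm_num)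
  let q : ℝ → ℝ := fun t => f (θ + t • v) + f (θ + t • (-v)) - t ^ 2 * inner ℝ (hessian f θ v) v
  have hd : ∀ t, HasDerivAt q (inner ℝ (gradient f (θ + t • v)) v +
      inner ℝ (gradient f (θ + t • (-v))) (-v) - 2 * t * inner ℝ (hessian f θ v) v) t := by
    intro t
    have h4 := ((hasDerivAt_along hfd θ v t).add (hasDerivAt_along hfd θ (-v) t)).sub
      ((hasDerivAt_pow 2 t).mul_const (inner ℝ (hessian f θ v) v))
    refine h4.congr_deriv ?_
    push_cast; ring
  have hbound : ∀ t ∈ Set.Icc (0 : ℝ) 1, ‖inner ℝ (gradient f (θ + t • v)) v +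
      inner ℝ (gradient f (θ + t • (-v))) (-v) - 2 * t * inner ℝ (hessian f θ v) v‖ ≤
      2 * C * ‖v‖ ^ 3 := by
    intro t ht
    have hmem : ∀ w : Par k, ‖w‖ = ‖v‖ → θ + t • w ∈ Metric.closedBall θ ‖v‖ := by
      intro w hw
      rw [mem_closedBall_iff_norm, add_sub_cancel_left, norm_smul, hw, Real.norm_eq_abs,
        abs_of_nonneg ht.1]
      exact mul_le_of_le_one_left (norm_nonneg _) ht.2
    have h1 := norm_gradient_sub_le_of_hessian hf (convex_closedBall θ ‖v‖) (H := hessian f θ)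
      (K := C * ‖v‖) (fun x hx => (hC x θ).trans
        (mul_le_mul_of_nonneg_left (mem_closedBall_iff_norm.1 hx) hC0))
      (hmem v rfl) (hmem (-v) (norm_neg v))
    have e1 : θ + t • v - (θ + t • -v) = (2 * t) • v := by
      rw [smul_neg, mul_smul, two_smul]; abel
    rw [e1, map_smul, norm_smul, Real.norm_eq_abs, abs_of_nonneg (by linarith [ht.1])] at h1
    have e2 : inner ℝ (gradient f (θ + t • v)) v + inner ℝ (gradient f (θ + t • (-v))) (-v) -
        2 * t * inner ℝ (hessian f θ v) v =
        inner ℝ (gradient f (θ + t • v) - gradient f (θ + t • -v) - (2 * t) • hessian f θ v) v := by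
      rw [inner_sub_left, inner_sub_left, inner_smul_left, inner_neg_right]
      simp [sub_eq_add_neg]
    rw [e2]
    refine (norm_inner_le_norm _ _).trans ?_
    calc _ ≤ (C * ‖v‖ * (2 * t * ‖v‖)) * ‖v‖ := mul_le_mul_of_nonneg_right h1 (norm_nonneg _)
      _ = (2 * C * ‖v‖ ^ 3) * t := by ring
      _ ≤ (2 * C * ‖v‖ ^ 3) * 1 := mul_le_mul_of_nonneg_left ht.2 (by positivity)
      _ = _ := mul_one _
  have h := (convex_Icc (0 : ℝ) 1).norm_image_sub_le_of_norm_hasDerivWithin_le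
    (fun t _ => (hd t).hasDerivWithinAt) hbound (Set.left_mem_Icc.2 zero_le_one)
    (Set.right_mem_Icc.2 zero_le_one)
  simp only [q, one_smul, zero_smul, add_zero, Real.norm_eq_abs, sub_zero, abs_one, mul_one] at h
  refine le_trans (le_of_eq ?_) h
  congr 1
  rw [secondDiff, ← sub_eq_add_neg]; ring

/-- The operator norm of a symmetric operator is controlled by its quadratic form on sums of basis
vectors. -/
lemma norm_le_of_quadratic_form {M : Par k →L[ℝ] Par k}
    (hM : ∀ u v, inner ℝ (M u) v = inner ℝ (M v) u) {κ : ℝ}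
    (h1 : ∀ a : Fin k, |inner ℝ (M (EuclideanSpace.single a 1)) (EuclideanSpace.single a 1)| ≤ κ)
    (h2 : ∀ a b : Fin k, |inner ℝ (M (EuclideanSpace.single a 1 + EuclideanSpace.single b 1))
      (EuclideanSpace.single a 1 + EuclideanSpace.single b 1)| ≤ κ) :
    ‖M‖ ≤ (k : ℝ) ^ 2 * (2 * κ) := by
  rcases Nat.eq_zero_or_pos k with rfl | hk
  · have : M = 0 := by ext x a; exact a.elim0
    simp [this]
  have hκ : 0 ≤ κ := (abs_nonneg _).trans (h1 ⟨0, hk⟩)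
  set e : Fin k → Par k := fun a => EuclideanSpace.single a 1 with he
  have hentry : ∀ a b, |inner ℝ (M (e a)) (e b)| ≤ 2 * κ := by
    intro a b
    have h3 := abs_le.1 (h2 a b)
    have h4 := abs_le.1 (h1 a)
    have h5 := abs_le.1 (h1 b)
    have h6 := hM (e b) (e a)
    simp only [map_add, inner_add_left, inner_add_right] at h3
    change _ ≤ inner ℝ (M (e a)) (e a) + inner ℝ (M (e b)) (e a) +
      (inner ℝ (M (e a)) (e b) + inner ℝ (M (e b)) (e b)) ∧ inner ℝ (M (e a)) (e a) +
      inner ℝ (M (e b)) (e a) + (inner ℝ (M (e a)) (e b) + inner ℝ (M (e b)) (e b)) ≤ _ at h3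
    change _ ≤ inner ℝ (M (e a)) (e a) ∧ inner ℝ (M (e a)) (e a) ≤ _ at h4
    change _ ≤ inner ℝ (M (e b)) (e b) ∧ inner ℝ (M (e b)) (e b) ≤ _ at h5
    rw [abs_le]
    constructor <;> linarith [h3.1, h3.2, h4.1, h4.2, h5.1, h5.2]
  refine M.opNorm_le_bound (by positivity) fun x => ?_
  have hx : M x = ∑ a, ∑ b, (x a * inner ℝ (M (e a)) (e b)) • e b := by
    have hx1 : x = ∑ a, x a • e a := by
      ext a
      simp [he, Finset.sum_apply, Pi.single_apply]
    conv_lhs => rw [hx1, map_sum]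
    refine Finset.sum_congr rfl fun a _ => ?_
    rw [map_smul]
    ext b
    simp [he, Finset.sum_apply, Pi.single_apply, EuclideanSpace.inner_single_right]
  rw [hx]
  refine (norm_sum_le _ _).trans ?_
  calc _ ≤ ∑ a : Fin k, ∑ b : Fin k, ‖x‖ * (2 * κ) := by
        refine Finset.sum_le_sum fun a _ => (norm_sum_le _ _).trans (Finset.sum_le_sum fun b _ => ?_)
        have h7 : ‖e b‖ = 1 := by simp [he]
        rw [norm_smul, h7, mul_one, norm_mul]
        exact mul_le_mul (PiLp.norm_apply_le x a) (hentry a b) (norm_nonneg _) (norm_nonneg _)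
    _ = _ := by simp; ring

/-- The forward difference of `f` in the direction `v`. -/
def fwdDiffAlong (v : Par k) (f : Par k → ℝ) : Par k → ℝ := fun x => f (x + v) - f x

lemma ContDiff.fwdDiffAlong {m : ℕ} {f : Par k → ℝ} (hf : ContDiff ℝ m f) (v : Par k) :
    ContDiff ℝ m (fwdDiffAlong v f) :=
  (hf.comp (contDiff_id.add contDiff_const)).sub hf

lemma norm_iteratedFDeriv_fwdDiffAlong_le {m : ℕ} {f : Par k → ℝ} (hf : ContDiff ℝ m f)
    (hd : Differentiable ℝ (iteratedFDeriv ℝ m f)) {D : ℝ}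
    (hD : ∀ x, ‖iteratedFDeriv ℝ (m + 1) f x‖ ≤ D) (v x : Par k) :
    ‖iteratedFDeriv ℝ m (fwdDiffAlong v f) x‖ ≤ D * ‖v‖ := by
  have hshift : ContDiff ℝ m fun x => f (x + v) := hf.comp (contDiff_id.add contDiff_const)
  have e : iteratedFDeriv ℝ m (fwdDiffAlong v f) x =
      iteratedFDeriv ℝ m f (x + v) - iteratedFDeriv ℝ m f x := by
    have h1 : fwdDiffAlong v f = (fun x => f (x + v)) - f := rfl
    rw [h1, iteratedFDeriv_sub hshift hf, Pi.sub_apply, iteratedFDeriv_comp_add_right]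
  rw [e]
  have h := convex_univ.norm_image_sub_le_of_norm_fderiv_le (𝕜 := ℝ) (f := iteratedFDeriv ℝ m f)
    (C := D) (fun x _ => hd x) (fun x _ => by rw [norm_fderiv_iteratedFDeriv]; exact hD x)
    (Set.mem_univ x) (Set.mem_univ (x + v))
  rwa [add_sub_cancel_left] at h

lemma ContDiff.differentiable_iteratedFDeriv_of_succ {m : ℕ} {f : Par k → ℝ}
    (hf : ContDiff ℝ (m + 1 : ℕ) f) : Differentiable ℝ (iteratedFDeriv ℝ m f) :=
  hf.differentiable_iteratedFDeriv (by exact_mod_cast Nat.lt_succ_self m)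

/-- The fourth difference `Δ_v⁴ f (x)`. -/
def fourthDiff (f : Par k → ℝ) (x v : Par k) : ℝ :=
  f (x + (4 : ℝ) • v) - 4 * f (x + (3 : ℝ) • v) + 6 * f (x + (2 : ℝ) • v) - 4 * f (x + v) + f x

lemma abs_fourthDiff_le {f : Par k → ℝ} (hf : ContDiff ℝ 3 f)
    (hd : Differentiable ℝ (iteratedFDeriv ℝ 3 f)) {D : ℝ}
    (hD : ∀ x, ‖iteratedFDeriv ℝ 4 f x‖ ≤ D) (x v : Par k) :
    |fourthDiff f x v| ≤ D * ‖v‖ ^ 4 := by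
  have c3 : ContDiff ℝ (3 : ℕ) (fwdDiffAlong v f) := ContDiff.fwdDiffAlong hf v
  have b3 := norm_iteratedFDeriv_fwdDiffAlong_le (m := 3) hf hd hD v
  have c2 : ContDiff ℝ (2 : ℕ) (fwdDiffAlong v f) := c3.of_le (by norm_num)
  have b2 := norm_iteratedFDeriv_fwdDiffAlong_le (m := 2) c2
    (ContDiff.differentiable_iteratedFDeriv_of_succ c3) b3 v
  have c2' := ContDiff.fwdDiffAlong c2 v
  have c1 : ContDiff ℝ (1 : ℕ) (fwdDiffAlong v (fwdDiffAlong v f)) := c2'.of_le (by norm_num)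
  have b1 := norm_iteratedFDeriv_fwdDiffAlong_le (m := 1) c1
    (ContDiff.differentiable_iteratedFDeriv_of_succ c2') b2 v
  have c1' := ContDiff.fwdDiffAlong c1 v
  have c0 : ContDiff ℝ (0 : ℕ) (fwdDiffAlong v (fwdDiffAlong v (fwdDiffAlong v f))) :=
    c1'.of_le (by norm_num)
  have b0 := norm_iteratedFDeriv_fwdDiffAlong_le (m := 0) c0
    (ContDiff.differentiable_iteratedFDeriv_of_succ c1') b1 v x
  rw [norm_iteratedFDeriv_zero, Real.norm_eq_abs] at b0
  have e : fwdDiffAlong v (fwdDiffAlong v (fwdDiffAlong v (fwdDiffAlong v f))) x =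
      fourthDiff f x v := by
    have e2 : x + v + v = x + (2 : ℝ) • v := by rw [two_smul]; abel
    have e3 : x + v + v + v = x + (3 : ℝ) • v := by
      rw [show (3 : ℝ) = 2 + 1 by norm_num, add_smul, one_smul, two_smul]; abel
    have e4 : x + v + v + v + v = x + (4 : ℝ) • v := by
      rw [show (4 : ℝ) = 2 + 2 by norm_num, add_smul, two_smul]; abel
    simp only [fwdDiffAlong, e2, fourthDiff, ← e3, ← e4]
    ring
  rw [e] at b0
  exact b0.trans (le_of_eq (by ring))

/-! ### Functions with vanishing fourth differences -/

/-- A nonnegative sequence on `ℤ` that vanishes at `0` and has vanishing fourth differences is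
`b m + a m²` with `|b| ≤ a`: a cubic polynomial that is bounded below has no cubic term. -/
lemma int_seq_quadratic {x : ℤ → ℝ} (hx : ∀ m, x (m + 4) - 4 * x (m + 3) + 6 * x (m + 2)
    - 4 * x (m + 1) + x m = 0) (h0 : x 0 = 0) (hnn : ∀ m, 0 ≤ x m) :
    ∃ a b : ℝ, |b| ≤ a ∧ ∀ m : ℤ, x m = b * m + a * m ^ 2 := by
  -- the coefficients of the cubic interpolating `x` at `0, 1, 2, 3`
  set c₃ : ℝ := (x 3 - 3 * x 2 + 3 * x 1) / 6 with hc₃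
  set c₂ : ℝ := (x 2 - 2 * x 1) / 2 - 3 * c₃ with hc₂
  set c₁ : ℝ := x 1 - c₂ - c₃ with hc₁
  set d : ℤ → ℝ := fun m => x m - (c₁ * m + c₂ * m ^ 2 + c₃ * m ^ 3) with hd
  have hd4 : ∀ m, d (m + 4) - 4 * d (m + 3) + 6 * d (m + 2) - 4 * d (m + 1) + d m = 0 := by
    intro m
    have := hx m
    simp only [hd]
    push_cast
    linear_combination this
  have hd0 : ∀ m, d m = 0 ∧ d (m + 1) = 0 ∧ d (m + 2) = 0 ∧ d (m + 3) = 0 := by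
    intro m
    induction m using Int.induction_on with
    | zero =>
      refine ⟨?_, ?_, ?_, ?_⟩ <;> simp only [hd, h0, hc₁, hc₂, hc₃, zero_add] <;> push_cast <;> ring
    | succ i ih =>
      obtain ⟨i0, i1, i2, i3⟩ := ih
      have := hd4 i
      rw [i0, i1, i2, i3] at this
      refine ⟨i1, ?_, ?_, ?_⟩
      · rw [add_assoc]; exact i2
      · rw [add_assoc]; exact i3
      · rw [add_assoc]; norm_num at this ⊢; exact this
    | pred i ih =>
      obtain ⟨i0, i1, i2, i3⟩ := ih
      have := hd4 (-(i : ℤ) - 1)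
      have e1 : -(i : ℤ) - 1 + 1 = -i := by ring
      have e2 : -(i : ℤ) - 1 + 2 = -i + 1 := by ring
      have e3 : -(i : ℤ) - 1 + 3 = -i + 2 := by ring
      have e4 : -(i : ℤ) - 1 + 4 = -i + 3 := by ring
      rw [e1, e2, e3, e4, i0, i1, i2, i3] at this
      rw [e1, e2, e3]
      refine ⟨by linarith, i0, i1, i2⟩
  have hcubic : ∀ m : ℤ, x m = c₁ * m + c₂ * m ^ 2 + c₃ * m ^ 3 := fun m =>
    sub_eq_zero.1 (hd0 m).1
  have hbound : ∀ m : ℕ, 1 ≤ m → |c₁ + c₃ * m ^ 2| ≤ c₂ * m := by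
    intro m hm
    have hm0 : (0 : ℝ) < m := by exact_mod_cast hm
    have h1 := hnn m
    have h2 := hnn (-m)
    rw [hcubic] at h1 h2
    push_cast at h1 h2
    rw [abs_le]
    constructor
    · refine le_of_mul_le_mul_left ?_ hm0
      linarith
    · refine le_of_mul_le_mul_left ?_ hm0
      linarith
  have hc₃0 : c₃ = 0 := by
    by_contra hne
    have hpos : 0 < |c₃| := abs_pos.2 hne
    obtain ⟨N, hN⟩ := exists_nat_gt ((|c₁| + |c₂|) / |c₃|)
    rw [div_lt_iff₀ hpos] at hN
    have hN1 : 1 ≤ N := by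
      rcases Nat.eq_zero_or_pos N with rfl | h
      · have := abs_nonneg c₁
        have := abs_nonneg c₂
        simp at hN; linarith
      · exact h
    have hN0 : (1 : ℝ) ≤ N := by exact_mod_cast hN1
    have h1 := hbound N hN1
    have h2 : |c₃| * N ^ 2 ≤ |c₁ + c₃ * N ^ 2| + |c₁| := by
      have h3 := abs_sub_le (c₃ * N ^ 2) (c₁ + c₃ * N ^ 2) 0
      have h4 := abs_sub (c₁ + c₃ * N ^ 2) c₁
      rw [add_sub_cancel_left, abs_mul, abs_of_nonneg (by positivity : (0 : ℝ) ≤ (N : ℝ) ^ 2)] at h4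
      exact h4
    have h5 : c₂ * N ≤ |c₂| * N := mul_le_mul_of_nonneg_right (le_abs_self _) (by linarith)
    nlinarith [abs_nonneg c₁]
  refine ⟨c₂, c₁, ?_, fun m => by rw [hcubic, hc₃0]; ring⟩
  have := hbound 1 le_rfl
  rw [hc₃0] at this
  simpa using this

/-- A nonnegative function with vanishing fourth differences, which vanishes at `θ₀` and whose
Hessian at `θ₀` is the identity, is `½‖θ - θ₀‖²`. -/
lemma eq_half_normSq_of_fourthDiff {F : Par k → ℝ} {θ₀ : Par k}
    (h4 : ∀ x v, fourthDiff F x v = 0) (hnn : ∀ x, 0 ≤ F x) (h0 : F θ₀ = 0)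
    (hdiff : ∀ᶠ θ in 𝓝 θ₀, DifferentiableAt ℝ F θ)
    (hhess : HasFDerivAt (gradient F) (ContinuousLinearMap.id ℝ (Par k)) θ₀) (v : Par k) :
    F (θ₀ + v) = 1 / 2 * ‖v‖ ^ 2 := by
  have hquad : ∀ w : Par k, ∃ a b : ℝ, |b| ≤ a ∧
      ∀ m : ℤ, F (θ₀ + (m : ℝ) • w) = b * m + a * m ^ 2 := by
    intro w
    refine int_seq_quadratic (x := fun m : ℤ => F (θ₀ + (m : ℝ) • w)) (fun m => ?_) (by simp [h0])
      fun m => hnn _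
    have := h4 (θ₀ + (m : ℝ) • w) w
    rw [fourthDiff] at this
    push_cast
    simp only [add_smul, ← add_assoc, one_smul]
    exact this
  obtain ⟨a, b, -, hab⟩ := hquad v
  have hscale : ∀ N : ℕ, 1 ≤ N → |b| ≤ a / N ∧ F (θ₀ + (N : ℝ)⁻¹ • v) = b / N + a / N ^ 2 := by
    intro N hN
    have hN0 : (0 : ℝ) < N := by exact_mod_cast hN
    obtain ⟨a', b', hle, hab'⟩ := hquad ((N : ℝ)⁻¹ • v)
    have e1 := hab' N
    have e2 := hab' (-N)
    have f1 := hab 1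
    have f2 := hab (-1)
    push_cast at e1 e2 f1 f2
    rw [smul_smul, mul_inv_cancel₀ hN0.ne'] at e1
    rw [neg_smul, smul_smul, mul_inv_cancel₀ hN0.ne', ← neg_smul] at e2
    have hb : b = b' * N := by linarith
    have ha : a = a' * N ^ 2 := by linarith
    have e3 := hab' 1
    push_cast at e3
    rw [one_smul] at e3
    rw [e3, hb, ha, abs_mul, abs_of_pos hN0]
    constructor
    · rw [le_div_iff₀ hN0]
      nlinarith [mul_pos hN0 hN0]
    · field_simp
  have hb0 : b = 0 := by
    by_contra hne
    have hpos : 0 < |b| := abs_pos.2 hne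
    obtain ⟨N, hN⟩ := exists_nat_gt (|a| / |b|)
    rw [div_lt_iff₀ hpos] at hN
    have hN1 : 1 ≤ N := by
      rcases Nat.eq_zero_or_pos N with rfl | h
      · have := abs_nonneg a
        simp at hN; linarith
      · exact h
    have hN0 : (0 : ℝ) < N := by exact_mod_cast hN1
    have := (hscale N hN1).1
    rw [le_div_iff₀ hN0] at this
    linarith [le_abs_self a]
  -- the behaviour of `F` near `θ₀` determines the quadratic coefficient
  have hgrad : gradient F θ₀ = 0 := by
    have hmin : IsLocalMin F θ₀ := Eventually.of_forall fun x => by rw [h0]; exact hnn x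
    rw [gradient, hmin.fderiv_eq_zero, map_zero]
  have ha : a = 1 / 2 * ‖v‖ ^ 2 := by
    by_contra hne
    have hpos : 0 < |a - 1 / 2 * ‖v‖ ^ 2| := abs_pos.2 (sub_ne_zero.2 hne)
    set ε := |a - 1 / 2 * ‖v‖ ^ 2| / (2 * (‖v‖ ^ 2 + 1)) with hε
    have hε0 : 0 < ε := by positivity
    have h1 := hhess.isLittleO.def hε0
    obtain ⟨r, hr, hball⟩ := Metric.eventually_nhds_iff.1 (hdiff.and h1)
    obtain ⟨N, hN⟩ := exists_nat_gt (‖v‖ / r + 1)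
    have hN1 : (1 : ℝ) < N := by
      have : 0 ≤ ‖v‖ / r := by positivity
      linarith
    have hN0 : (0 : ℝ) < N := by linarith
    have hs : ‖(N : ℝ)⁻¹ • v‖ < r := by
      rw [norm_smul, norm_inv, Real.norm_natCast, inv_mul_lt_iff₀ hN0]
      have : ‖v‖ / r < N := by linarith
      rwa [div_lt_iff₀ hr] at this
    set u := (N : ℝ)⁻¹ • v with hu
    have hG : ∀ x, DifferentiableAt ℝ F x →
        HasGradientAt (fun z => F z - 1 / 2 * ‖z - θ₀‖ ^ 2) (gradient F x - (x - θ₀)) x := by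
      intro x hx
      have h1 : HasFDerivAt (fun y : Par k => y - θ₀) (ContinuousLinearMap.id ℝ _) x :=
        (hasFDerivAt_id x).sub_const θ₀
      have h2 : HasFDerivAt (fun g : Par k => 1 / 2 * ‖g‖ ^ 2)
        (InnerProductSpace.toDual ℝ (Par k) (x - θ₀)) (x - θ₀) :=
        (gradient_half_normSq (x - θ₀)).hasFDerivAt
      have h3 := HasFDerivAt.comp (g := fun g : Par k => 1 / 2 * ‖g‖ ^ 2) x h2 h1
      rw [hasGradientAt_iff_hasFDerivAt, map_sub]
      exact hx.hasGradientAt.hasFDerivAt.sub h3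
    have hmem : ∀ x ∈ Metric.closedBall θ₀ ‖u‖, dist x θ₀ < r := fun x hx =>
      lt_of_le_of_lt hx hs
    have h2 := abs_sub_inner_le_of_gradient (g := 0) (K := ε * ‖u‖)
      (convex_closedBall θ₀ ‖u‖) (fun x hx => (hG x (hball (hmem x hx)).1).differentiableAt)
      (fun x hx => by
        have h3 := (hball (hmem x hx)).2
        rw [hgrad, sub_zero, ContinuousLinearMap.id_apply] at h3
        rw [(hG x (hball (hmem x hx)).1).gradient, sub_zero]
        exact h3.trans (mul_le_mul_of_nonneg_left (mem_closedBall_iff_norm.1 hx) hε0.le))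
      (x := θ₀) (y := θ₀ + u) (Metric.mem_closedBall_self (norm_nonneg _))
      (by rw [mem_closedBall_iff_norm, add_sub_cancel_left])
    rw [inner_zero_left, sub_self, norm_zero, add_sub_cancel_left, h0] at h2
    have h3 := (hscale N (by exact_mod_cast hN1.le)).2
    rw [h3, hb0, hu, norm_smul, norm_inv, Real.norm_natCast] at h2
    have e : 0 / (N : ℝ) + a / N ^ 2 - 1 / 2 * ((N : ℝ)⁻¹ * ‖v‖) ^ 2 - (0 - 1 / 2 * 0 ^ 2) - 0 =
        (a - 1 / 2 * ‖v‖ ^ 2) / N ^ 2 := by field_simp; ring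
    rw [e, abs_div, abs_of_pos (by positivity : (0 : ℝ) < (N : ℝ) ^ 2), div_le_iff₀ (by positivity)]
      at h2
    have e2 : ε * ((N : ℝ)⁻¹ * ‖v‖) * ((N : ℝ)⁻¹ * ‖v‖) * N ^ 2 = ε * ‖v‖ ^ 2 := by field_simp
    rw [e2] at h2
    have e3 : ε * (2 * (‖v‖ ^ 2 + 1)) = |a - 1 / 2 * ‖v‖ ^ 2| := by
      rw [hε]; exact div_mul_cancel₀ _ (by positivity)
    rw [← e3] at h2
    nlinarith [sq_nonneg ‖v‖, mul_nonneg hε0.le (sq_nonneg ‖v‖)]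
  have h5 := hab 1
  rw [hb0, ha] at h5
  simpa using h5

end CVSure

namespace CVSure

variable {k : ℕ} {Z : Type*}

/-! ### The population problem -/

section Regularity

variable {l : Par k → Z → ℝ} {n : ℕ} {z : Z}

lemma contDiff_locLoss (h : ContDiff ℝ 3 fun β => l β z) :
    ContDiff ℝ 3 fun t => locLoss l n t z := by
  have h1 : ContDiff ℝ 3 fun t : Par k => (Real.sqrt n)⁻¹ • t := by fun_prop
  exact h.comp h1

lemma differentiable_iteratedFDeriv_locLoss (h : ContDiff ℝ 3 fun β => l β z)
    (h' : Differentiable ℝ (iteratedFDeriv ℝ 3 fun β => l β z)) :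
    Differentiable ℝ (iteratedFDeriv ℝ 3 fun t => locLoss l n t z) := by
  have e := iteratedFDeriv_comp_const_smul (𝕜 := ℝ) (i := 3) (Real.sqrt n)⁻¹
    (f := fun β => l β z) h
  show Differentiable ℝ (iteratedFDeriv ℝ 3 fun t => l ((Real.sqrt n)⁻¹ • t) z)
  rw [e]
  have h1 : Differentiable ℝ fun t : Par k => (Real.sqrt n)⁻¹ • t := by fun_prop
  exact (h'.comp h1).const_smul (((Real.sqrt n)⁻¹ : ℝ) ^ 3)

/-- The gradient in the original parameter is `√n` times the gradient in the local parameter. -/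
lemma gradient_eq_sqrt_smul_gradient_locLoss (hn : 1 ≤ n) (h : Differentiable ℝ fun β => l β z)
    (θ : Par k) : gradient (fun β => l β z) ((Real.sqrt n)⁻¹ • θ) =
      Real.sqrt n • gradient (fun t => locLoss l n t z) θ := by
  have hn0 : (0 : ℝ) < n := by exact_mod_cast hn
  have hs : Real.sqrt n ≠ 0 := (Real.sqrt_pos.2 hn0).ne'
  have h1 : HasGradientAt (fun t => locLoss l n t z)
      ((Real.sqrt n)⁻¹ • gradient (fun β => l β z) ((Real.sqrt n)⁻¹ • θ)) θ := by
    rw [hasGradientAt_iff_hasFDerivAt]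
    have h2 : HasFDerivAt (fun t : Par k => (Real.sqrt n)⁻¹ • t)
        ((Real.sqrt n)⁻¹ • ContinuousLinearMap.id ℝ (Par k)) θ :=
      ((Real.sqrt n)⁻¹ • ContinuousLinearMap.id ℝ (Par k)).hasFDerivAt
    have h3 := HasFDerivAt.comp (g := fun β => l β z) θ
      (h ((Real.sqrt n)⁻¹ • θ)).hasGradientAt.hasFDerivAt h2
    refine h3.congr_fderiv (ContinuousLinearMap.ext fun v => ?_)
    simp
  rw [h1.gradient, smul_smul, mul_inv_cancel₀ hs, one_smul]

end Regularity

variable [MeasurableSpace Z]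

/-- Gradients of a family of differentiable functions depend measurably on the parameter, as limits
of difference quotients. -/
lemma aestronglyMeasurable_gradient {ν : Measure Z} {f : Par k → Z → ℝ}
    (hm : ∀ θ, AEStronglyMeasurable (f θ) ν)
    (hd : ∀ᵐ z ∂ν, Differentiable ℝ fun t => f t z) (θ : Par k) :
    AEStronglyMeasurable (fun z => gradient (fun t => f t z) θ) ν := by
  have hcoord : ∀ v : Par k,
      AEStronglyMeasurable (fun z => inner ℝ (gradient (fun t => f t z) θ) v) ν := by
    intro v
    refine aestronglyMeasurable_of_tendsto_ae (u := atTop)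
      (f := fun (m : ℕ) z => ((m : ℝ) + 1) * (f (θ + ((m : ℝ) + 1)⁻¹ • v) z - f θ z))
      (fun m => (((hm _).sub (hm _)).const_mul _)) ?_
    filter_upwards [hd] with z hz
    have h1 := hasDerivAt_along hz θ v 0
    simp only [zero_smul, add_zero] at h1
    have h2 := h1.tendsto_slope_zero_right
    have h3 : Tendsto (fun m : ℕ => ((m : ℝ) + 1)⁻¹) atTop (𝓝[>] 0) := by
      refine tendsto_nhdsWithin_iff.2 ⟨?_, Eventually.of_forall fun m => ?_⟩
      · simpa [one_div] using tendsto_one_div_add_atTop_nhds_zero_nat (𝕜 := ℝ)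
      · exact Set.mem_Ioi.2 (by positivity)
    have h4 := h2.comp h3
    refine h4.congr fun m => ?_
    simp
  have e : (fun z => gradient (fun t => f t z) θ) = fun z =>
      ∑ a : Fin k, inner ℝ (gradient (fun t => f t z) θ) (EuclideanSpace.single a (1 : ℝ)) •
        (EuclideanSpace.single a (1 : ℝ) : Par k) := by
    funext z
    set g := gradient (fun t => f t z) θ
    ext b
    simp [Finset.sum_apply, Pi.single_apply, -inner_gradient_left,
      EuclideanSpace.inner_single_right]
  rw [e]
  exact Finset.aestronglyMeasurable_fun_sum _ fun a _ => (hcoord _).smul_const _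

variable {l : Par k → Z → ℝ} {μ : ℕ → Measure Z} {θ₀ : Par k} {Sig : Matrix (Fin k) (Fin k) ℝ}

/-- The score `√n ∇l_n(θ₀, z)`, which is the gradient of the loss in the original parameter. -/
noncomputable def score (l : Par k → Z → ℝ) (θ₀ : Par k) (n : ℕ) (z : Z) : Par k :=
  Real.sqrt n • gradient (fun t => locLoss l n t z) θ₀

lemma integrable_locLoss (hseq : SequenceOfExperiments l μ θ₀ Sig) {n : ℕ} (hn : 1 ≤ n)
    (θ : Par k) : Integrable (locLoss l n θ) (μ n) :=
  hseq.integrable n hn _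

lemma ae_contDiff_locLoss (hcv : CVConditions l μ θ₀) {n : ℕ} (hn : 1 ≤ n) :
    ∀ᵐ z ∂(μ n), ContDiff ℝ 3 fun t => locLoss l n t z := by
  filter_upwards [hcv.smooth n hn] with z hz
  exact contDiff_locLoss hz.1

lemma aestronglyMeasurable_score (hseq : SequenceOfExperiments l μ θ₀ Sig)
    (hcv : CVConditions l μ θ₀) {n : ℕ} (hn : 1 ≤ n) :
    AEStronglyMeasurable (score l θ₀ n) (μ n) := by
  refine (aestronglyMeasurable_gradient (f := locLoss l n)
    (fun θ => (integrable_locLoss hseq hn θ).1) ?_ θ₀).const_smul (Real.sqrt n)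
  filter_upwards [ae_contDiff_locLoss hcv hn] with z hz
  exact hz.differentiable (by norm_num)

lemma memLp_score (hseq : SequenceOfExperiments l μ θ₀ Sig)
    (hcv : CVConditions l μ θ₀) {n : ℕ} (hn : 1 ≤ n) : MemLp (score l θ₀ n) 4 (μ n) := by
  refine ⟨aestronglyMeasurable_score hseq hcv hn, ?_⟩
  obtain ⟨M, hM⟩ := hcv.score_moment
  rw [eLpNorm_lt_top_iff_lintegral_rpow_enorm_lt_top (by norm_num) (by norm_num)]
  have h := hM n hn
  refine lt_of_le_of_lt (le_of_eq ?_) (h.trans_lt ENNReal.coe_lt_top)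
  refine lintegral_congr fun z => ?_
  rw [score]
  norm_num

lemma exists_integral_norm_score_pow_le (hseq : SequenceOfExperiments l μ θ₀ Sig)
    (hcv : CVConditions l μ θ₀) :
    ∃ M : ℝ, ∀ n, 1 ≤ n → ∫ z, ‖score l θ₀ n z‖ ^ 4 ∂(μ n) ≤ M := by
  obtain ⟨M, hM⟩ := hcv.score_moment
  refine ⟨M, fun n hn => ?_⟩
  have hm : AEStronglyMeasurable (fun z => ‖score l θ₀ n z‖ ^ 4) (μ n) :=
    (aestronglyMeasurable_score hseq hcv hn).norm.pow 4
  rw [integral_eq_lintegral_of_nonneg_ae (Eventually.of_forall fun z => by positivity) hm]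
  refine ENNReal.toReal_le_coe_of_le_coe (le_trans (le_of_eq ?_) (hM n hn))
  refine lintegral_congr fun z => ?_
  rw [ENNReal.ofReal_pow (norm_nonneg _), ofReal_norm]
  rfl

lemma memLp_inner_score (hseq : SequenceOfExperiments l μ θ₀ Sig)
    (hcv : CVConditions l μ θ₀) {n : ℕ} (hn : 1 ≤ n) (v : Par k) :
    MemLp (fun z => inner ℝ (score l θ₀ n z) v) 4 (μ n) :=
  (memLp_score hseq hcv hn).inner_const v

lemma memLp_score_apply (hseq : SequenceOfExperiments l μ θ₀ Sig)
    (hcv : CVConditions l μ θ₀) {n : ℕ} (hn : 1 ≤ n) (a : Fin k) :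
    MemLp (fun z => score l θ₀ n z a) 4 (μ n) := by
  have h := memLp_inner_score hseq hcv hn (EuclideanSpace.single a 1)
  simpa [EuclideanSpace.inner_single_right] using h

variable [∀ n, IsProbabilityMeasure (μ n)]

/-- The score has mean zero: `θ₀` minimizes the expected loss, whose expansion at `θ₀` is justified
by the Lipschitz condition on the score. -/
lemma integral_inner_score (hseq : SequenceOfExperiments l μ θ₀ Sig)
    (hcv : CVConditions l μ θ₀) {n : ℕ} (hn : 1 ≤ n) (v : Par k) :
    ∫ z, inner ℝ (score l θ₀ n z) v ∂(μ n) = 0 := by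
  have hn0 : (0 : ℝ) < n := by exact_mod_cast hn
  have hs : 0 < Real.sqrt n := Real.sqrt_pos.2 hn0
  obtain ⟨B, M, hB⟩ := hcv.score_lipschitz
  obtain ⟨hlip, hBL, -⟩ := hB n hn
  have hBint : Integrable (fun z => |B n z|) (μ n) := (hBL.integrable one_le_two).abs
  have hsint : Integrable (fun z => inner ℝ (score l θ₀ n z) v) (μ n) :=
    (memLp_inner_score hseq hcv hn v).integrable (by norm_num)
  set a := ∫ z, inner ℝ (score l θ₀ n z) v ∂(μ n) with ha
  set b := ‖v‖ ^ 2 * ∫ z, |B n z| ∂(μ n) with hb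
  have hb0 : 0 ≤ b := mul_nonneg (sq_nonneg _) (integral_nonneg fun z => abs_nonneg _)
  have key : ∀ t : ℝ, 0 ≤ t * a + t ^ 2 * b := by
    intro t
    have h1 : ∀ᵐ z ∂(μ n), Real.sqrt n * (locLoss l n (θ₀ + t • v) z - locLoss l n θ₀ z) ≤
        t * inner ℝ (score l θ₀ n z) v + t ^ 2 * (‖v‖ ^ 2 * |B n z|) := by
      filter_upwards [hlip, ae_contDiff_locLoss hcv hn] with z hz hzd
      have hd : Differentiable ℝ fun t => locLoss l n t z := hzd.differentiable (by norm_num)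
      have h2 := abs_sub_inner_le_of_gradient (f := fun t => locLoss l n t z)
        (g := gradient (fun t => locLoss l n t z) θ₀) (K := (Real.sqrt n)⁻¹ * (|B n z| * ‖t • v‖))
        (convex_closedBall θ₀ ‖t • v‖) (fun x _ => hd x)
        (fun x hx => by
          rw [le_inv_mul_iff₀ hs]
          have h3 := hz x θ₀
          rw [← smul_sub, norm_smul, Real.norm_eq_abs, abs_of_pos hs] at h3
          refine h3.trans (mul_le_mul (le_abs_self _) (mem_closedBall_iff_norm.1 hx)
            (norm_nonneg _) (abs_nonneg _)))
        (x := θ₀) (y := θ₀ + t • v) (Metric.mem_closedBall_self (norm_nonneg _))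
        (by rw [mem_closedBall_iff_norm, add_sub_cancel_left])
      rw [add_sub_cancel_left] at h2
      have h4 := (abs_le.1 h2).2
      have h5 := mul_le_mul_of_nonneg_left h4 hs.le
      have h6 : Real.sqrt n * inner ℝ (gradient (fun t => locLoss l n t z) θ₀) (t • v) =
          t * inner ℝ (score l θ₀ n z) v := by
        rw [inner_smul_right, score, inner_smul_left]
        simp only [conj_trivial]; ring
      have h7 : Real.sqrt n * ((Real.sqrt n)⁻¹ * (|B n z| * ‖t • v‖) * ‖t • v‖) =
          t ^ 2 * (‖v‖ ^ 2 * |B n z|) := by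
        rw [norm_smul, Real.norm_eq_abs, ← sq_abs t]
        field_simp
      rw [mul_sub, h6, h7] at h5
      linarith
    have hint : Integrable (fun z => locLoss l n (θ₀ + t • v) z - locLoss l n θ₀ z) (μ n) :=
      (integrable_locLoss hseq hn _).sub (integrable_locLoss hseq hn _)
    have h8 := integral_mono_ae (hint.const_mul (Real.sqrt n))
      ((hsint.const_mul t).add ((hBint.const_mul (‖v‖ ^ 2)).const_mul (t ^ 2))) h1
    have e : ∫ z, (fun z => t * inner ℝ (score l θ₀ n z) v) z +
        (fun z => t ^ 2 * (‖v‖ ^ 2 * |B n z|)) z ∂(μ n) = t * a + t ^ 2 * b := by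
      rw [integral_add (hsint.const_mul t) ((hBint.const_mul (‖v‖ ^ 2)).const_mul (t ^ 2)),
        integral_const_mul, integral_const_mul, integral_const_mul]
    refine le_trans ?_ (h8.trans (le_of_eq e))
    rw [integral_const_mul, integral_sub (integrable_locLoss hseq hn _)
      (integrable_locLoss hseq hn _)]
    exact mul_nonneg hs.le (sub_nonneg.2 (hseq.minimizer n hn _))
  by_contra hne
  have h1 := key (-a / (b + 1))
  have h2 : 0 < b + 1 := by linarith
  have h3 : -a / (b + 1) * a + (-a / (b + 1)) ^ 2 * b = -(a ^ 2) / (b + 1) ^ 2 := by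
    field_simp; ring
  rw [h3] at h1
  have h4 : 0 < a ^ 2 / (b + 1) ^ 2 := by positivity
  rw [neg_div] at h1
  linarith

lemma integral_score_apply (hseq : SequenceOfExperiments l μ θ₀ Sig)
    (hcv : CVConditions l μ θ₀) {n : ℕ} (hn : 1 ≤ n) (a : Fin k) :
    ∫ z, score l θ₀ n z a ∂(μ n) = 0 := by
  have h := integral_inner_score hseq hcv hn (EuclideanSpace.single a 1)
  simpa [EuclideanSpace.inner_single_right] using h

lemma integral_score_mul (hseq : SequenceOfExperiments l μ θ₀ Sig)
    (hcv : CVConditions l μ θ₀) {n : ℕ} (hn : 1 ≤ n) (a b : Fin k) :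
    ∫ z, score l θ₀ n z a * score l θ₀ n z b ∂(μ n) = Sig a b := by
  have hle : (2 : ℝ≥0∞) ≤ 4 := by norm_num
  have hae : ∀ c : Fin k, (fun z => gradient (fun β => l β z) ((Real.sqrt n)⁻¹ • θ₀) c) =ᵐ[μ n]
      fun z => score l θ₀ n z c := by
    intro c
    filter_upwards [hcv.smooth n hn] with z hz
    rw [gradient_eq_sqrt_smul_gradient_locLoss hn (hz.1.differentiable (by norm_num)), score]
  rw [hseq.variance n hn a b, ProbabilityTheory.covariance_eq_sub
    (((memLp_score_apply hseq hcv hn a).mono_exponent hle).ae_eq (hae a).symm)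
    (((memLp_score_apply hseq hcv hn b).mono_exponent hle).ae_eq (hae b).symm),
    integral_congr_ae (hae a), integral_score_apply hseq hcv hn, zero_mul, sub_zero]
  refine (integral_congr_ae ?_).symm
  filter_upwards [hae a, hae b] with z h1 h2
  rw [Pi.mul_apply, h1, h2]

lemma integral_inner_score_sq (hseq : SequenceOfExperiments l μ θ₀ Sig)
    (hcv : CVConditions l μ θ₀) {n : ℕ} (hn : 1 ≤ n) (v : Par k) :
    ∫ z, inner ℝ (score l θ₀ n z) v ^ 2 ∂(μ n) =
      (v : Fin k → ℝ) ⬝ᵥ (Sig.mulVec (v : Fin k → ℝ)) := by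
  have hle : (2 : ℝ≥0∞) ≤ 4 := by norm_num
  have e : ∀ z, inner ℝ (score l θ₀ n z) v ^ 2 =
      ∑ a, ∑ b, v a * v b * (score l θ₀ n z a * score l θ₀ n z b) := by
    intro z
    rw [PiLp.inner_apply, sq, Finset.sum_mul_sum]
    refine Finset.sum_congr rfl fun a _ => Finset.sum_congr rfl fun b _ => ?_
    simp only [RCLike.inner_apply, conj_trivial]; ring
  have hint : ∀ a b, Integrable (fun z => v a * v b * (score l θ₀ n z a * score l θ₀ n z b))
      (μ n) := fun a b =>
    (((memLp_score_apply hseq hcv hn a).mono_exponent hle).integrable_mul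
      ((memLp_score_apply hseq hcv hn b).mono_exponent hle)).const_mul _
  simp only [e]
  rw [integral_finsetSum _ fun a _ => integrable_finsetSum _ fun b _ => hint a b]
  simp only [dotProduct, Matrix.mulVec, Finset.mul_sum]
  refine Finset.sum_congr rfl fun a _ => ?_
  rw [integral_finsetSum _ fun b _ => hint a b]
  refine Finset.sum_congr rfl fun b _ => ?_
  rw [integral_const_mul, integral_score_mul hseq hcv hn]
  ring

/-! ### The limit of the expected loss -/

lemma expLoss_eq (hseq : SequenceOfExperiments l μ θ₀ Sig) {n : ℕ} (hn : 1 ≤ n) (θ : Par k) :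
    expLoss l μ θ₀ n θ = n * (∫ z, locLoss l n θ z ∂(μ n) - ∫ z, locLoss l n θ₀ z ∂(μ n)) := by
  have hi : ∀ (θ : Par k) (i : Fin n),
      Integrable (fun ω : Fin n → Z => locLoss l n θ (ω i)) (sampleLaw μ n) := fun θ i =>
    (measurePreserving_eval (fun _ : Fin n => μ n) i).integrable_comp_of_integrable
      (integrable_locLoss hseq hn θ)
  have he : ∀ θ : Par k, ∫ ω, empLoss l n ω θ ∂(sampleLaw μ n) =
      n * ∫ z, locLoss l n θ z ∂(μ n) := by
    intro θ
    simp only [empLoss]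
    rw [integral_finsetSum _ fun i _ => hi θ i]
    unfold sampleLaw
    rw [Finset.sum_congr rfl fun i _ => integral_comp_eval (μ := fun _ : Fin n => μ n)
      (integrable_locLoss hseq hn θ).aestronglyMeasurable]
    simp
  rw [expLoss, integral_sub, he, he, mul_sub]
  · exact integrable_finsetSum _ fun i _ => hi θ i
  · exact integrable_finsetSum _ fun i _ => hi θ₀ i

lemma expLoss_nonneg (hseq : SequenceOfExperiments l μ θ₀ Sig) {n : ℕ} (hn : 1 ≤ n) (θ : Par k) :
    0 ≤ expLoss l μ θ₀ n θ := by
  rw [expLoss_eq hseq hn]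
  exact mul_nonneg (Nat.cast_nonneg n) (sub_nonneg.2 (hseq.minimizer n hn θ))

/-- The fourth derivative of the local loss is of order `n⁻²`, so that the fourth differences of
the expected loss vanish in the limit. -/
lemma exists_abs_fourthDiff_expLoss_le (hseq : SequenceOfExperiments l μ θ₀ Sig)
    (hcv : CVConditions l μ θ₀) :
    ∃ M : ℝ, ∀ n, 1 ≤ n → ∀ x v, |fourthDiff (expLoss l μ θ₀ n) x v| ≤ M * ‖v‖ ^ 4 / n := by
  obtain ⟨M, hM⟩ := hcv.fourth_derivative
  refine ⟨1 + M, fun n hn x v => ?_⟩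
  have hn0 : (0 : ℝ) < n := by exact_mod_cast hn
  set S : Z → ℝ≥0∞ := fun z => ⨆ θ : Par k,
    ‖(n : ℝ) ^ 2 • iteratedFDeriv ℝ 4 (fun t => locLoss l n t z) θ‖ₑ with hS
  have hS1 : ∫⁻ z, S z ∂(μ n) ≤ 1 + M := by
    have h1 : ∀ z, S z ≤ 1 + ⨆ θ : Par k,
        ‖(n : ℝ) ^ 2 • iteratedFDeriv ℝ 4 (fun t => locLoss l n t z) θ‖ₑ ^ 4 := by
      intro z
      refine iSup_le fun θ => ?_
      have h2 := le_iSup (fun θ : Par k =>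
        ‖(n : ℝ) ^ 2 • iteratedFDeriv ℝ 4 (fun t => locLoss l n t z) θ‖ₑ ^ 4) θ
      refine le_trans ?_ (add_le_add le_rfl h2)
      rcases le_total ‖(n : ℝ) ^ 2 • iteratedFDeriv ℝ 4 (fun t => locLoss l n t z) θ‖ₑ 1 with h | h
      · exact h.trans le_self_add
      · exact (le_self_pow₀ h (by norm_num)).trans le_add_self
    refine (lintegral_mono h1).trans ?_
    rw [lintegral_add_left measurable_const, lintegral_const, measure_univ, mul_one]
    exact add_le_add le_rfl (hM n hn)
  have hpt : ∀ᵐ z ∂(μ n), ENNReal.ofReal ((n : ℝ) ^ 2) *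
      ‖fourthDiff (fun t => locLoss l n t z) x v‖ₑ ≤ S z * ENNReal.ofReal (‖v‖ ^ 4) := by
    filter_upwards [hcv.smooth n hn] with z hz
    rcases eq_or_ne (S z) ⊤ with htop | htop
    · rcases eq_or_ne v 0 with rfl | hv
      · have : fourthDiff (fun t => locLoss l n t z) x 0 = 0 := by
          simp only [fourthDiff, smul_zero, add_zero]; ring
        rw [this, enorm_zero, mul_zero]
        exact zero_le
      · rw [htop, ENNReal.top_mul]
        · exact le_top
        · exact (ENNReal.ofReal_pos.2 (by positivity)).ne'
    · have h1 : ∀ θ, ‖iteratedFDeriv ℝ 4 (fun t => locLoss l n t z) θ‖ ≤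
          (S z).toReal / (n : ℝ) ^ 2 := by
        intro θ
        rw [le_div_iff₀ (by positivity), mul_comm]
        have h2 : ‖(n : ℝ) ^ 2 • iteratedFDeriv ℝ 4 (fun t => locLoss l n t z) θ‖ₑ ≤ S z :=
          le_iSup (fun θ : Par k =>
            ‖(n : ℝ) ^ 2 • iteratedFDeriv ℝ 4 (fun t => locLoss l n t z) θ‖ₑ) θ
        have h3 := ENNReal.toReal_mono htop h2
        rw [toReal_enorm, norm_smul, Real.norm_eq_abs, abs_of_nonneg (by positivity)] at h3
        exact h3
      have h4 := abs_fourthDiff_le (contDiff_locLoss (n := n) hz.1)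
        (differentiable_iteratedFDeriv_locLoss hz.1 hz.2) h1 x v
      rw [← ENNReal.ofReal_toReal htop, ← ofReal_norm, Real.norm_eq_abs,
        ← ENNReal.ofReal_mul (by positivity), ← ENNReal.ofReal_mul ENNReal.toReal_nonneg]
      refine ENNReal.ofReal_le_ofReal ?_
      have h5 := mul_le_mul_of_nonneg_left h4 (by positivity : (0 : ℝ) ≤ (n : ℝ) ^ 2)
      refine h5.trans (le_of_eq ?_)
      field_simp
  have hI : |∫ z, fourthDiff (fun t => locLoss l n t z) x v ∂(μ n)| ≤
      (1 + M) * ‖v‖ ^ 4 / n ^ 2 := by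
    have h1 : ENNReal.ofReal ((n : ℝ) ^ 2) *
        ‖∫ z, fourthDiff (fun t => locLoss l n t z) x v ∂(μ n)‖ₑ ≤
        (1 + M) * ENNReal.ofReal (‖v‖ ^ 4) := by
      calc _ ≤ ENNReal.ofReal ((n : ℝ) ^ 2) *
            ∫⁻ z, ‖fourthDiff (fun t => locLoss l n t z) x v‖ₑ ∂(μ n) := by
            gcongr; exact enorm_integral_le_lintegral_enorm _
        _ = ∫⁻ z, ENNReal.ofReal ((n : ℝ) ^ 2) *
            ‖fourthDiff (fun t => locLoss l n t z) x v‖ₑ ∂(μ n) :=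
            (lintegral_const_mul' _ _ ENNReal.ofReal_ne_top).symm
        _ ≤ ∫⁻ z, S z * ENNReal.ofReal (‖v‖ ^ 4) ∂(μ n) := lintegral_mono_ae hpt
        _ = (∫⁻ z, S z ∂(μ n)) * ENNReal.ofReal (‖v‖ ^ 4) :=
            lintegral_mul_const' _ _ ENNReal.ofReal_ne_top
        _ ≤ _ := by gcongr
    have e1 : (1 + M : ℝ≥0∞) = ENNReal.ofReal ((1 : ℝ) + (M : ℝ)) := by
      rw [ENNReal.ofReal_add zero_le_one (NNReal.coe_nonneg M), ENNReal.ofReal_one, ENNReal.ofReal_coe_nnreal]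
    rw [← ofReal_norm, e1, ← ENNReal.ofReal_mul (by positivity),
      ← ENNReal.ofReal_mul (by positivity), ENNReal.ofReal_le_ofReal_iff (by positivity),
      Real.norm_eq_abs] at h1
    rw [le_div_iff₀ (by positivity)]
    linarith
  have e : fourthDiff (expLoss l μ θ₀ n) x v =
      n * ∫ z, fourthDiff (fun t => locLoss l n t z) x v ∂(μ n) := by
    have hi := fun θ => integrable_locLoss hseq hn θ
    simp only [fourthDiff, expLoss_eq hseq hn]
    rw [integral_add, integral_sub, integral_add, integral_sub, integral_const_mul,
      integral_const_mul, integral_const_mul]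
    · ring
    · exact hi _
    · exact (hi _).const_mul _
    · exact (hi _).sub ((hi _).const_mul _)
    · exact (hi _).const_mul _
    · exact ((hi _).sub ((hi _).const_mul _)).add ((hi _).const_mul _)
    · exact (hi _).const_mul _
    · exact (((hi _).sub ((hi _).const_mul _)).add ((hi _).const_mul _)).sub ((hi _).const_mul _)
    · exact hi _
  rw [e, abs_mul, abs_of_pos hn0]
  calc _ ≤ n * ((1 + M) * ‖v‖ ^ 4 / n ^ 2) := mul_le_mul_of_nonneg_left hI hn0.le
    _ = _ := by field_simp

/-- The limiting expected loss is exactly `½‖θ - θ₀‖²`. -/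
lemma tendsto_expLoss (hseq : SequenceOfExperiments l μ θ₀ Sig)
    (hnorm : NormalizedLoss l μ θ₀) (hcv : CVConditions l μ θ₀) (θ : Par k) :
    Tendsto (fun n => expLoss l μ θ₀ n θ) atTop (𝓝 (1 / 2 * ‖θ - θ₀‖ ^ 2)) := by
  obtain ⟨Lbar, hlim, hdiff, hhess⟩ := hnorm
  obtain ⟨M, hM⟩ := exists_abs_fourthDiff_expLoss_le hseq hcv
  have h4 : ∀ x v, fourthDiff Lbar x v = 0 := by
    intro x v
    have h1 : Tendsto (fun n => fourthDiff (expLoss l μ θ₀ n) x v) atTop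
        (𝓝 (fourthDiff Lbar x v)) :=
      (((((hlim _).sub ((hlim _).const_mul 4)).add ((hlim _).const_mul 6)).sub
        ((hlim _).const_mul 4)).add (hlim _))
    have h2 : Tendsto (fun n => fourthDiff (expLoss l μ θ₀ n) x v) atTop (𝓝 0) := by
      refine squeeze_zero_norm' ?_ (tendsto_const_div_atTop_nhds_zero_nat (M * ‖v‖ ^ 4))
      filter_upwards [eventually_ge_atTop 1] with n hn
      exact hM n hn x v
    exact tendsto_nhds_unique h1 h2
  have hnn : ∀ x, 0 ≤ Lbar x := fun x => ge_of_tendsto (hlim x) (by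
    filter_upwards [eventually_ge_atTop 1] with n hn
    exact expLoss_nonneg hseq hn x)
  have h0 : Lbar θ₀ = 0 := by
    refine tendsto_nhds_unique (hlim θ₀) ?_
    simp [expLoss]
  have h := eq_half_normSq_of_fourthDiff h4 hnn h0 hdiff hhess (θ - θ₀)
  rw [add_sub_cancel] at h
  rw [← h]
  exact hlim θ

lemma integral_secondDiff_locLoss (hseq : SequenceOfExperiments l μ θ₀ Sig) {n : ℕ} (hn : 1 ≤ n)
    (θ v : Par k) : ∫ z, n * secondDiff (fun t => locLoss l n t z) θ v ∂(μ n) =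
      secondDiff (expLoss l μ θ₀ n) θ v := by
  have hi := fun θ => integrable_locLoss hseq hn θ
  simp only [secondDiff, expLoss_eq hseq hn]
  rw [integral_const_mul, integral_sub, integral_add, integral_const_mul]
  · ring
  · exact hi _
  · exact hi _
  · exact (hi _).add (hi _)
  · exact (hi _).const_mul _

lemma tendsto_secondDiff_expLoss (hseq : SequenceOfExperiments l μ θ₀ Sig)
    (hnorm : NormalizedLoss l μ θ₀) (hcv : CVConditions l μ θ₀) (θ v : Par k) :
    Tendsto (fun n => secondDiff (expLoss l μ θ₀ n) θ v) atTop (𝓝 (‖v‖ ^ 2)) := by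
  have h := tendsto_expLoss hseq hnorm hcv
  have h1 := ((h (θ + v)).add (h (θ - v))).sub ((h θ).const_mul 2)
  have e : 1 / 2 * ‖θ + v - θ₀‖ ^ 2 + 1 / 2 * ‖θ - v - θ₀‖ ^ 2 - 2 * (1 / 2 * ‖θ - θ₀‖ ^ 2) =
      ‖v‖ ^ 2 := by
    have e1 : θ + v - θ₀ = (θ - θ₀) + v := by abel
    have e2 : θ - v - θ₀ = (θ - θ₀) - v := by abel
    rw [e1, e2]
    have := parallelogram_law_with_norm ℝ (θ - θ₀) v
    nlinarith
  rw [e] at h1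
  exact h1

end CVSure

namespace CVSure

/-! ### Regularity of the sample -/

section Regular

variable {k : ℕ} {Z : Type*} {l : Par k → Z → ℝ}

/-- The loss at `z` is smooth, its score is `b`-Lipschitz and its Hessian is `c`-Lipschitz, on the
scale of the conditions for cross-validation. -/
structure RegularLoss (l : Par k → Z → ℝ) (n : ℕ) (z : Z) (b c : ℝ) : Prop where
  contDiff : ContDiff ℝ 3 fun t => locLoss l n t z
  gradient_lip : ∀ θ θ', ‖gradient (fun t => locLoss l n t z) θ -
    gradient (fun t => locLoss l n t z) θ'‖ ≤ (Real.sqrt n)⁻¹ * b * ‖θ - θ'‖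
  hessian_lip : ∀ θ θ', ‖hessian (fun t => locLoss l n t z) θ -
    hessian (fun t => locLoss l n t z) θ'‖ ≤ (n : ℝ)⁻¹ * c * ‖θ - θ'‖

variable {n : ℕ} {z : Z} {b c : ℝ}

lemma RegularLoss.contDiff_two (h : RegularLoss l n z b c) :
    ContDiff ℝ 2 fun t => locLoss l n t z := h.contDiff.of_le (by norm_num)

lemma RegularLoss.differentiable (h : RegularLoss l n z b c) :
    Differentiable ℝ fun t => locLoss l n t z := h.contDiff.differentiable (by norm_num)

lemma gradient_locLoss_eq_score (hn : 1 ≤ n) (θ₀ : Par k) (z : Z) :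
    gradient (fun t => locLoss l n t z) θ₀ = (Real.sqrt n)⁻¹ • score l θ₀ n z := by
  have hn0 : (0 : ℝ) < n := by exact_mod_cast hn
  rw [score, smul_smul, inv_mul_cancel₀ (Real.sqrt_pos.2 hn0).ne', one_smul]

lemma RegularLoss.abs_secondDiff_le (h : RegularLoss l n z b c) (hn : 1 ≤ n) (hb : 0 ≤ b)
    (θ v : Par k) : |n * secondDiff (fun t => locLoss l n t z) θ v| ≤
      Real.sqrt n * (2 * ‖v‖ ^ 2 * b) := by
  have hn0 : (0 : ℝ) < n := by exact_mod_cast hn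
  have hs : 0 < Real.sqrt n := Real.sqrt_pos.2 hn0
  have h1 := abs_secondDiff_le_of_gradient h.differentiable (by positivity) h.gradient_lip θ v
  rw [abs_mul, abs_of_pos hn0]
  refine (mul_le_mul_of_nonneg_left h1 hn0.le).trans (le_of_eq ?_)
  nth_rewrite 1 [← Real.mul_self_sqrt hn0.le]
  field_simp

lemma RegularLoss.secondDiff_sq_le (h : RegularLoss l n z b c) (hn : 1 ≤ n) (hc : 0 ≤ c)
    (θ₀ θ v : Par k) : (n * secondDiff (fun t => locLoss l n t z) θ v) ^ 2 ≤
      2 * (2 * ‖v‖ ^ 3 + (‖θ - θ₀‖ + 1) * ‖v‖ ^ 2) ^ 2 *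
        (c ^ 2 + ‖(n : ℝ) • hessian (fun t => locLoss l n t z) θ₀‖ ^ 2) := by
  have hn0 : (0 : ℝ) < n := by exact_mod_cast hn
  set f : Par k → ℝ := fun t => locLoss l n t z with hf
  set η := ‖(n : ℝ) • hessian f θ₀‖ with hη
  set D := 2 * ‖v‖ ^ 3 + (‖θ - θ₀‖ + 1) * ‖v‖ ^ 2 with hD
  have hη0 : 0 ≤ η := norm_nonneg _
  have h1 := abs_secondDiff_sub_hessian_le h.contDiff_two (by positivity) h.hessian_lip θ v
  have h2 : ‖(n : ℝ) • hessian f θ‖ ≤ c * ‖θ - θ₀‖ + η := by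
    have e : (n : ℝ) • hessian f θ = (n : ℝ) • (hessian f θ - hessian f θ₀) +
        (n : ℝ) • hessian f θ₀ := by rw [smul_sub]; abel
    rw [e]
    refine (norm_add_le _ _).trans (add_le_add ?_ le_rfl)
    rw [norm_smul, Real.norm_eq_abs, abs_of_pos hn0]
    refine (mul_le_mul_of_nonneg_left (h.hessian_lip θ θ₀) hn0.le).trans (le_of_eq ?_)
    field_simp
  have h3 : |n * inner ℝ (hessian f θ v) v| ≤ (c * ‖θ - θ₀‖ + η) * ‖v‖ ^ 2 := by
    have e : n * inner ℝ (hessian f θ v) v = inner ℝ (((n : ℝ) • hessian f θ) v) v := by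
      simp [inner_smul_left]
    rw [e]
    refine (abs_real_inner_le_norm _ _).trans ?_
    calc _ ≤ (‖(n : ℝ) • hessian f θ‖ * ‖v‖) * ‖v‖ :=
          mul_le_mul_of_nonneg_right (ContinuousLinearMap.le_opNorm _ _) (norm_nonneg _)
      _ = ‖(n : ℝ) • hessian f θ‖ * ‖v‖ ^ 2 := by ring
      _ ≤ _ := mul_le_mul_of_nonneg_right h2 (sq_nonneg _)
  have h4 : |n * secondDiff f θ v| ≤ D * (c + η) := by
    have e : n * secondDiff f θ v = n * (secondDiff f θ v - inner ℝ (hessian f θ v) v) +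
        n * inner ℝ (hessian f θ v) v := by ring
    rw [e]
    refine (abs_add_le _ _).trans ?_
    have h5 : |n * (secondDiff f θ v - inner ℝ (hessian f θ v) v)| ≤ 2 * c * ‖v‖ ^ 3 := by
      rw [abs_mul, abs_of_pos hn0]
      refine (mul_le_mul_of_nonneg_left h1 hn0.le).trans (le_of_eq ?_)
      field_simp
    have h6 : 0 ≤ 2 * ‖v‖ ^ 3 * η + c * ‖v‖ ^ 2 + η * ‖θ - θ₀‖ * ‖v‖ ^ 2 := by positivity
    rw [hD]
    linarith
  calc _ = |n * secondDiff f θ v| ^ 2 := (sq_abs _).symm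
    _ ≤ (D * (c + η)) ^ 2 := pow_le_pow_left₀ (abs_nonneg _) h4 2
    _ ≤ 2 * D ^ 2 * (c ^ 2 + η ^ 2) := by nlinarith [mul_nonneg (sq_nonneg D) (sq_nonneg (c - η))]

lemma RegularLoss.norm_gradient_sub_le (h : RegularLoss l n z b c) (hn : 1 ≤ n) (hc : 0 ≤ c)
    {θ₀ x : Par k} {R : ℝ} (hR : 0 ≤ R) (hx : x ∈ Metric.closedBall θ₀ R) :
    ‖gradient (fun t => locLoss l n t z) x - gradient (fun t => locLoss l n t z) θ₀‖ ≤
      (n : ℝ)⁻¹ * ((‖(n : ℝ) • hessian (fun t => locLoss l n t z) θ₀‖ + c * R) * R) := by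
  have hn0 : (0 : ℝ) < n := by exact_mod_cast hn
  set f : Par k → ℝ := fun t => locLoss l n t z with hf
  have h1 : ∀ y ∈ Metric.closedBall θ₀ R,
      ‖hessian f y - 0‖ ≤ (n : ℝ)⁻¹ * (‖(n : ℝ) • hessian f θ₀‖ + c * R) := by
    intro y hy
    have e : hessian f y - 0 = hessian f y - hessian f θ₀ + (n : ℝ)⁻¹ • (n : ℝ) • hessian f θ₀ := by
      rw [smul_smul, inv_mul_cancel₀ hn0.ne', one_smul]; abel
    rw [e]
    refine (norm_add_le _ _).trans ?_
    rw [norm_smul (n : ℝ)⁻¹, Real.norm_eq_abs, abs_of_pos (inv_pos.2 hn0), mul_add, add_comm]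
    refine add_le_add le_rfl ((h.hessian_lip y θ₀).trans ?_)
    rw [← mul_assoc]
    exact mul_le_mul_of_nonneg_left (mem_closedBall_iff_norm.1 hy) (by positivity)
  have h2 := norm_gradient_sub_le_of_hessian h.contDiff_two (convex_closedBall θ₀ R) h1 hx
    (Metric.mem_closedBall_self hR)
  rw [zero_apply, sub_zero] at h2
  refine h2.trans ?_
  rw [← mul_assoc]
  exact mul_le_mul_of_nonneg_left (mem_closedBall_iff_norm.1 hx) (by positivity)

end Regular

section Sample

variable {k : ℕ} {Z : Type*} [MeasurableSpace Z] {l : Par k → Z → ℝ} {μ : ℕ → Measure Z}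
  {θ₀ : Par k} {Sig : Matrix (Fin k) (Fin k) ℝ}

/-- The functions `B`, `C` are Lipschitz constants of the score and of the Hessian, nonnegative and
with second moments bounded by `M`. -/
structure LipschitzEnvelope (l : Par k → Z → ℝ) (μ : ℕ → Measure Z) (B C : ℕ → Z → ℝ) (M : ℝ) :
    Prop where
  regular : ∀ n, 1 ≤ n → ∀ᵐ z ∂(μ n), RegularLoss l n z (B n z) (C n z)
  nonneg_left : ∀ n z, 0 ≤ B n z
  nonneg_right : ∀ n z, 0 ≤ C n z
  memLp_left : ∀ n, 1 ≤ n → MemLp (B n) 2 (μ n)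
  memLp_right : ∀ n, 1 ≤ n → MemLp (C n) 2 (μ n)
  integral_left_le : ∀ n, 1 ≤ n → ∫ z, B n z ^ 2 ∂(μ n) ≤ M
  integral_right_le : ∀ n, 1 ≤ n → ∫ z, C n z ^ 2 ∂(μ n) ≤ M

lemma exists_lipschitzEnvelope (hcv : CVConditions l μ θ₀) :
    ∃ B C M, LipschitzEnvelope l μ B C M := by
  obtain ⟨B, M, hB⟩ := hcv.score_lipschitz
  obtain ⟨C, M', hC⟩ := hcv.hessian_lipschitz
  refine ⟨fun n z => |B n z|, fun n z => |C n z|, max M M', fun n hn => ?_,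
    fun _ _ => abs_nonneg _, fun _ _ => abs_nonneg _, fun n hn => (hB n hn).2.1.norm,
    fun n hn => (hC n hn).2.1.norm, fun n hn => ?_, fun n hn => ?_⟩
  · have hn0 : (0 : ℝ) < n := by exact_mod_cast hn
    have hs : 0 < Real.sqrt n := Real.sqrt_pos.2 hn0
    filter_upwards [ae_contDiff_locLoss hcv hn, (hB n hn).1, (hC n hn).1] with z h1 h2 h3
    refine ⟨h1, fun θ θ' => ?_, fun θ θ' => ?_⟩
    · have h4 := h2 θ θ'
      rw [← smul_sub, norm_smul, Real.norm_eq_abs, abs_of_pos hs] at h4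
      rw [mul_assoc, le_inv_mul_iff₀ hs]
      exact h4.trans (mul_le_mul_of_nonneg_right (le_abs_self _) (norm_nonneg _))
    · have h4 := h3 θ θ'
      have e : (n : ℝ) • hessian (fun t => locLoss l n t z) θ -
          (n : ℝ) • hessian (fun t => locLoss l n t z) θ' =
          (n : ℝ) • (hessian (fun t => locLoss l n t z) θ -
            hessian (fun t => locLoss l n t z) θ') := (smul_sub _ _ _).symm
      rw [e, norm_smul, Real.norm_eq_abs, abs_of_pos hn0] at h4
      rw [mul_assoc, le_inv_mul_iff₀ hn0]
      exact h4.trans (mul_le_mul_of_nonneg_right (le_abs_self _) (norm_nonneg _))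
  · simp only [sq_abs]
    exact (hB n hn).2.2.trans (le_max_left _ _)
  · simp only [sq_abs]
    exact (hC n hn).2.2.trans (le_max_right _ _)

variable {B C : ℕ → Z → ℝ} {M : ℝ} [∀ n, IsProbabilityMeasure (μ n)]

lemma highProb_regular (hE : LipschitzEnvelope l μ B C M) :
    HighProb μ fun n ω => ∀ i, RegularLoss l n (ω i) (B n (ω i)) (C n (ω i)) :=
  highProb_of_ae (p := fun n z => RegularLoss l n z (B n z) (C n z)) hE.regular

lemma exists_evProb_curvature_le (hE : LipschitzEnvelope l μ B C M) (hcv : CVConditions l μ θ₀)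
    {τ : ℝ} (hτ : 0 < τ) : ∃ K : ℝ, 0 < K ∧ EvProb μ τ fun n ω =>
      (n : ℝ)⁻¹ * ∑ i, C n (ω i) ^ 2 ≤ K ∧
      (n : ℝ)⁻¹ * ∑ i, ‖(n : ℝ) • hessian (fun t => locLoss l n t (ω i)) θ₀‖ ^ 2 ≤ K := by
  obtain ⟨K, hK, h⟩ := exists_evProb_avg_le (μ := μ) (Y := fun n z => C n z ^ 2)
    (fun n hn => (hE.memLp_right n hn).integrable_sq) (fun _ _ => sq_nonneg _)
    hE.integral_right_le (half_pos hτ)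
  obtain ⟨K', h'⟩ := hcv.hessian_bounded (τ / 2) (half_pos hτ)
  refine ⟨max K K', lt_max_of_lt_left hK, ?_⟩
  have h'' : EvProb μ (τ / 2) fun n ω =>
      (n : ℝ)⁻¹ * ∑ i, ‖(n : ℝ) • hessian (fun t => locLoss l n t (ω i)) θ₀‖ ^ 2 ≤ K' := by
    filter_upwards [h'] with n hn
    refine le_trans (measure_mono fun ω hω => ?_) hn
    exact (not_le.1 hω).trans_le (le_abs_self _)
  have h3 := h.and h'' (half_pos hτ).le (half_pos hτ).le
  rw [add_halves] at h3
  exact h3.mono (Eventually.of_forall fun n ω hω =>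
    ⟨hω.1.trans (le_max_left _ _), hω.2.trans (le_max_right _ _)⟩)

/-- On bounded sets, the gradient of a single loss is nearly constant, even in the sum of squares
over the sample. -/
lemma highProb_gradient_oscillation (hE : LipschitzEnvelope l μ B C M)
    (hcv : CVConditions l μ θ₀) {R κ : ℝ} (hR : 0 ≤ R) (hκ : 0 < κ) :
    HighProb μ fun n ω => ∃ a : Fin n → ℝ, ∑ i, a i ^ 2 ≤ κ ^ 2 ∧
      ∀ i, ∀ x ∈ Metric.closedBall θ₀ R, ‖gradient (fun t => locLoss l n t (ω i)) x -
        gradient (fun t => locLoss l n t (ω i)) θ₀‖ ≤ a i := by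
  intro τ hτ
  obtain ⟨K, hK, h⟩ := exists_evProb_curvature_le hE hcv (half_pos hτ)
  have h1 := h.and (highProb_regular hE (τ / 2) (half_pos hτ)) (half_pos hτ).le (half_pos hτ).le
  rw [add_halves] at h1
  refine h1.mono ?_
  filter_upwards [eventually_ge_atTop 1,
    eventually_div_le (2 * R ^ 2 * (1 + R ^ 2) * K) (by positivity : 0 < κ ^ 2)] with n hn hn' ω hω
  have hn0 : (0 : ℝ) < n := by exact_mod_cast hn
  obtain ⟨⟨h2, h3⟩, h4⟩ := hω
  set η : Fin n → ℝ := fun i => ‖(n : ℝ) • hessian (fun t => locLoss l n t (ω i)) θ₀‖ with hη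
  refine ⟨fun i => (n : ℝ)⁻¹ * ((η i + C n (ω i) * R) * R), ?_, fun i x hx =>
    (h4 i).norm_gradient_sub_le hn (hE.nonneg_right n _) hR hx⟩
  refine le_trans ?_ hn'
  have h5 : ∀ i, ((n : ℝ)⁻¹ * ((η i + C n (ω i) * R) * R)) ^ 2 ≤
      2 * R ^ 2 * (n : ℝ)⁻¹ * ((n : ℝ)⁻¹ * η i ^ 2 + R ^ 2 * ((n : ℝ)⁻¹ * C n (ω i) ^ 2)) := by
    intro i
    have h6 : 0 ≤ ((n : ℝ)⁻¹ * R) ^ 2 * (η i - C n (ω i) * R) ^ 2 := by positivity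
    nlinarith
  refine (Finset.sum_le_sum fun i _ => h5 i).trans ?_
  rw [← Finset.mul_sum, Finset.sum_add_distrib, ← Finset.mul_sum, ← Finset.mul_sum,
    ← Finset.mul_sum]
  calc _ ≤ 2 * R ^ 2 * (n : ℝ)⁻¹ * (K + R ^ 2 * K) := by gcongr
    _ = _ := by field_simp

/-! ### Convergence of the empirical Hessian -/

lemma highProb_secondDiff (hseq : SequenceOfExperiments l μ θ₀ Sig)
    (hnorm : NormalizedLoss l μ θ₀) (hcv : CVConditions l μ θ₀)
    (hE : LipschitzEnvelope l μ B C M) (θ v : Par k) {ε : ℝ} (hε : 0 < ε) :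
    HighProb μ fun n ω => |secondDiff (empLoss l n ω) θ v - ‖v‖ ^ 2| ≤ ε := by
  have h1 := highProb_avg_of_bddInProb (μ := μ)
    (X := fun n z => n * secondDiff (fun t => locLoss l n t z) θ v)
    (B := fun n z => 2 * ‖v‖ ^ 2 * B n z) (M := (2 * ‖v‖ ^ 2) ^ 2 * M) ?_ ?_ ?_ ?_ ?_ (half_pos hε)
  · refine h1.mono ?_
    have h2 := (tendsto_secondDiff_expLoss hseq hnorm hcv θ v).eventually
      (Metric.closedBall_mem_nhds _ (half_pos hε))
    filter_upwards [eventually_ge_atTop 1, h2] with n hn hn2 ω hω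
    have hn0 : (0 : ℝ) < n := by exact_mod_cast hn
    rw [integral_secondDiff_locLoss hseq hn, ← Finset.mul_sum, inv_mul_cancel_left₀ hn0.ne'] at hω
    have e : ∑ i, secondDiff (fun t => locLoss l n t (ω i)) θ v =
        secondDiff (empLoss l n ω) θ v := by
      simp only [secondDiff, empLoss, Finset.sum_sub_distrib, Finset.sum_add_distrib,
        Finset.mul_sum]
    rw [e] at hω
    have hn3 : |secondDiff (expLoss l μ θ₀ n) θ v - ‖v‖ ^ 2| ≤ ε / 2 := hn2
    have := abs_sub_le (secondDiff (empLoss l n ω) θ v) (secondDiff (expLoss l μ θ₀ n) θ v)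
      (‖v‖ ^ 2)
    linarith
  · intro n hn
    exact ((((integrable_locLoss hseq hn _).1.add (integrable_locLoss hseq hn _).1).sub
      ((integrable_locLoss hseq hn _).1.const_mul 2)).const_mul _)
  · intro n hn
    filter_upwards [hE.regular n hn] with z hz
    exact hz.abs_secondDiff_le hn (hE.nonneg_left n z) θ v
  · intro n hn
    exact (hE.memLp_left n hn).const_mul _
  · intro n hn
    simp only [mul_pow _ (B n _)]
    rw [integral_const_mul]
    exact mul_le_mul_of_nonneg_left (hE.integral_left_le n hn) (by positivity)
  · intro τ hτ
    obtain ⟨K, hK, h⟩ := exists_evProb_curvature_le hE hcv (half_pos hτ)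
    have h1 := h.and (highProb_regular hE (τ / 2) (half_pos hτ)) (half_pos hτ).le (half_pos hτ).le
    rw [add_halves] at h1
    refine ⟨2 * (2 * ‖v‖ ^ 3 + (‖θ - θ₀‖ + 1) * ‖v‖ ^ 2) ^ 2 * (K + K), h1.mono ?_⟩
    filter_upwards [eventually_ge_atTop 1] with n hn ω hω
    have hn0 : (0 : ℝ) < n := by exact_mod_cast hn
    obtain ⟨⟨h2, h3⟩, h4⟩ := hω
    refine (mul_le_mul_of_nonneg_left (Finset.sum_le_sum fun i _ =>
      (h4 i).secondDiff_sq_le hn (hE.nonneg_right n _) θ₀ θ v) (inv_nonneg.2 hn0.le)).trans ?_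
    rw [← Finset.mul_sum, Finset.sum_add_distrib, mul_left_comm, mul_add]
    gcongr

/-- A smooth function with Lipschitz Hessian whose second differences are close to those of
`½‖·‖²`, on a net and in finitely many directions, has Hessian close to the identity. -/
lemma norm_hessian_sub_id_le {f : Par k → ℝ} (hf : ContDiff ℝ 2 f) {A ε η : ℝ} (hA : 0 ≤ A)
    (hε : 0 < ε) (hlip : ∀ x y, ‖hessian f x - hessian f y‖ ≤ A * ‖x - y‖) {x θ : Par k}
    (hx : ‖x - θ‖ ≤ η)
    (h1 : ∀ a : Fin k, |secondDiff f θ (ε • EuclideanSpace.single a 1) -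
      ‖(ε • EuclideanSpace.single a 1 : Par k)‖ ^ 2| ≤ ε ^ 3)
    (h2 : ∀ a b : Fin k,
      |secondDiff f θ (ε • (EuclideanSpace.single a 1 + EuclideanSpace.single b 1)) -
      ‖(ε • (EuclideanSpace.single a 1 + EuclideanSpace.single b 1) : Par k)‖ ^ 2| ≤ ε ^ 3) :
    ‖hessian f x - ContinuousLinearMap.id ℝ (Par k)‖ ≤
      A * η + (k : ℝ) ^ 2 * (2 * (ε * (1 + 16 * A))) := by
  have key : ∀ w : Par k, ‖w‖ ≤ 2 → |secondDiff f θ (ε • w) - ‖ε • w‖ ^ 2| ≤ ε ^ 3 →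
      |inner ℝ ((hessian f θ - ContinuousLinearMap.id ℝ (Par k)) w) w| ≤ ε * (1 + 16 * A) := by
    intro w hw h
    have h3 := abs_secondDiff_sub_hessian_le hf hA hlip θ (ε • w)
    have e1 : inner ℝ (hessian f θ (ε • w)) (ε • w) - ‖ε • w‖ ^ 2 =
        ε ^ 2 * inner ℝ ((hessian f θ - ContinuousLinearMap.id ℝ (Par k)) w) w := by
      rw [map_smul, inner_smul_left, inner_smul_right, norm_smul, mul_pow, Real.norm_eq_abs, sq_abs]
      simp only [conj_trivial, sub_apply, ContinuousLinearMap.id_apply,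
        inner_sub_left, real_inner_self_eq_norm_sq]
      ring
    have h4 : ε ^ 2 * |inner ℝ ((hessian f θ - ContinuousLinearMap.id ℝ (Par k)) w) w| ≤
        ε ^ 3 + 2 * A * ‖ε • w‖ ^ 3 := by
      rw [← abs_of_pos (by positivity : 0 < ε ^ 2), ← abs_mul, ← e1]
      have := abs_sub_le (inner ℝ (hessian f θ (ε • w)) (ε • w)) (secondDiff f θ (ε • w))
        (‖ε • w‖ ^ 2)
      rw [abs_sub_comm (inner ℝ (hessian f θ (ε • w)) (ε • w)) (secondDiff f θ (ε • w))] at this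
      linarith
    rw [norm_smul, Real.norm_eq_abs, abs_of_pos hε, mul_pow] at h4
    have h5 : ‖w‖ ^ 3 ≤ 2 ^ 3 := pow_le_pow_left₀ (norm_nonneg _) hw 3
    have h6 : 2 * A * (ε ^ 3 * ‖w‖ ^ 3) ≤ 2 * A * (ε ^ 3 * 2 ^ 3) := by gcongr
    have h7 : ε ^ 2 * |inner ℝ ((hessian f θ - ContinuousLinearMap.id ℝ (Par k)) w) w| ≤
        ε ^ 2 * (ε * (1 + 16 * A)) := by
      refine h4.trans (le_trans (add_le_add le_rfl h6) (le_of_eq ?_))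
      ring
    exact le_of_mul_le_mul_left h7 (by positivity)
  have hs : ∀ a : Fin k, ‖(EuclideanSpace.single a 1 : Par k)‖ ≤ 1 := fun a => by simp
  have hM := norm_le_of_quadratic_form (M := hessian f θ - ContinuousLinearMap.id ℝ (Par k))
    (fun u v => by
      simp only [sub_apply, ContinuousLinearMap.id_apply, inner_sub_left]
      rw [hessian_symm hf, real_inner_comm v u])
    (fun a => key _ ((hs a).trans one_le_two) (h1 a))
    (fun a b => key _ ((norm_add_le _ _).trans (by linarith [hs a, hs b])) (h2 a b))
  have e : hessian f x - ContinuousLinearMap.id ℝ (Par k) = hessian f x - hessian f θ +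
      (hessian f θ - ContinuousLinearMap.id ℝ (Par k)) := by abel
  rw [e]
  exact (norm_add_le _ _).trans (add_le_add ((hlip x θ).trans
    (mul_le_mul_of_nonneg_left hx hA)) hM)

lemma highProb_hessian (hseq : SequenceOfExperiments l μ θ₀ Sig)
    (hnorm : NormalizedLoss l μ θ₀) (hcv : CVConditions l μ θ₀)
    (hE : LipschitzEnvelope l μ B C M) {R κ : ℝ} (hκ : 0 < κ) :
    HighProb μ fun n ω => ∀ x ∈ Metric.closedBall θ₀ R,
      ‖hessian (empLoss l n ω) x - ContinuousLinearMap.id ℝ (Par k)‖ ≤ κ := by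
  intro τ hτ
  obtain ⟨K, hK, h⟩ := exists_evProb_curvature_le hE hcv (half_pos (half_pos hτ))
  set A := 1 + K with hA
  have hA0 : 0 < A := by positivity
  -- mesh of the net, and length of the directions
  set η := κ / (2 * A) with hη
  have hη0 : 0 < η := by positivity
  set ε := κ / (4 * ((k : ℝ) ^ 2 + 1) * (1 + 16 * A)) with hε
  have hε0 : 0 < ε := by positivity
  have hsmall : A * η + (k : ℝ) ^ 2 * (2 * (ε * (1 + 16 * A))) ≤ κ := by
    have e1 : A * η = κ / 2 := by rw [hη]; field_simp
    have e2 : ((k : ℝ) ^ 2 + 1) * (2 * (ε * (1 + 16 * A))) = κ / 2 := by rw [hε]; field_simp; ring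
    have h3 : (0 : ℝ) ≤ 2 * (ε * (1 + 16 * A)) := by positivity
    nlinarith
  obtain ⟨t, -, htf, hcover⟩ := (isCompact_closedBall θ₀ R).finite_cover_balls hη0
  have hnet1 := highProb_forall_finset (μ := μ) (htf.toFinset ×ˢ (Finset.univ : Finset (Fin k)))
    (F := fun q n ω => |secondDiff (empLoss l n ω) q.1 (ε • EuclideanSpace.single q.2 1) -
      ‖(ε • EuclideanSpace.single q.2 1 : Par k)‖ ^ 2| ≤ ε ^ 3)
    (fun q _ => highProb_secondDiff hseq hnorm hcv hE _ _ (by positivity))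
  have hnet2 := highProb_forall_finset (μ := μ)
    (htf.toFinset ×ˢ (Finset.univ : Finset (Fin k × Fin k)))
    (F := fun q n ω => |secondDiff (empLoss l n ω) q.1
        (ε • (EuclideanSpace.single q.2.1 1 + EuclideanSpace.single q.2.2 1)) -
      ‖(ε • (EuclideanSpace.single q.2.1 1 + EuclideanSpace.single q.2.2 1) : Par k)‖ ^ 2| ≤ ε ^ 3)
    (fun q _ => highProb_secondDiff hseq hnorm hcv hE _ _ (by positivity))
  have h1 := h.and (highProb_regular hE (τ / 2 / 2) (by positivity)) (by positivity) (by positivity)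
  rw [add_halves] at h1
  have h2 := h1.and ((hnet1.and hnet2) (τ / 2) (by positivity)) (by positivity) (by positivity)
  rw [add_halves] at h2
  refine h2.mono ?_
  filter_upwards [eventually_ge_atTop 1] with n hn ω hω x hx
  have hn0 : (0 : ℝ) < n := by exact_mod_cast hn
  obtain ⟨⟨⟨h3, -⟩, h4⟩, h5, h6⟩ := hω
  obtain ⟨θ, hθ, hxθ⟩ := Set.mem_iUnion₂.1 (hcover hx)
  have hθ' : θ ∈ htf.toFinset := htf.mem_toFinset.2 hθ
  have hcd : ContDiff ℝ 2 (empLoss l n ω) := by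
    unfold empLoss
    exact ContDiff.sum fun i _ => (h4 i).contDiff_two
  have hlip : ∀ x y, ‖hessian (empLoss l n ω) x - hessian (empLoss l n ω) y‖ ≤ A * ‖x - y‖ := by
    intro x y
    have e : ∀ x, hessian (empLoss l n ω) x = ∑ i, hessian (fun t => locLoss l n t (ω i)) x :=
      fun x => hessian_sum Finset.univ (fun i _ => (h4 i).contDiff_two) x
    rw [e, e, ← Finset.sum_sub_distrib]
    refine (norm_sum_le _ _).trans ((Finset.sum_le_sum fun i _ => (h4 i).hessian_lip x y).trans ?_)
    rw [← Finset.sum_mul, ← Finset.mul_sum]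
    refine mul_le_mul_of_nonneg_right ?_ (norm_nonneg _)
    have h7 : ∑ i, C n (ω i) ≤ ∑ i : Fin n, (1 + C n (ω i) ^ 2) := Finset.sum_le_sum fun i _ => by
      nlinarith [sq_nonneg (C n (ω i) - 1)]
    refine (mul_le_mul_of_nonneg_left h7 (inv_nonneg.2 hn0.le)).trans ?_
    rw [Finset.sum_add_distrib, mul_add]
    simp only [Finset.sum_const, Finset.card_univ, Fintype.card_fin, nsmul_eq_mul, mul_one]
    rw [inv_mul_cancel₀ hn0.ne']
    exact add_le_add le_rfl h3
  exact (norm_hessian_sub_id_le hcd hA0.le hε0 hlip (mem_ball_iff_norm.1 hxθ).le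
    (fun a => h5 (θ, a) (Finset.mem_product.2 ⟨hθ', Finset.mem_univ _⟩))
    (fun a b => h6 (θ, a, b) (Finset.mem_product.2 ⟨hθ', Finset.mem_univ _⟩))).trans hsmall

end Sample

end CVSure

namespace CVSure

/-! ### The scores of the sample -/

section Score

variable {k : ℕ} {Z : Type*} [MeasurableSpace Z] {l : Par k → Z → ℝ} {μ : ℕ → Measure Z}
  {θ₀ : Par k} {Sig : Matrix (Fin k) (Fin k) ℝ} [∀ n, IsProbabilityMeasure (μ n)]

lemma highProb_score_mul (hseq : SequenceOfExperiments l μ θ₀ Sig) (hcv : CVConditions l μ θ₀)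
    {κ : ℝ} (hκ : 0 < κ) : HighProb μ fun n ω => ∀ p q : Fin k,
      |∑ i, gradient (fun t => locLoss l n t (ω i)) θ₀ p *
        gradient (fun t => locLoss l n t (ω i)) θ₀ q - Sig p q| ≤ κ := by
  obtain ⟨M, hM⟩ := exists_integral_norm_score_pow_le hseq hcv
  have hint : ∀ n, 1 ≤ n → Integrable (fun z => ‖score l θ₀ n z‖ ^ 4) (μ n) := fun n hn => by
    have := (memLp_score hseq hcv hn).integrable_norm_pow (p := 4) (by norm_num)
    exact this
  have hsq : ∀ (p q : Fin k) n z, (score l θ₀ n z p * score l θ₀ n z q) ^ 2 ≤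
      ‖score l θ₀ n z‖ ^ 4 := by
    intro p q n z
    have hp : |score l θ₀ n z p| ≤ ‖score l θ₀ n z‖ := PiLp.norm_apply_le (score l θ₀ n z) p
    have hq : |score l θ₀ n z q| ≤ ‖score l θ₀ n z‖ := PiLp.norm_apply_le (score l θ₀ n z) q
    rw [← sq_abs, abs_mul, show (4 : ℕ) = 2 * 2 from rfl, pow_mul, sq ‖score l θ₀ n z‖]
    exact pow_le_pow_left₀ (by positivity)
      (mul_le_mul hp hq (abs_nonneg _) (norm_nonneg _)) 2
  have hL : ∀ (p q : Fin k) n, 1 ≤ n →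
      MemLp (fun z => score l θ₀ n z p * score l θ₀ n z q) 2 (μ n) := by
    intro p q n hn
    have hm : AEStronglyMeasurable (fun z => score l θ₀ n z p * score l θ₀ n z q) (μ n) :=
      (memLp_score_apply hseq hcv hn p).1.mul (memLp_score_apply hseq hcv hn q).1
    rw [memLp_two_iff_integrable_sq hm]
    refine (hint n hn).mono' (hm.pow 2) (Eventually.of_forall fun z => ?_)
    rw [Real.norm_eq_abs, abs_of_nonneg (sq_nonneg _)]
    exact hsq p q n z
  have h := highProb_forall_finset (μ := μ) (Finset.univ : Finset (Fin k × Fin k))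
    (F := fun r n ω => |(n : ℝ)⁻¹ * ∑ i, score l θ₀ n (ω i) r.1 * score l θ₀ n (ω i) r.2 -
      ∫ z, score l θ₀ n z r.1 * score l θ₀ n z r.2 ∂(μ n)| ≤ κ)
    (fun r _ => highProb_avg_of_sq (X := fun n z => score l θ₀ n z r.1 * score l θ₀ n z r.2)
      (hL r.1 r.2) (fun n hn => (integral_mono (hL r.1 r.2 n hn).integrable_sq (hint n hn)
        (hsq r.1 r.2 n)).trans (hM n hn)) hκ)
  refine h.mono ?_
  filter_upwards [eventually_ge_atTop 1] with n hn ω hω p q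
  have hn0 : (0 : ℝ) < n := by exact_mod_cast hn
  have h1 := hω (p, q) (Finset.mem_univ _)
  simp only at h1
  rw [integral_score_mul hseq hcv hn] at h1
  refine le_trans (le_of_eq ?_) h1
  congr 2
  rw [Finset.mul_sum]
  refine Finset.sum_congr rfl fun i _ => ?_
  rw [gradient_locLoss_eq_score hn]
  simp only [PiLp.smul_apply, smul_eq_mul]
  have := Real.mul_self_sqrt hn0.le
  calc _ = (Real.sqrt n * Real.sqrt n)⁻¹ * (score l θ₀ n (ω i) p * score l θ₀ n (ω i) q) := by
        rw [mul_inv]; ring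
    _ = _ := by rw [this]

lemma highProb_norm_score_le (hseq : SequenceOfExperiments l μ θ₀ Sig)
    (hcv : CVConditions l μ θ₀) {κ : ℝ} (hκ : 0 < κ) :
    HighProb μ fun n ω => ∀ i, ‖gradient (fun t => locLoss l n t (ω i)) θ₀‖ ≤ κ := by
  obtain ⟨M, hM⟩ := hcv.score_moment
  refine (highProb_norm_le_sqrt (μ := μ) (s := score l θ₀)
    (fun n hn => aestronglyMeasurable_score hseq hcv hn) hM hκ).mono ?_
  filter_upwards [eventually_ge_atTop 1] with n hn ω hω i
  have hs : 0 < Real.sqrt n := Real.sqrt_pos.2 (by exact_mod_cast hn)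
  rw [gradient_locLoss_eq_score hn, norm_smul, Real.norm_eq_abs, abs_of_pos (inv_pos.2 hs),
    inv_mul_le_iff₀ hs, mul_comm]
  exact hω i

end Score

/-! ### Convexity of the leave-one-out losses -/

section LeaveOneOut

/-- Suppose that the rest of a sample lies in `W`, and that one draw in `G` then puts the sample in
`V`. If `G` has probability at least one half, then it is at most `(m + 1) ν(O)` times as likely as
`V`, up to a factor two, that some draw lies in `O` while the rest lies in `W`. None of the sets
needs to be measurable. -/
lemma measure_exists_rest_mem_le {Z : Type*} [MeasurableSpace Z] {ν : Measure Z}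
    [IsProbabilityMeasure ν] {m : ℕ} {O G : Set Z} {W : Set (Fin m → Z)}
    {V : Set (Fin (m + 1) → Z)}
    (hV : ∀ ω : Fin (m + 1) → Z, ω 0 ∈ G → (fun j => ω (Fin.succAbove 0 j)) ∈ W → ω ∈ V)
    (hG : 1 ≤ 2 * ν G) :
    (Measure.pi fun _ : Fin (m + 1) => ν)
        {ω | ∃ i, ω i ∈ O ∧ (fun j => ω (Fin.succAbove i j)) ∈ W} ≤
      ((m + 1 : ℕ) * ν O) * (2 * (Measure.pi fun _ : Fin (m + 1) => ν) V) := by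
  have hprod : ∀ (i : Fin (m + 1)) (S : Set Z), (Measure.pi fun _ : Fin (m + 1) => ν)
      {ω | ω i ∈ S ∧ (fun j => ω (Fin.succAbove i j)) ∈ W} =
        ν S * (Measure.pi fun _ : Fin m => ν) W := by
    intro i S
    have h := (measurePreserving_piFinSuccAbove (fun _ : Fin (m + 1) => ν) i).measure_preimage_equiv
      (S ×ˢ W)
    rw [Measure.prod_prod] at h
    exact h
  have hW : (Measure.pi fun _ : Fin m => ν) W ≤ 2 * (Measure.pi fun _ : Fin (m + 1) => ν) V := by
    calc _ = 1 * (Measure.pi fun _ : Fin m => ν) W := (one_mul _).symm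
      _ ≤ 2 * ν G * (Measure.pi fun _ : Fin m => ν) W := by gcongr
      _ = 2 * (ν G * (Measure.pi fun _ : Fin m => ν) W) := mul_assoc _ _ _
      _ = 2 * (Measure.pi fun _ : Fin (m + 1) => ν)
          {ω | ω 0 ∈ G ∧ (fun j => ω (Fin.succAbove 0 j)) ∈ W} := by rw [hprod]
      _ ≤ _ := by
          gcongr
          exact fun ω hω => hV ω hω.1 hω.2
  calc _ = (Measure.pi fun _ : Fin (m + 1) => ν)
        (⋃ i, {ω | ω i ∈ O ∧ (fun j => ω (Fin.succAbove i j)) ∈ W}) := by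
        congr 1; ext ω; simp
    _ ≤ ∑ i : Fin (m + 1), ν O * (Measure.pi fun _ : Fin m => ν) W := by
        refine (measure_iUnion_fintype_le _ _).trans (le_of_eq ?_)
        exact Finset.sum_congr rfl fun i _ => hprod i O
    _ = ((m + 1 : ℕ) * ν O) * (Measure.pi fun _ : Fin m => ν) W := by
        rw [Finset.sum_const, Finset.card_univ, Fintype.card_fin, nsmul_eq_mul, mul_assoc]
    _ ≤ _ := by gcongr

lemma sum_erase_eq_sum_succAbove {m : ℕ} (g : Fin (m + 1) → ℝ) (i : Fin (m + 1)) :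
    ∑ j ∈ Finset.univ.erase i, g j = ∑ j, g (Fin.succAbove i j) := by
  have h1 := Finset.add_sum_erase Finset.univ g (Finset.mem_univ i)
  rw [Fin.sum_univ_succAbove g i] at h1
  exact add_left_cancel h1

/-- Removing a summand whose gradient is Lipschitz with a small constant preserves strong
convexity. -/
lemma StrongMono.erase {k : ℕ} {ι : Type*} [Fintype ι] [DecidableEq ι] {f : ι → Par k → ℝ}
    {c b : ℝ} (h : StrongMono c fun θ => ∑ j, f j θ) (hf : ∀ j, Differentiable ℝ (f j)) (i : ι)
    (hb : ∀ x y, ‖gradient (f i) x - gradient (f i) y‖ ≤ b * ‖x - y‖) :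
    StrongMono (c - b) fun θ => ∑ j ∈ Finset.univ.erase i, f j θ := by
  intro x y
  have hg : ∀ x, gradient (fun θ => ∑ j ∈ Finset.univ.erase i, f j θ) x =
      gradient (fun θ => ∑ j, f j θ) x - gradient (f i) x := by
    intro x
    rw [gradient_sum _ (fun j _ => hf j), gradient_sum _ (fun j _ => hf j),
      Finset.sum_erase_eq_sub (Finset.mem_univ i)]
  have h1 := h x y
  have h2 := (real_inner_le_norm (gradient (f i) x - gradient (f i) y) (x - y)).trans
    (mul_le_mul_of_nonneg_right (hb x y) (norm_nonneg _))
  have e : gradient (fun θ => ∑ j, f j θ) x - gradient (f i) x -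
      (gradient (fun θ => ∑ j, f j θ) y - gradient (f i) y) =
      gradient (fun θ => ∑ j, f j θ) x - gradient (fun θ => ∑ j, f j θ) y -
      (gradient (f i) x - gradient (f i) y) := by abel
  rw [hg, hg, e, inner_sub_left]
  nlinarith

variable {k : ℕ} {Z : Type*} [MeasurableSpace Z] {l : Par k → Z → ℝ} {μ : ℕ → Measure Z}
  {B C : ℕ → Z → ℝ} {M : ℝ} [∀ n, IsProbabilityMeasure (μ n)]

lemma measure_outlier_le (hE : LipschitzEnvelope l μ B C M) {b : ℝ} (hb : 0 < b) {n : ℕ}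
    (hn : 1 ≤ n) : μ n {z | b * Real.sqrt n ≤ B n z} ≤ ENNReal.ofReal (M / b ^ 2 / n) := by
  have hn0 : (0 : ℝ) < n := by exact_mod_cast hn
  have h := mul_meas_ge_le_integral_of_nonneg (μ := μ n) (f := fun z => B n z ^ 2)
    (Eventually.of_forall fun z => sq_nonneg _) (hE.memLp_left n hn).integrable_sq (b ^ 2 * n)
  have h1 : (μ n).real {z | b ^ 2 * n ≤ B n z ^ 2} ≤ M / b ^ 2 / n := by
    rw [div_div, le_div_iff₀ (by positivity), mul_comm]
    exact h.trans (hE.integral_left_le n hn)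
  refine le_trans (measure_mono fun z hz => ?_) ((ENNReal.le_ofReal_iff_toReal_le
    (measure_ne_top _ _) (measureReal_nonneg.trans h1)).2 h1)
  have h2 := pow_le_pow_left₀ (by positivity) (show b * Real.sqrt n ≤ B n z from hz) 2
  rw [mul_pow, Real.sq_sqrt hn0.le] at h2
  exact h2

/-- All leave-one-out losses are strongly convex with high probability. Removing an observation
matters only if the Lipschitz constant of its score is of order `√n`. The expected number of such
outliers is bounded, and an outlier is independent of the rest of the sample, whose loss is strongly
convex with high probability because it would be so after adding a typical observation. -/
lemma highProb_strongMono_erase (hE : LipschitzEnvelope l μ B C M) {c : ℝ} (hc : 0 < c)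
    (h : HighProb μ fun n ω => StrongMono c (empLoss l n ω)) :
    HighProb μ fun n ω => ∀ i, StrongMono (c / 2) (looLoss l n ω i) := by
  set D : ℝ := |M| / (c / 2) ^ 2 with hD
  have hD0 : 0 ≤ D := by positivity
  intro τ hτ
  set τ' := τ / (2 * D + 1) / 2 with hτ'
  have hτ'0 : 0 < τ' := by positivity
  have hall := (h τ' hτ'0).and (highProb_regular hE τ' hτ'0) hτ'0.le hτ'0.le
  filter_upwards [hall, eventually_ge_atTop 1, eventually_div_le D (half_pos one_pos)]
    with n hVn hn hDn
  obtain ⟨m, rfl⟩ : ∃ m, n = m + 1 := ⟨n - 1, by omega⟩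
  have hn0 : (0 : ℝ) < (m + 1 : ℕ) := by positivity
  have hs : 0 < Real.sqrt (m + 1 : ℕ) := Real.sqrt_pos.2 hn0
  set f : Z → Par k → ℝ := fun z t => locLoss l (m + 1) t z with hf
  set O : Set Z := {z | c / 2 * Real.sqrt (m + 1 : ℕ) ≤ B (m + 1) z} with hO
  set Reg : Set Z := {z | RegularLoss l (m + 1) z (B (m + 1) z) (C (m + 1) z)} with hReg
  set V : Set (Fin (m + 1) → Z) := {ω | ¬ (StrongMono c (empLoss l (m + 1) ω) ∧
    ∀ i, ω i ∈ Reg)} with hVdef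
  -- the remaining observations are regular, but their loss is not strongly convex
  set W : Set (Fin m → Z) := {w | (∀ j, w j ∈ Reg) ∧
    ¬ StrongMono (c / 2) fun θ => ∑ j, f (w j) θ} with hW
  have hOm : μ (m + 1) O ≤ ENNReal.ofReal (D / (m + 1 : ℕ)) := by
    refine (measure_outlier_le hE (half_pos hc) hn).trans (ENNReal.ofReal_le_ofReal ?_)
    rw [hD]
    gcongr
    exact le_abs_self M
  have hgood : ∀ (ω : Fin (m + 1) → Z) i, StrongMono c (empLoss l (m + 1) ω) →
      (∀ i, ω i ∈ Reg) → ω i ∉ O → StrongMono (c / 2) (looLoss l (m + 1) ω i) := by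
    intro ω i h1 h2 h3
    have h4 : (Real.sqrt (m + 1 : ℕ))⁻¹ * B (m + 1) (ω i) ≤ c / 2 := by
      rw [inv_mul_le_iff₀ hs, mul_comm]
      exact (not_le.1 h3).le
    have h5 := StrongMono.erase (f := fun j => f (ω j)) h1 (fun j => (h2 j).differentiable) i
      (b := c / 2) (fun x y => ((h2 i).gradient_lip x y).trans
        (mul_le_mul_of_nonneg_right h4 (norm_nonneg _)))
    rwa [sub_half] at h5
  have hloo : ∀ (ω : Fin (m + 1) → Z) i, looLoss l (m + 1) ω i =
      fun θ => ∑ j, f (ω (Fin.succAbove i j)) θ := fun ω i =>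
    funext fun θ => sum_erase_eq_sum_succAbove (fun j => f (ω j) θ) i
  have hG : 1 ≤ 2 * μ (m + 1) (Reg \ O) := by
    have h1 : (1 : ℝ≥0∞) ≤ μ (m + 1) (Reg \ O) + ENNReal.ofReal (1 / 2) := by
      have h2 : μ (m + 1) Regᶜ = 0 := hE.regular (m + 1) hn
      calc (1 : ℝ≥0∞) = μ (m + 1) Set.univ := measure_univ.symm
        _ ≤ μ (m + 1) ((Reg \ O) ∪ O ∪ Regᶜ) := measure_mono fun z _ => by
            by_cases h3 : z ∈ Reg <;> by_cases h4 : z ∈ O <;> simp [h3, h4]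
        _ ≤ μ (m + 1) (Reg \ O) + μ (m + 1) O + μ (m + 1) Regᶜ :=
            (measure_union_le _ _).trans (add_le_add (measure_union_le _ _) le_rfl)
        _ ≤ _ := by
            rw [h2, add_zero]
            exact add_le_add le_rfl (hOm.trans (ENNReal.ofReal_le_ofReal hDn))
    have h5 : ENNReal.ofReal (1 / 2) = 2⁻¹ := by
      rw [one_div, ENNReal.ofReal_inv_of_pos two_pos]; simp
    rw [h5] at h1
    have h6 : (2 : ℝ≥0∞)⁻¹ ≤ μ (m + 1) (Reg \ O) := by
      have h7 : (2 : ℝ≥0∞)⁻¹ + 2⁻¹ ≤ μ (m + 1) (Reg \ O) + 2⁻¹ := by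
        rwa [ENNReal.inv_two_add_inv_two]
      exact (ENNReal.add_le_add_iff_right (by simp)).1 h7
    calc (1 : ℝ≥0∞) = 2 * 2⁻¹ := (ENNReal.mul_inv_cancel two_ne_zero (by simp)).symm
      _ ≤ _ := by gcongr
  have hVle : sampleLaw μ (m + 1) V ≤ ENNReal.ofReal (τ' + τ') := hVn
  have hmain := measure_exists_rest_mem_le (ν := μ (m + 1)) (O := O) (G := Reg \ O) (W := W) (V := V)
    (fun ω h1 h2 hcon => by
      obtain ⟨h3, h4⟩ := hcon
      refine h2.2 ?_
      have h5 := hgood ω 0 h3 h4 h1.2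
      rwa [hloo] at h5) hG
  have hsub : {ω | ¬ ∀ i, StrongMono (c / 2) (looLoss l (m + 1) ω i)} ⊆
      V ∪ {ω | ∃ i, ω i ∈ O ∧ (fun j => ω (Fin.succAbove i j)) ∈ W} := by
    intro ω hω
    by_cases h1 : ω ∈ V
    · exact Or.inl h1
    · right
      obtain ⟨h2, h3⟩ := not_not.1 h1
      obtain ⟨i, hi⟩ := not_forall.1 hω
      refine ⟨i, by_contra fun h4 => hi (hgood ω i h2 h3 h4), fun j => h3 _, ?_⟩
      rwa [hloo] at hi
  have hDm : ((m + 1 : ℕ) : ℝ≥0∞) * μ (m + 1) O ≤ ENNReal.ofReal D := by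
    calc _ ≤ ((m + 1 : ℕ) : ℝ≥0∞) * ENNReal.ofReal (D / (m + 1 : ℕ)) := by gcongr
      _ = ENNReal.ofReal D := by
        rw [← ENNReal.ofReal_natCast, ← ENNReal.ofReal_mul hn0.le, mul_div_cancel₀ _ hn0.ne']
  calc _ ≤ sampleLaw μ (m + 1) V + sampleLaw μ (m + 1)
          {ω | ∃ i, ω i ∈ O ∧ (fun j => ω (Fin.succAbove i j)) ∈ W} :=
        (measure_mono hsub).trans (measure_union_le _ _)
    _ ≤ ENNReal.ofReal (τ' + τ') + ENNReal.ofReal D * (2 * ENNReal.ofReal (τ' + τ')) := by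
        refine add_le_add hVle (hmain.trans ?_)
        gcongr
        exact hVle
    _ = ENNReal.ofReal τ := by
        have h2 : (2 : ℝ≥0∞) = ENNReal.ofReal 2 := by simp
        rw [h2, ← ENNReal.ofReal_mul zero_le_two, ← ENNReal.ofReal_mul hD0,
          ← ENNReal.ofReal_add (by positivity) (by positivity)]
        congr 1
        rw [hτ']
        field_simp
        ring

end LeaveOneOut

end CVSure

namespace CVSure

/-! ### Convergence of cross-validation -/

section Estimator

variable {k : ℕ}

lemma gradient_argmin_eq_zero {c : ℝ} {f : Par k → ℝ} (hc : StrongMono c f) (hc0 : 0 < c)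
    (hf : Differentiable ℝ f) : gradient f (argmin f) = 0 := by
  have h0 : IsPenalty fun _ : Par k => (0 : ℝ) :=
    ⟨convexOn_const 0 convex_univ, continuous_const, fun _ => le_rfl, rfl⟩
  obtain ⟨x, hx⟩ := exists_minimizer hc hc0 hf h0 le_rfl
  simp only [mul_zero, add_zero] at hx
  have hmin : IsLocalMin f (argmin f) := Eventually.of_forall (argmin_spec ⟨x, hx⟩)
  rw [gradient, hmin.fderiv_eq_zero, map_zero]

/-- A zero of a gradient which is close to the gradient of `½‖·‖²` is close to a Newton step. -/
lemma lt_abs_inner_sub_of_gradient_eq_zero {f : Par k → ℝ} {θ₀ th v : Par k} {b ρ κ R₀ : ℝ}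
    (hth : gradient f th = 0) (hth0 : ‖th‖ ≤ R₀) (hθ₀ : ‖θ₀‖ ≤ R₀) (hκ : 0 ≤ κ)
    (hquad : ‖gradient f th - gradient f θ₀ - (th - θ₀)‖ ≤ κ * ‖th - θ₀‖)
    (hfar : 2 * ρ < |inner ℝ (gradient f θ₀) v - (inner ℝ v θ₀ - b)|)
    (hsmall : κ * (2 * R₀) * ‖v‖ ≤ ρ) : ρ < |inner ℝ v th - b| := by
  have h1 : ‖th - θ₀‖ ≤ 2 * R₀ := (norm_sub_le _ _).trans (by linarith)
  have h2 : ‖gradient f th - gradient f θ₀ - (th - θ₀)‖ ≤ κ * (2 * R₀) :=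
    hquad.trans (mul_le_mul_of_nonneg_left h1 hκ)
  have h3 := (abs_real_inner_le_norm (gradient f th - gradient f θ₀ - (th - θ₀)) v).trans
    ((mul_le_mul_of_nonneg_right h2 (norm_nonneg _)).trans hsmall)
  have e : inner ℝ (gradient f th - gradient f θ₀ - (th - θ₀)) v =
      -(inner ℝ (gradient f θ₀) v - (inner ℝ v θ₀ - b)) - (inner ℝ v th - b) := by
    rw [hth, zero_sub, inner_sub_left, inner_neg_left, inner_sub_left, real_inner_comm v th,
      real_inner_comm v θ₀]
    ring
  rw [e] at h3
  have h4 := abs_sub_abs_le_abs_sub (-(inner ℝ (gradient f θ₀) v - (inner ℝ v θ₀ - b)))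
    (inner ℝ v th - b)
  rw [abs_neg] at h4
  linarith

end Estimator

section Convergence

variable {k : ℕ} {Z : Type*} [MeasurableSpace Z] {l : Par k → Z → ℝ} {μ : ℕ → Measure Z}
  {θ₀ : Par k} {Sig : Matrix (Fin k) (Fin k) ℝ} {B C : ℕ → Z → ℝ} {M : ℝ}
  [∀ n, IsProbabilityMeasure (μ n)]

lemma exists_highProb_strongMono (hE : LipschitzEnvelope l μ B C M) (hcv : CVConditions l μ θ₀) :
    ∃ c : ℝ, 0 < c ∧ HighProb μ fun n ω => StrongMono c (empLoss l n ω) := by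
  obtain ⟨c, hc, h⟩ := hcv.strongly_convex
  refine ⟨c, hc, ((highProb_iff_tendsto.2 h).and (highProb_regular hE)).mono
    (Eventually.of_forall fun n ω hω => strongMono_of_hessian ?_ hω.1)⟩
  unfold empLoss
  exact ContDiff.sum fun i _ => (hω.2 i).contDiff_two

/-- With a nondegenerate score variance, the central limit theorem keeps the normalized score away
from any finite set of hyperplanes. -/
lemma exists_evProb_gradient_far (hseq : SequenceOfExperiments l μ θ₀ Sig)
    (hcv : CVConditions l μ θ₀) (hE : LipschitzEnvelope l μ B C M) (Q : Finset (Par k × ℝ))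
    (hQ : ∀ q ∈ Q, q.1 ≠ 0) (hSig : Q = ∅ ∨ Sig.PosDef) {τ : ℝ} (hτ : 0 < τ) :
    ∃ ρ : ℝ, 0 < ρ ∧ EvProb μ τ fun n ω => ∀ q ∈ Q,
      ρ < |inner ℝ (gradient (empLoss l n ω) θ₀) q.1 - (inner ℝ q.1 θ₀ - q.2)| := by
  rcases hSig with rfl | hSig
  · exact ⟨1, one_pos, Eventually.of_forall fun n => by simp⟩
  obtain ⟨M', hM'⟩ := exists_integral_norm_score_pow_le hseq hcv
  have hsingle : ∀ q : Par k × ℝ, q.1 ≠ 0 → ∀ τ : ℝ, 0 < τ → ∃ ρ : ℝ, 0 < ρ ∧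
      EvProb μ τ fun n ω =>
        ρ < |inner ℝ (gradient (empLoss l n ω) θ₀) q.1 - (inner ℝ q.1 θ₀ - q.2)| := by
    intro q hq τ hτ
    have hpos : 0 < (q.1 : Fin k → ℝ) ⬝ᵥ (Sig.mulVec (q.1 : Fin k → ℝ)) := by
      have hq' : (q.1 : Fin k → ℝ) ≠ 0 := fun h => hq (by ext a; exact congrFun h a)
      simpa using hSig.dotProduct_mulVec_pos hq'
    obtain ⟨ρ, hρ, h⟩ := exists_evProb_sum_far (μ := μ) (Y := fun n z =>
        inner ℝ (score l θ₀ n z) q.1) (M := ‖q.1‖ ^ 4 * M') hpos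
      (fun n hn => memLp_inner_score hseq hcv hn q.1)
      (fun n hn => integral_inner_score hseq hcv hn q.1)
      (fun n hn => integral_inner_score_sq hseq hcv hn q.1)
      (fun n hn => by
        have hint : Integrable (fun z => ‖score l θ₀ n z‖ ^ 4) (μ n) :=
          (memLp_score hseq hcv hn).integrable_norm_pow (p := 4) (by norm_num)
        have hint' : Integrable (fun z => |inner ℝ (score l θ₀ n z) q.1| ^ 4) (μ n) :=
          (memLp_inner_score hseq hcv hn q.1).integrable_norm_pow (p := 4) (by norm_num)
        refine (integral_mono hint' (hint.const_mul (‖q.1‖ ^ 4)) fun z => ?_).trans ?_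
        · show |inner ℝ (score l θ₀ n z) q.1| ^ 4 ≤ ‖q.1‖ ^ 4 * ‖score l θ₀ n z‖ ^ 4
          rw [mul_comm, ← mul_pow]
          exact pow_le_pow_left₀ (abs_nonneg _) (abs_real_inner_le_norm _ _) 4
        · rw [integral_const_mul]
          exact mul_le_mul_of_nonneg_left (hM' n hn) (by positivity))
      (inner ℝ q.1 θ₀ - q.2) (half_pos hτ)
    have h2 := h.and (highProb_regular hE (τ / 2) (half_pos hτ)) (half_pos hτ).le (half_pos hτ).le
    rw [add_halves] at h2
    refine ⟨ρ, hρ, h2.mono ?_⟩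
    filter_upwards [eventually_ge_atTop 1] with n hn ω hω
    have e : inner ℝ (gradient (empLoss l n ω) θ₀) q.1 =
        (Real.sqrt n)⁻¹ * ∑ i, inner ℝ (score l θ₀ n (ω i)) q.1 := by
      have e1 : gradient (empLoss l n ω) θ₀ =
          ∑ i, gradient (fun t => locLoss l n t (ω i)) θ₀ :=
        gradient_sum Finset.univ (fun i _ => (hω.2 i).differentiable) θ₀
      rw [e1, sum_inner, Finset.mul_sum]
      refine Finset.sum_congr rfl fun i _ => ?_
      rw [gradient_locLoss_eq_score hn, inner_smul_left]
      rfl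
    rw [e]
    exact hω.1
  induction Q using Finset.induction_on generalizing τ with
  | empty => exact ⟨1, one_pos, Eventually.of_forall fun n => by simp⟩
  | insert q Q _ ih =>
    obtain ⟨ρ, hρ, h⟩ := hsingle q (hQ q (Finset.mem_insert_self _ _)) (τ / 2) (half_pos hτ)
    obtain ⟨ρ', hρ', h'⟩ := ih (fun r hr => hQ r (Finset.mem_insert_of_mem hr)) (half_pos hτ)
    have h2 := h.and h' (half_pos hτ).le (half_pos hτ).le
    rw [add_halves] at h2
    refine ⟨min ρ ρ', lt_min hρ hρ', h2.mono (Eventually.of_forall fun n ω hω r hr => ?_)⟩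
    rcases Finset.mem_insert.1 hr with rfl | hr
    · exact (min_le_left _ _).trans_lt hω.1
    · exact (min_le_right _ _).trans_lt (hω.2 r hr)

lemma highProb_abs_cv_sub_le {pen : Par k → ℝ} {Lam : Set ℝ}
    (hseq : SequenceOfExperiments l μ θ₀ Sig) (hnorm : NormalizedLoss l μ θ₀)
    (hpen : IsRidge pen Lam ∨ (IsLasso pen Lam ∧ Sig.PosDef))
    (herm : ERMConditions l μ) (hcv : CVConditions l μ θ₀) {ε : ℝ} (hε : 0 < ε) :
    HighProb μ fun n ω => ∀ lam ∈ Lam,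
      |cv l pen n ω lam - (empLoss l n ω (erm l n ω) + 1 / 2 * Sig.trace)
        - 1 / 2 * sure pen Sig lam (erm l n ω)| ≤ ε := by
  intro τ hτ
  obtain ⟨hp, hl, Q, hQ, hSig⟩ := penalty_facts hpen
  obtain ⟨B, C, M, hE⟩ := exists_lipschitzEnvelope hcv
  obtain ⟨c, hc, hmono⟩ := exists_highProb_strongMono hE hcv
  have hτ3 : 0 < τ / 3 := by positivity
  obtain ⟨K, hK⟩ := herm.bounded (τ / 3) hτ3
  have hbdd : EvProb μ (τ / 3) fun n ω => ‖erm l n ω‖ ≤ K := by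
    filter_upwards [hK] with n hn
    refine le_trans (measure_mono fun ω hω => ?_) hn
    exact (not_le.1 hω).trans_le (le_abs_self _)
  obtain ⟨ρ, hρ, hfar⟩ := exists_evProb_gradient_far hseq hcv hE Q hQ.1 hSig hτ3
  obtain ⟨δ, hδ, hloc⟩ := hQ.2 (ρ / 2) (half_pos hρ)
  set R₀ : ℝ := max K ‖θ₀‖ with hR₀
  have hR₀0 : 0 ≤ R₀ := (norm_nonneg θ₀).trans (le_max_right _ _)
  set R : ℝ := 4 * R₀ / (c / 2) + 2 * R₀ + 1 with hR
  have hRpos : 0 < R := by positivity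
  set T : ℝ := |Sig.trace| + k with hT
  have hT0 : 0 ≤ T := by positivity
  set A : ℝ := (3 * T + 3) / (c / 2) + T + 1 + (k : ℝ) ^ 2 + 10 * R ^ 2 with hA
  have hA0 : 0 < A := by positivity
  set N : ℝ := ∑ q ∈ Q, ‖q.1‖ with hN
  have hN0 : 0 ≤ N := Finset.sum_nonneg fun q _ => norm_nonneg _
  -- the accuracy to which all limits have to be attained
  obtain ⟨κ, hκ, hκ1, hκc, hκR, hκδ, hκA, hκN⟩ : ∃ κ : ℝ, 0 < κ ∧ κ ≤ 1 ∧ κ ≤ c / 2 / 2 ∧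
      κ ≤ δ / (4 * R) ∧ κ ≤ δ / 6 ∧ κ ≤ ε / A ∧ κ ≤ ρ / 2 / (2 * R₀ * N + 1) := by
    have h1 : ∀ x : ℝ, 0 < x → ∀ᶠ κ : ℝ in 𝓝[>] 0, κ ≤ x := fun x hx =>
      mem_nhdsWithin_of_mem_nhds (Iic_mem_nhds hx)
    have h2 : 0 < ρ / 2 / (2 * R₀ * N + 1) := by positivity
    obtain ⟨κ, h⟩ := ((((((h1 1 one_pos).and (h1 (c / 2 / 2) (by positivity))).and
      (h1 (δ / (4 * R)) (by positivity))).and (h1 (δ / 6) (by positivity))).and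
      (h1 (ε / A) (by positivity))).and ((h1 _ h2).and self_mem_nhdsWithin)).exists
    exact ⟨κ, h.2.2, h.1.1.1.1.1, h.1.1.1.1.2, h.1.1.1.2, h.1.1.2, h.1.2, h.2.1⟩
  have hall := (((((highProb_regular hE).and hmono).and (highProb_strongMono_erase hE hc hmono)).and
    ((highProb_score_mul hseq hcv hκ).and (highProb_norm_score_le hseq hcv hκ))).and
    ((highProb_gradient_oscillation hE hcv hRpos.le hκ).and
      (highProb_hessian hseq hnorm hcv hE (R := R) hκ))) (τ / 3) hτ3
  have hev := (hall.and hbdd hτ3.le hτ3.le).and hfar (by positivity) hτ3.le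
  have e3 : τ / 3 + τ / 3 + τ / 3 = τ := by ring
  rw [e3] at hev
  refine hev.mono (Eventually.of_forall fun n ω hω lam hlam => ?_)
  obtain ⟨⟨⟨⟨⟨⟨hreg, hL⟩, hLi⟩, hS, hσ⟩, ⟨a, hasum, ha⟩, hhess⟩, hth0⟩, hQfar⟩ := hω
  have hθ₀ : ‖θ₀‖ ≤ R₀ := le_max_right _ _
  have hth1 : ‖erm l n ω‖ ≤ R₀ := hth0.trans (le_max_left _ _)
  have hcd : ContDiff ℝ 2 (empLoss l n ω) := by
    unfold empLoss
    exact ContDiff.sum fun i _ => (hreg i).contDiff_two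
  have hth : gradient (empLoss l n ω) (erm l n ω) = 0 :=
    gradient_argmin_eq_zero hL hc (hcd.differentiable (by norm_num))
  have hquad : ∀ x ∈ Metric.closedBall θ₀ R, ∀ y ∈ Metric.closedBall θ₀ R,
      ‖gradient (empLoss l n ω) x - gradient (empLoss l n ω) y - (x - y)‖ ≤ κ * ‖x - y‖ :=
    fun x hx y hy => norm_gradient_sub_le_of_hessian hcd (convex_closedBall θ₀ R) hhess hx hy
  have hthR : erm l n ω ∈ Metric.closedBall θ₀ R := by
    rw [mem_closedBall_iff_norm]
    have h1 := norm_sub_le (erm l n ω) θ₀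
    have h2 : 0 ≤ 4 * R₀ / (c / 2) := by positivity
    rw [hR]
    linarith
  have hsum : ∑ i, ‖gradient (fun t => locLoss l n t (ω i)) θ₀‖ ^ 2 ≤ T := by
    simp only [EuclideanSpace.real_norm_sq_eq]
    rw [Finset.sum_comm]
    have h1 : ∀ p : Fin k, ∑ i, gradient (fun t => locLoss l n t (ω i)) θ₀ p ^ 2 ≤ Sig p p + 1 := by
      intro p
      have h2 := (abs_le.1 (hS p p)).2
      simp only [← sq] at h2
      linarith
    refine (Finset.sum_le_sum fun p _ => h1 p).trans ?_
    rw [Finset.sum_add_distrib, hT]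
    simp only [Finset.sum_const, Finset.card_univ, Fintype.card_fin, nsmul_eq_mul, mul_one]
    exact add_le_add (le_abs_self Sig.trace) le_rfl
  obtain ⟨P, hP, hP'⟩ := hloc (erm l n ω) (fun q hq => by
    refine lt_abs_inner_sub_of_gradient_eq_zero hth hth1 hθ₀ hκ.le
      (hquad _ hthR _ (Metric.mem_closedBall_self hRpos.le)) ?_ ?_
    · rw [mul_div_cancel₀ _ two_ne_zero]
      exact hQfar q hq
    · have h1 : ‖q.1‖ ≤ N := Finset.single_le_sum (f := fun q : Par k × ℝ => ‖q.1‖)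
        (fun _ _ => norm_nonneg _) hq
      rw [le_div_iff₀ (by positivity)] at hκN
      calc _ ≤ κ * (2 * R₀) * N := by gcongr
        _ ≤ κ * (2 * R₀ * N + 1) := by linarith
        _ ≤ _ := hκN) lam hlam
  refine (cv_sub_sure_le (f := fun i θ => locLoss l n θ (ω i)) (a := a) (half_pos hc) hT0 hδ hR₀0 hR
    hκ hκ1 hκc hκR hκδ hp (hl lam hlam) (fun i => (hreg i).differentiable)
    (fun x y => le_trans (by gcongr; linarith) (hL x y)) hLi hth hth1 hθ₀ ha hasum hσ hS hsum hquad
    hP hP').trans ?_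
  rw [le_div_iff₀ hA0, mul_comm] at hκA
  exact hκA

end Convergence

end CVSure

theorem mainTheorem3 {k : ℕ} {Z : Type*} [MeasurableSpace Z]
    (l : Par k → Z → ℝ) (μ : ℕ → Measure Z) [∀ n, IsProbabilityMeasure (μ n)]
    (θ₀ : Par k) (Sig : Matrix (Fin k) (Fin k) ℝ) (pen : Par k → ℝ) (Lam : Set ℝ)
    (hseq : SequenceOfExperiments l μ θ₀ Sig)
    (hnorm : NormalizedLoss l μ θ₀)
    (hpen : IsRidge pen Lam ∨ (IsLasso pen Lam ∧ Sig.PosDef))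
    (herm : ERMConditions l μ)
    (hcv : CVConditions l μ θ₀) :
    ∀ ε : ℝ, 0 < ε →
      Tendsto
        (fun n : ℕ => sampleLaw μ n
          {ω | ENNReal.ofReal ε < ⨆ lam ∈ Lam, ENNReal.ofReal
            |cv l pen n ω lam - (empLoss l n ω (erm l n ω) + 1 / 2 * Sig.trace)
              - 1 / 2 * sure pen Sig lam (erm l n ω)|})
        atTop (𝓝 0) := by
  intro ε hε
  have h := highProb_iff_tendsto.1 (highProb_abs_cv_sub_le hseq hnorm hpen herm hcv hε)
  refine tendsto_of_tendsto_of_tendsto_of_le_of_le tendsto_const_nhds h (fun _ => zero_le)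
    fun n => measure_mono fun ω hω hle => ?_
  exact absurd hω (not_lt.2 (iSup₂_le fun lam hlam => ENNReal.ofReal_le_ofReal (hle lam hlam)))
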